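/- Let $\mathbb H_j=\{z_j=x_j+iy_j : y_j>0\}$ $(j=1,2)$ and $\Omega=\mathbb H_1\times\mathbb H_2\subset\mathbb C^2$. Let $f=f_1\,d\bar z_1+f_2\,d\bar z_2$ be a $(0,1)$-form whose coefficients are Schwartz functions on $\overline\Omega$ (smooth on $\overline\Omega$, every derivative decaying faster than every power), and let $u=u_1\,d\bar z_1+u_2\,d\bar z_2$ be the solution of the $\bar\partial$-Neumann problem on $\Omega$ with data $f$. That is, for $\{j,k\}=\{1,2\}$, $u_j\in C^2(\Omega)$ satisfies $$\Delta u_j=-2f_j\quad\text{in }\Omega,\qquad u_j=0\ \text{ on } y_j=0,\qquad \frac{\partial u_j}{\partial\bar z_k}=0\ \text{ on } y_k=0,$$ where $u_j$ and $\partial u_j/\partial\bar z_k$ belong to $L^p(\Omega)$ for some $p\in(2,\infty)$, and the boundary conditions mean that, for some $q\in(2,4)$ and some $q'\in(2,\infty)$, the $L^{q}$ norm of $u_j$ over the slice $\{y_j=s\}\cap\Omega$ and the $L^{q'}$ norm of $\partial u_j/\partial\bar z_k$ over the slice $\{y_k=s\}\cap\Omega$ tend to $0$ as $s\to0^+$.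 Write $h^{o12}$ for the extension of a function $h$ on $\Omega$ that is odd in $y_1$ and in $y_2$, and $$F.T._x\,h(\xi,y)=\int_{\mathbb R^2}h(x,y)\,e^{-ix\cdot\xi}\,dx .$$ Then for every $n\in\mathbb N$ there are polynomials $A_n,B_n,C_n$ in $(y_1,y_2)$ of degree at most $n$, whose coefficients are Schwartz functions of $\xi=(\xi_1,\xi_2)\in\mathbb R^2$, a function $d_n\in C^n(\overline\Omega)$ with $d_n(\cdot,y)\in L^1(\mathbb R^2)$ for all $y_1,y_2>0$, and an $\varepsilon>0$ such that, with $D_n=F.T._x\,d_n$, for all $0<y_1,y_2<\varepsilon$ the function $\big(\frac{\partial u_1}{\partial\bar z_2}\big)^{o12}(\cdot,y)$ is integrable on $\mathbb R^2$ and, for all $\xi\in\mathbb R^2$, $$F.T._x\Big(\frac{\partial u_1}{\partial\bar z_2}\Big)^{o12}(\xi,y)=A_n(\xi,y)\log(y_1^2+y_2^2)+B_n(\xi,y)+C_n(\xi,y)\arctan\Big(\frac{y_1}{y_2}\Big)+D_n(\xi,y).$$ -/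

import Mathlib

open MeasureTheory Filter Topology
open scoped ContDiff SchwartzMap

namespace DbarNeumann

/-- `ℝ²`, with its Euclidean structure. -/
abbrev R2 : Type := EuclideanSpace ℝ (Fin 2)

/-- `ℂ² = ℝ⁴`: the coordinate `Sum.inl j` is `x_j` and the coordinate `Sum.inr j` is `y_j`, where
`z_j = x_j + i y_j`. The index `j : Fin 2` is `0` for the first and `1` for the second variable. -/
abbrev C2 : Type := EuclideanSpace ℝ (Fin 2 ⊕ Fin 2)

/-- The point of `ℂ²` with real part `x = (x₁, x₂)` and imaginary part `y = (y₁, y₂)`. -/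
noncomputable def pt (x y : R2) : C2 := WithLp.toLp 2 (Sum.elim (fun j => x j) (fun j => y j))

/-- The product `ℍ₁ × ℍ₂` of two half-planes: `y₁ > 0` and `y₂ > 0`. -/
def Omega : Set C2 := {z | ∀ j : Fin 2, 0 < z (Sum.inr j)}

/-- The Wirtinger derivative `∂h/∂z̄_k = (∂h/∂x_k + i ∂h/∂y_k) / 2`. -/
noncomputable def dbar (k : Fin 2) (h : C2 → ℂ) (z : C2) : ℂ :=
  (1 / 2 : ℂ) *
    (fderiv ℝ h z (EuclideanSpace.single (Sum.inl k) 1) +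
      Complex.I * fderiv ℝ h z (EuclideanSpace.single (Sum.inr k) 1))

/-- Schwartz functions on a closed set `K` (used for the closure of `Omega`): smooth up to the
boundary, all derivatives decaying faster than every power. -/
def IsSchwartzOn (K : Set C2) (h : C2 → ℂ) : Prop :=
  ContDiffOn ℝ ∞ h K ∧
    ∀ k n : ℕ, ∃ M : ℝ, ∀ z ∈ K, ‖z‖ ^ k * ‖iteratedFDerivWithin ℝ n h K z‖ ≤ M

/-- The `L^q` norm of the restriction of `h` to the slice `{y_j = s} ∩ Omega`, that is, the norm in
the three variables `x₁`, `x₂` and `t = y_k > 0`, where `k ≠ j`. -/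
noncomputable def sliceNorm (j : Fin 2) (q : ENNReal) (h : C2 → ℂ) (s : ℝ) : ENNReal :=
  eLpNorm
    (fun w : R2 × ℝ => h (pt w.1 (WithLp.toLp 2 (Function.update (fun _ => w.2) j s))))
    q (volume.restrict {w : R2 × ℝ | 0 < w.2})

/-- The form `u = u₁ dz̄₁ + u₂ dz̄₂` is the solution of the `∂̄`-Neumann problem on `Omega` with data
`f = f₁ dz̄₁ + f₂ dz̄₂`: for `j ≠ k` the component `u_j` satisfies `Δ u_j = -2 f_j` in `Omega`, both
`u_j` and `∂u_j/∂z̄_k` lie in `L^p(Omega)` for an exponent `p ∈ (2, ∞)`, and the boundary conditions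
`u_j = 0` on `y_j = 0` and `∂u_j/∂z̄_k = 0` on `y_k = 0` hold in the sense that the `L^q` norms of
the slices tend to zero. On `Omega` there is exactly one such `u`, and it has the listed properties for all
the admissible exponents; only one exponent is asked for here. -/
structure IsSolution (f u : Fin 2 → C2 → ℂ) : Prop where
  contDiffOn : ∀ j, ContDiffOn ℝ 2 (u j) Omega
  laplacian_eq : ∀ j, ∀ z ∈ Omega, Laplacian.laplacian (u j) z = -2 * f j z
  memLp : ∀ j k, j ≠ k → ∃ p : ENNReal, 2 < p ∧ p < ⊤ ∧
    MemLp (u j) p (volume.restrict Omega) ∧ MemLp (dbar k (u j)) p (volume.restrict Omega)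
  boundary_dirichlet : ∀ j, ∃ q : ENNReal, 2 < q ∧ q < 4 ∧
    Tendsto (sliceNorm j q (u j)) (𝓝[>] 0) (𝓝 0)
  boundary_dbar : ∀ j k, j ≠ k → ∃ q : ENNReal, 2 < q ∧ q < ⊤ ∧
    Tendsto (sliceNorm k q (dbar k (u j))) (𝓝[>] 0) (𝓝 0)

/-- The extension `h^{o12}` of a function on `Omega` that is odd in `y₁` and odd in `y₂`. -/
noncomputable def oddExt (h : C2 → ℂ) (z : C2) : ℂ :=
  ((Real.sign (z (Sum.inr 0)) * Real.sign (z (Sum.inr 1)) : ℝ) : ℂ) *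
    h (pt (WithLp.toLp 2 (fun j => z (Sum.inl j))) (WithLp.toLp 2 (fun j => |z (Sum.inr j)|)))

/-- The partial Fourier transform in the `x` variables,
`∫ h(x, y) e^{-i x·ξ} dx`, as a function of `ξ` and `y`. -/
noncomputable def partialFT (h : C2 → ℂ) (ξ y : R2) : ℂ :=
  ∫ x : R2, Complex.exp (-Complex.I * ((inner ℝ x ξ : ℝ) : ℂ)) * h (pt x y)

/-- The polynomial `∑_{a + b ≤ n} c_{ab}(ξ) y₁^a y₂^b` of degree (at most) `n` in `(y₁, y₂)`, whose
coefficients are Schwartz functions of `ξ`. -/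
noncomputable def schwartzPoly (n : ℕ) (c : ℕ → ℕ → 𝓢(R2, ℂ)) (ξ : R2) (y₁ y₂ : ℝ) : ℂ :=
  ∑ d ∈ Finset.range (n + 1), ∑ ab ∈ Finset.HasAntidiagonal.antidiagonal d,
    c ab.1 ab.2 ξ * (y₁ : ℂ) ^ ab.1 * (y₂ : ℂ) ^ ab.2

end DbarNeumann

/-! Put `w = ∂u₁/∂z̄₂`. Differentiating the equation gives `Δw = -R` with `R = 2 ∂f₁/∂z̄₂`, which is
smooth up to the boundary and rapidly decreasing. Both boundary conditions become Dirichlet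
conditions for `w`: on `y₂ = 0` this is assumed, and on `y₁ = 0` the derivative `∂/∂z̄₂` is
tangential, so that `u₁ = 0` forces `w = 0`. Thus `w` solves a Dirichlet problem on the product of
`ℝ²` with a quarter-plane, and logarithms can only come from the corner `y₁ = y₂ = 0`.

An explicit `v`, vanishing on both faces, is built with `Δv = S - R` and `S` flat to order `n + 1`
at the boundary (`exists_corrector`). Taylor correctors `-y_j^(k+2)/(k+2)!` times the `k`-th normal
derivative of the residual flatten it face by face. Those for `y₁ = 0` leave multiples of `y₁^k`, `k
≥ 2`, on the other face near the corner. These are cancelled by sums `∑ (-Δ_x)^j c · Q_j`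
(`exists_isCorner`), where `Q_0` is harmonic in the quadrant with boundary values `0` and `y₁^k`,
and `ΔQ_{j+1} = Q_j` with zero boundary values. With `z = y₂ + i y₁` one may take for `Q_0` a
multiple of `Im z^k` if `k` is odd. If `k` is even, this function vanishes on both axes, and the
resonance requires `Im (z^k log z)`. Hence the terms `log |z|²` and `arg z = arctan (y₁/y₂)`; the
terms of degree greater than `n` are of class `C^n`.

The difference `H = w - v` satisfies `-ΔH = S` weakly, with null boundary values. Let the Dirichlet
heat kernel at `a` evolve from time `0` to `∞`: its pairing with `H` starts at `H a`, tends to `0`,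
and has as derivative minus its pairing with `S`. So `H` is the alternating sum, over the four
reflections in the faces, of the heat potential of `S` extended by zero (`representation`), and this
potential is of class `C^n` on the whole space. Since the boundary conditions only say that slice
norms tend to zero, the kernel is truncated at distance `s` from the faces; the truncation errors
live on strips `s ≤ y_j ≤ 2 s` and vanish in the limit (`FaceNull`, `weak_identity`).

Close to the corner the cutoffs are `1`, and the Fourier transform in `x` sends the Schwartz
coefficients of the expansion to Schwartz functions of `ξ`. -/

namespace DbarNeumann

/-! ### Regularity with rapid decay on closed sets, and flatness on subsets -/

section Decay

variable {E : Type*} [NormedAddCommGroup E] {K S : Set E} {h h' : E → ℂ}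

/-- Continuous on `K` and decaying faster than every power. -/
def Dec0 (K : Set E) (h : E → ℂ) : Prop :=
  ContinuousOn h K ∧ ∀ k : ℕ, ∃ M : ℝ, ∀ z ∈ K, (1 + ‖z‖) ^ k * ‖h z‖ ≤ M

theorem Dec0.bound (hh : Dec0 K h) (k : ℕ) :
    ∃ M : ℝ, 0 ≤ M ∧ ∀ z ∈ K, (1 + ‖z‖) ^ k * ‖h z‖ ≤ M := by
  obtain ⟨M, hM⟩ := hh.2 k
  exact ⟨max M 0, le_max_right _ _, fun z hz => (hM z hz).trans (le_max_left _ _)⟩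

theorem Dec0.congr (hh : Dec0 K h) (e : Set.EqOn h' h K) : Dec0 K h' := by
  refine ⟨hh.1.congr e, fun k => ?_⟩
  obtain ⟨M, hM⟩ := hh.2 k
  exact ⟨M, fun z hz => by rw [e hz]; exact hM z hz⟩

theorem Dec0.add (h1 : Dec0 K h) (h2 : Dec0 K h') : Dec0 K (fun z => h z + h' z) := by
  refine ⟨h1.1.add h2.1, fun k => ?_⟩
  obtain ⟨M, hM⟩ := h1.2 k
  obtain ⟨M', hM'⟩ := h2.2 k
  refine ⟨M + M', fun z hz => ?_⟩
  calc (1 + ‖z‖) ^ k * ‖h z + h' z‖ ≤ (1 + ‖z‖) ^ k * (‖h z‖ + ‖h' z‖) := by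
        gcongr; exact norm_add_le _ _
    _ ≤ M + M' := by rw [mul_add]; exact add_le_add (hM z hz) (hM' z hz)

theorem Dec0.const_mul (h1 : Dec0 K h) (c : ℂ) : Dec0 K (fun z => c * h z) := by
  refine ⟨continuousOn_const.mul h1.1, fun k => ?_⟩
  obtain ⟨M, hM⟩ := h1.2 k
  refine ⟨‖c‖ * M, fun z hz => ?_⟩
  rw [norm_mul, mul_left_comm]
  exact mul_le_mul_of_nonneg_left (hM z hz) (norm_nonneg _)

theorem Dec0.zero : Dec0 K (fun _ => 0) :=
  ⟨continuousOn_const, fun _ => ⟨0, fun z _ => by simp⟩⟩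

variable [NormedSpace ℝ E]

/-- The derivative of `h` along `v`, within `K`. -/
noncomputable def pd (K : Set E) (v : E) (h : E → ℂ) : E → ℂ := fun z => fderivWithin ℝ h K z v

/-- `N` times differentiable on `K`, all the derivatives being continuous on `K` and decaying faster
than every power. -/
def Dec : ℕ → Set E → (E → ℂ) → Prop
  | 0, K, h => Dec0 K h
  | N + 1, K, h => Dec0 K h ∧ DifferentiableOn ℝ h K ∧ ∀ v, Dec N K (pd K v h)

/-- All derivatives of `h` of order less than `M` vanish on `S`. -/
def Flat (K S : Set E) : ℕ → (E → ℂ) → Prop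
  | 0, _ => True
  | M + 1, h => (∀ z ∈ S, h z = 0) ∧ ∀ v, Flat K S M (pd K v h)

theorem pd_congr (e : Set.EqOn h' h K) (v : E) : Set.EqOn (pd K v h') (pd K v h) K := by
  intro z hz
  simp only [pd]
  rw [fderivWithin_congr e (e hz)]

theorem Dec.dec0 : ∀ {N : ℕ}, Dec N K h → Dec0 K h
  | 0, hh => hh
  | _ + 1, hh => hh.1

theorem Dec.differentiableOn {N : ℕ} (hh : Dec (N + 1) K h) : DifferentiableOn ℝ h K := hh.2.1

theorem Dec.pd {N : ℕ} (hh : Dec (N + 1) K h) (v : E) : Dec N K (pd K v h) := hh.2.2 v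

theorem Dec.succ : ∀ {N : ℕ} {h : E → ℂ}, Dec (N + 1) K h → Dec N K h
  | 0, _, hh => hh.1
  | _ + 1, _, hh => ⟨hh.1, hh.2.1, fun v => (hh.2.2 v).succ⟩

theorem Dec.mono {N M : ℕ} (hNM : N ≤ M) (hh : Dec M K h) : Dec N K h := by
  induction M, hNM using Nat.le_induction with
  | base => exact hh
  | succ M _ ih => exact ih hh.succ

theorem Dec.congr : ∀ {N : ℕ} {h h' : E → ℂ}, Dec N K h → Set.EqOn h' h K → Dec N K h'
  | 0, _, _, hh, e => Dec0.congr hh e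
  | _ + 1, _, _, hh, e => ⟨Dec0.congr hh.1 e, hh.2.1.congr e,
      fun v => (hh.2.2 v).congr (pd_congr e v)⟩

/-- To prove membership in `Dec (N + 1)`, it suffices to exhibit a derivative. -/
theorem Dec.of_hasFDerivWithinAt (hK : UniqueDiffOn ℝ K) {N : ℕ} (h0 : Dec0 K h)
    (D : E → E →L[ℝ] ℂ) (hD : ∀ z ∈ K, HasFDerivWithinAt h (D z) K z)
    (hN : ∀ v, Dec N K (fun z => D z v)) : Dec (N + 1) K h :=
  ⟨h0, fun z hz => (hD z hz).differentiableWithinAt, fun v => (hN v).congr fun z hz => by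
    simp only [DbarNeumann.pd]
    rw [(hD z hz).fderivWithin (hK z hz)]⟩

theorem pd_add (hK : UniqueDiffOn ℝ K) (h1 : DifferentiableOn ℝ h K)
    (h2 : DifferentiableOn ℝ h' K) (v : E) :
    Set.EqOn (pd K v (fun z => h z + h' z)) (fun z => pd K v h z + pd K v h' z) K := by
  intro z hz
  simp only [pd]
  rw [fderivWithin_fun_add (hK z hz) (h1 z hz) (h2 z hz)]
  rfl

theorem pd_const_mul (hK : UniqueDiffOn ℝ K) (h1 : DifferentiableOn ℝ h K) (c : ℂ) (v : E) :
    Set.EqOn (pd K v (fun z => c * h z)) (fun z => c * pd K v h z) K := by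
  intro z hz
  simp only [pd]
  rw [((h1 z hz).hasFDerivWithinAt.const_mul c).fderivWithin (hK z hz)]
  rfl

theorem Dec.add (hK : UniqueDiffOn ℝ K) : ∀ {N : ℕ} {h h' : E → ℂ}, Dec N K h → Dec N K h' →
    Dec N K (fun z => h z + h' z)
  | 0, _, _, h1, h2 => Dec0.add h1 h2
  | _ + 1, _, _, h1, h2 => ⟨Dec0.add h1.1 h2.1, h1.2.1.add h2.2.1, fun v =>
      (Dec.add hK (h1.2.2 v) (h2.2.2 v)).congr (pd_add hK h1.2.1 h2.2.1 v)⟩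

theorem Dec.const_mul (hK : UniqueDiffOn ℝ K) (c : ℂ) : ∀ {N : ℕ} {h : E → ℂ}, Dec N K h →
    Dec N K (fun z => c * h z)
  | 0, _, h1 => Dec0.const_mul h1 c
  | _ + 1, _, h1 => ⟨Dec0.const_mul h1.1 c, h1.2.1.const_mul c, fun v =>
      (Dec.const_mul hK c (h1.2.2 v)).congr (pd_const_mul hK h1.2.1 c v)⟩

theorem Dec.zero (hK : UniqueDiffOn ℝ K) : ∀ {N : ℕ}, Dec N K (fun _ => (0 : ℂ))
  | 0 => Dec0.zero
  | _ + 1 => Dec.of_hasFDerivWithinAt hK Dec0.zero (fun _ => 0)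
      (fun z _ => hasFDerivWithinAt_const 0 z K) (fun _ => Dec.zero hK)

theorem Dec.sum (hK : UniqueDiffOn ℝ K) {ι : Type*} (s : Finset ι) {N : ℕ} {f : ι → E → ℂ}
    (hf : ∀ i ∈ s, Dec N K (f i)) : Dec N K (fun z => ∑ i ∈ s, f i z) := by
  classical
  induction s using Finset.induction_on with
  | empty => simpa using Dec.zero hK
  | insert a s ha ih =>
    simp only [Finset.sum_insert ha]
    exact Dec.add hK (hf a (by simp)) (ih fun i hi => hf i (by simp [hi]))

theorem Dec.contDiffOn [FiniteDimensional ℝ E] : ∀ {N : ℕ} {h : E → ℂ}, Dec N K h →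
    ContDiffOn ℝ N h K
  | 0, _, hh => by
    simpa using (contDiffOn_zero (𝕜 := ℝ)).2 hh.1
  | N + 1, h, hh => by
    push_cast
    exact contDiffOn_succ_of_fderiv_apply hh.2.1 (by simp) fun v => (hh.2.2 v).contDiffOn

theorem Flat.congr : ∀ {M : ℕ} {h h' : E → ℂ}, S ⊆ K → Flat K S M h → Set.EqOn h' h K →
    Flat K S M h'
  | 0, _, _, _, _, _ => trivial
  | _ + 1, _, _, hS, hh, e => ⟨fun z hz => by rw [e (hS hz)]; exact hh.1 z hz,
      fun v => Flat.congr hS (hh.2 v) (pd_congr e v)⟩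

theorem Flat.succ : ∀ {M : ℕ} {h : E → ℂ}, Flat K S (M + 1) h → Flat K S M h
  | 0, _, _ => trivial
  | _ + 1, _, hh => ⟨hh.1, fun v => (hh.2 v).succ⟩

theorem Flat.mono {N M : ℕ} (hNM : N ≤ M) (hh : Flat K S M h) : Flat K S N h := by
  induction M, hNM using Nat.le_induction with
  | base => exact hh
  | succ M _ ih => exact ih hh.succ

theorem Flat.subset {T : Set E} (hT : T ⊆ S) : ∀ {M : ℕ} {h : E → ℂ}, Flat K S M h → Flat K T M h
  | 0, _, _ => trivial
  | _ + 1, _, hh => ⟨fun z hz => hh.1 z (hT hz), fun v => (hh.2 v).subset hT⟩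

theorem Flat.add (hK : UniqueDiffOn ℝ K) (hS : S ⊆ K) : ∀ {M : ℕ} {h h' : E → ℂ}, Flat K S M h →
    Flat K S M h' → Dec M K h → Dec M K h' → Flat K S M (fun z => h z + h' z)
  | 0, _, _, _, _, _, _ => trivial
  | _ + 1, _, _, h1, h2, d1, d2 => ⟨fun z hz => by simp [h1.1 z hz, h2.1 z hz], fun v =>
      (Flat.add hK hS (h1.2 v) (h2.2 v) (d1.2.2 v) (d2.2.2 v)).congr hS
        (pd_add hK d1.2.1 d2.2.1 v)⟩

theorem Flat.const_mul (hK : UniqueDiffOn ℝ K) (hS : S ⊆ K) (c : ℂ) : ∀ {M : ℕ} {h : E → ℂ},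
    Flat K S M h → Dec M K h → Flat K S M (fun z => c * h z)
  | 0, _, _, _ => trivial
  | _ + 1, _, h1, d1 => ⟨fun z hz => by simp [h1.1 z hz], fun v =>
      (Flat.const_mul hK hS c (h1.2 v) (d1.2.2 v)).congr hS (pd_const_mul hK d1.2.1 c v)⟩

theorem Flat.zero (hK : UniqueDiffOn ℝ K) (hS : S ⊆ K) : ∀ {M : ℕ}, Flat K S M (fun _ => (0 : ℂ))
  | 0 => trivial
  | _ + 1 => ⟨fun _ _ => rfl, fun v => (Flat.zero hK hS).congr hS fun z _ => by simp [pd]⟩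

theorem Flat.sum (hK : UniqueDiffOn ℝ K) (hS : S ⊆ K) {ι : Type*} (s : Finset ι) {N : ℕ}
    {f : ι → E → ℂ} (hf : ∀ i ∈ s, Flat K S N (f i)) (hd : ∀ i ∈ s, Dec N K (f i)) :
    Flat K S N (fun z => ∑ i ∈ s, f i z) := by
  classical
  induction s using Finset.induction_on with
  | empty => simpa using Flat.zero hK hS
  | insert a s ha ih =>
    simp only [Finset.sum_insert ha]
    exact Flat.add hK hS (hf a (by simp)) (ih (fun i hi => hf i (by simp [hi]))
      fun i hi => hd i (by simp [hi])) (hd a (by simp))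
      (Dec.sum hK s fun i hi => hd i (by simp [hi]))

section Tensor

variable {E₁ E₂ : Type*} [NormedAddCommGroup E₁] [NormedSpace ℝ E₁] [NormedAddCommGroup E₂]
  [NormedSpace ℝ E₂] {K₁ : Set E₁} {K₂ : Set E₂} {L₁ : E →L[ℝ] E₁} {L₂ : E →L[ℝ] E₂}
  {f₁ : E₁ → ℂ} {f₂ : E₂ → ℂ}

/-- Since `1 + ‖z‖` is at most the product of the weights of the two components, each power of the
weight splits between the factors. -/
theorem Dec0.tensor (m₁ : Set.MapsTo L₁ K K₁) (m₂ : Set.MapsTo L₂ K K₂)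
    (hL : ∀ z, ‖z‖ ≤ ‖L₁ z‖ + ‖L₂ z‖) (h₁ : Dec0 K₁ f₁) (h₂ : Dec0 K₂ f₂) :
    Dec0 K (fun z => f₁ (L₁ z) * f₂ (L₂ z)) := by
  refine ⟨(h₁.1.comp L₁.continuous.continuousOn m₁).mul
    (h₂.1.comp L₂.continuous.continuousOn m₂), fun k => ?_⟩
  obtain ⟨M₁, p₁, hM₁⟩ := h₁.bound k
  obtain ⟨M₂, p₂, hM₂⟩ := h₂.bound k
  refine ⟨M₁ * M₂, fun z hz => ?_⟩
  have a₁ := hM₁ _ (m₁ hz)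
  have a₂ := hM₂ _ (m₂ hz)
  have key : 1 + ‖z‖ ≤ (1 + ‖L₁ z‖) * (1 + ‖L₂ z‖) := by
    nlinarith [hL z, mul_nonneg (norm_nonneg (L₁ z)) (norm_nonneg (L₂ z))]
  calc (1 + ‖z‖) ^ k * ‖f₁ (L₁ z) * f₂ (L₂ z)‖
      ≤ ((1 + ‖L₁ z‖) * (1 + ‖L₂ z‖)) ^ k * ‖f₁ (L₁ z) * f₂ (L₂ z)‖ := by gcongr
    _ = ((1 + ‖L₁ z‖) ^ k * ‖f₁ (L₁ z)‖) * ((1 + ‖L₂ z‖) ^ k * ‖f₂ (L₂ z)‖) := by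
        rw [mul_pow, norm_mul]; ring
    _ ≤ M₁ * M₂ := by gcongr

theorem hasFDerivWithinAt_tensor (m₁ : Set.MapsTo L₁ K K₁) (m₂ : Set.MapsTo L₂ K K₂)
    (h₁ : DifferentiableOn ℝ f₁ K₁) (h₂ : DifferentiableOn ℝ f₂ K₂) {z : E} (hz : z ∈ K) :
    HasFDerivWithinAt (fun z => f₁ (L₁ z) * f₂ (L₂ z))
      (f₁ (L₁ z) • (fderivWithin ℝ f₂ K₂ (L₂ z)).comp L₂ +
        f₂ (L₂ z) • (fderivWithin ℝ f₁ K₁ (L₁ z)).comp L₁) K z :=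
  ((h₁ _ (m₁ hz)).hasFDerivWithinAt.comp z L₁.hasFDerivWithinAt m₁).mul
    ((h₂ _ (m₂ hz)).hasFDerivWithinAt.comp z L₂.hasFDerivWithinAt m₂)

theorem pd_tensor (hK : UniqueDiffOn ℝ K) (m₁ : Set.MapsTo L₁ K K₁) (m₂ : Set.MapsTo L₂ K K₂)
    (h₁ : DifferentiableOn ℝ f₁ K₁) (h₂ : DifferentiableOn ℝ f₂ K₂) (v : E) :
    Set.EqOn (pd K v (fun z => f₁ (L₁ z) * f₂ (L₂ z)))
      (fun z => pd K₁ (L₁ v) f₁ (L₁ z) * f₂ (L₂ z) + f₁ (L₁ z) * pd K₂ (L₂ v) f₂ (L₂ z)) K := by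
  intro z hz
  simp only [pd]
  rw [(hasFDerivWithinAt_tensor m₁ m₂ h₁ h₂ hz).fderivWithin (hK z hz)]
  simp
  ring

theorem Dec.tensor (hK : UniqueDiffOn ℝ K) (m₁ : Set.MapsTo L₁ K K₁) (m₂ : Set.MapsTo L₂ K K₂)
    (hL : ∀ z, ‖z‖ ≤ ‖L₁ z‖ + ‖L₂ z‖) : ∀ {N : ℕ} {f₁ : E₁ → ℂ} {f₂ : E₂ → ℂ}, Dec N K₁ f₁ →
    Dec N K₂ f₂ → Dec N K (fun z => f₁ (L₁ z) * f₂ (L₂ z))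
  | 0, _, _, h₁, h₂ => Dec0.tensor m₁ m₂ hL h₁ h₂
  | N + 1, f₁, f₂, h₁, h₂ => by
    refine ⟨Dec0.tensor m₁ m₂ hL h₁.dec0 h₂.dec0, fun z hz =>
      (hasFDerivWithinAt_tensor m₁ m₂ h₁.2.1 h₂.2.1 hz).differentiableWithinAt, fun v => ?_⟩
    refine Dec.congr ?_ (pd_tensor hK m₁ m₂ h₁.2.1 h₂.2.1 v)
    exact Dec.add hK (Dec.tensor hK m₁ m₂ hL (h₁.2.2 _) h₂.succ)
      (Dec.tensor hK m₁ m₂ hL h₁.succ (h₂.2.2 _))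

/-- By the product rule every derivative leaves on `f₂` at least as much vanishing as is still
required; of `f₁` only regularity is used. -/
theorem Flat.tensor_right (hK : UniqueDiffOn ℝ K) (hS : S ⊆ K) (m₁ : Set.MapsTo L₁ K K₁)
    (m₂ : Set.MapsTo L₂ K K₂) (hL : ∀ z, ‖z‖ ≤ ‖L₁ z‖ + ‖L₂ z‖) {S₂ : Set E₂}
    (s₂ : Set.MapsTo L₂ S S₂) : ∀ {N : ℕ} {f₁ : E₁ → ℂ} {f₂ : E₂ → ℂ}, Dec N K₁ f₁ →
    Dec N K₂ f₂ → Flat K₂ S₂ N f₂ → Flat K S N (fun z => f₁ (L₁ z) * f₂ (L₂ z))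
  | 0, _, _, _, _, _ => trivial
  | N + 1, f₁, f₂, h₁, h₂, hf => by
    refine ⟨fun z hz => by simp [hf.1 _ (s₂ hz)], fun v => ?_⟩
    refine Flat.congr hS ?_ (pd_tensor hK m₁ m₂ h₁.2.1 h₂.2.1 v)
    exact Flat.add hK hS
      (Flat.tensor_right hK hS m₁ m₂ hL s₂ (h₁.2.2 _) h₂.succ hf.succ)
      (Flat.tensor_right hK hS m₁ m₂ hL s₂ h₁.succ (h₂.2.2 _) (hf.2 _))
      (Dec.tensor hK m₁ m₂ hL (h₁.2.2 _) h₂.succ) (Dec.tensor hK m₁ m₂ hL h₁.succ (h₂.2.2 _))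

end Tensor

/-- Directional derivatives commute. -/
theorem pd_comm [FiniteDimensional ℝ E] (hK : UniqueDiffOn ℝ K) (hc : K ⊆ closure (interior K))
    (hh : ContDiffOn ℝ 2 h K) (v w : E) :
    Set.EqOn (pd K v (pd K w h)) (pd K w (pd K v h)) K := by
  intro z hz
  have hs := ((hh z hz).isSymmSndFDerivWithinAt (by simp) hK (hc hz) hz) v w
  have hd : DifferentiableWithinAt ℝ (fderivWithin ℝ h K) K z :=
    ((hh.fderivWithin hK (m := 1) (by norm_num)).differentiableOn (by norm_num)) z hz
  have key : ∀ a b : E, pd K a (pd K b h) z = fderivWithin ℝ (fderivWithin ℝ h K) K z a b := by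
    intro a b
    have := (hd.hasFDerivWithinAt.clm_apply (hasFDerivWithinAt_const b z K)).fderivWithin (hK z hz)
    change fderivWithin ℝ (fun y => fderivWithin ℝ h K y b) K z a = _
    rw [this]
    simp
  rw [key, key, hs]

theorem Dec.pd_comm [FiniteDimensional ℝ E] (hK : UniqueDiffOn ℝ K)
    (hc : K ⊆ closure (interior K)) {N : ℕ} (hh : Dec (N + 2) K h) (v w : E) :
    Set.EqOn (DbarNeumann.pd K v (DbarNeumann.pd K w h))
      (DbarNeumann.pd K w (DbarNeumann.pd K v h)) K :=
  DbarNeumann.pd_comm hK hc (by exact_mod_cast (hh.mono (N := 2) (by lia)).contDiffOn) v w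

theorem pd_eq_fderiv {z : E} (hz : K ∈ 𝓝 z) (v : E) : pd K v h z = fderiv ℝ h z v := by
  simp only [pd, fderivWithin_of_mem_nhds hz]

theorem pd_pd_eq_fderiv {z : E} (hz : z ∈ interior K) (v w : E) :
    pd K v (pd K w h) z = fderiv ℝ (fun y => fderiv ℝ h y w) z v := by
  rw [pd_eq_fderiv (mem_interior_iff_mem_nhds.1 hz)]
  have : pd K w h =ᶠ[𝓝 z] fun y => fderiv ℝ h y w := by
    filter_upwards [isOpen_interior.mem_nhds hz] with y hy
    exact pd_eq_fderiv (mem_interior_iff_mem_nhds.1 hy) w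
  rw [this.fderiv_eq]

/-- The Laplacian in the directions `e i`. -/
noncomputable def lap {ι : Type*} [Fintype ι] (K : Set E) (e : ι → E) (h : E → ℂ) : E → ℂ :=
  fun z => ∑ i, pd K (e i) (pd K (e i) h) z

theorem Dec.lap {ι : Type*} [Fintype ι] (hK : UniqueDiffOn ℝ K) (e : ι → E) {N : ℕ}
    (hh : Dec (N + 2) K h) : Dec N K (lap K e h) :=
  Dec.sum hK _ fun i _ => (hh.pd (e i)).pd (e i)

theorem Flat.lap {ι : Type*} [Fintype ι] (hK : UniqueDiffOn ℝ K) (hS : S ⊆ K) (e : ι → E) {N : ℕ}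
    (hh : Dec (N + 2) K h) (hf : Flat K S (N + 2) h) : Flat K S N (lap K e h) :=
  Flat.sum hK hS _ (fun i _ => (hf.2 (e i)).2 (e i)) fun i _ => (hh.pd (e i)).pd (e i)

theorem lap_congr {ι : Type*} [Fintype ι] (e : ι → E) (q : Set.EqOn h' h K) :
    Set.EqOn (lap K e h') (lap K e h) K := fun z hz => by
  simp only [lap]
  exact Finset.sum_congr rfl fun i _ => pd_congr (pd_congr q _) _ hz

theorem lap_add {ι : Type*} [Fintype ι] (hK : UniqueDiffOn ℝ K) (e : ι → E)
    (h1 : DifferentiableOn ℝ h K) (h1' : ∀ v, DifferentiableOn ℝ (pd K v h) K)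
    (h2 : DifferentiableOn ℝ h' K) (h2' : ∀ v, DifferentiableOn ℝ (pd K v h') K) :
    Set.EqOn (lap K e (fun z => h z + h' z)) (fun z => lap K e h z + lap K e h' z) K :=
  fun z hz => by
  simp only [lap, ← Finset.sum_add_distrib]
  refine Finset.sum_congr rfl fun i _ => ?_
  rw [pd_congr (pd_add hK h1 h2 _) _ hz, pd_add hK (h1' _) (h2' _) _ hz]

theorem lap_const_mul {ι : Type*} [Fintype ι] (hK : UniqueDiffOn ℝ K) (e : ι → E)
    (h1 : DifferentiableOn ℝ h K) (h1' : ∀ v, DifferentiableOn ℝ (pd K v h) K) (c : ℂ) :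
    Set.EqOn (lap K e (fun z => c * h z)) (fun z => c * lap K e h z) K :=
  fun z hz => by
  simp only [lap, Finset.mul_sum]
  refine Finset.sum_congr rfl fun i _ => ?_
  rw [pd_congr (pd_const_mul hK h1 c _) _ hz, pd_const_mul hK (h1' _) c _ hz]

end Decay


/-! ### Product functions and the integrable weight on `ℝ⁴` -/

section Product

/-- The real coordinates of `C2`. -/
abbrev Ix : Type := Fin 2 ⊕ Fin 2

/-- The coordinate vectors of `C2`. -/
noncomputable def bv (i : Ix) : C2 := EuclideanSpace.single i 1

/-- The integrable weight `1 / (1 + τ ^ 2)`. -/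
noncomputable def m1 (τ : ℝ) : ℝ := (1 + τ ^ 2)⁻¹

/-- A product of functions of one coordinate each. -/
noncomputable def prodFn (α : Ix → ℝ → ℝ) (z : C2) : ℝ := ∏ i, α i (z i)

/-- The product weight on `C2`. -/
noncomputable def wt : C2 → ℝ := prodFn fun _ => m1

theorem m1_pos (τ : ℝ) : 0 < m1 τ := by unfold m1; positivity

theorem m1_le_one (τ : ℝ) : m1 τ ≤ 1 := by
  unfold m1
  exact inv_le_one_of_one_le₀ (by nlinarith [sq_nonneg τ])

theorem continuous_m1 : Continuous m1 := by
  unfold m1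
  exact Continuous.inv₀ (by fun_prop) fun τ => by positivity

theorem integrable_m1 : Integrable m1 := integrable_inv_one_add_sq

theorem wt_pos (z : C2) : 0 < wt z := by
  unfold wt prodFn
  exact Finset.prod_pos fun _ _ => m1_pos _

theorem wt_le_one (z : C2) : wt z ≤ 1 := by
  unfold wt prodFn
  exact Finset.prod_le_one (fun _ _ => (m1_pos _).le) fun _ _ => m1_le_one _

theorem integrable_prodFn {α : Ix → ℝ → ℝ} (h : ∀ i, Integrable (α i)) :
    Integrable (prodFn α) := by
  have := (Integrable.fintype_prod (f := α) (μ := fun _ => volume) h)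
  rw [← volume_pi] at this
  exact (PiLp.volume_preserving_ofLp Ix).integrable_comp_of_integrable this

theorem integral_prodFn (α : Ix → ℝ → ℝ) : ∫ z, prodFn α z = ∏ i, ∫ τ, α i τ := by
  rw [← integral_fintype_prod_volume_eq_prod]
  exact (PiLp.volume_preserving_ofLp Ix).integral_comp
    (MeasurableEquiv.toLp 2 (Ix → ℝ)).symm.measurableEmbedding (fun x => ∏ i, α i (x i))

theorem continuous_prodFn {α : Ix → ℝ → ℝ} (h : ∀ i, Continuous (α i)) :
    Continuous (prodFn α) := by
  unfold prodFn
  exact continuous_finsetProd _ fun i _ => (h i).comp (by fun_prop)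

theorem continuous_wt : Continuous wt := continuous_prodFn fun _ => continuous_m1

theorem integrable_wt : Integrable wt := integrable_prodFn fun _ => integrable_m1

theorem abs_prodFn_le {α β : Ix → ℝ → ℝ} {z : C2} (h : ∀ i, |α i (z i)| ≤ β i (z i)) :
    |prodFn α z| ≤ prodFn β z := by
  unfold prodFn
  rw [Finset.abs_prod]
  exact Finset.prod_le_prod (fun _ _ => abs_nonneg _) fun i _ => h i

theorem prodFn_const_mul (C : ℝ) (α : Ix → ℝ → ℝ) (z : C2) :
    prodFn (fun i τ => C * α i τ) z = C ^ 4 * prodFn α z := by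
  simp [prodFn, Finset.prod_mul_distrib]

theorem prodFn_update (α : Ix → ℝ → ℝ) (i : Ix) (f : ℝ → ℝ) (z : C2) :
    prodFn (Function.update α i f) z = f (z i) * ∏ k ∈ Finset.univ.erase i, α k (z k) := by
  unfold prodFn
  rw [← Finset.mul_prod_erase _ _ (Finset.mem_univ i)]
  simp only [Function.update_self]
  congr 1
  refine Finset.prod_congr rfl fun k hk => ?_
  rw [Function.update_of_ne (Finset.ne_of_mem_erase hk)]

theorem contDiff_prodFn {α : Ix → ℝ → ℝ} {n : WithTop ℕ∞} (h : ∀ i, ContDiff ℝ n (α i)) :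
    ContDiff ℝ n (prodFn α) := by
  unfold prodFn
  exact contDiff_prod fun i _ => (h i).comp (by fun_prop)

theorem fderiv_prodFn {α : Ix → ℝ → ℝ} (h : ∀ i, Differentiable ℝ (α i)) (i : Ix) (z : C2) :
    fderiv ℝ (prodFn α) z (bv i) = prodFn (Function.update α i (deriv (α i))) z := by
  have h1 : ∀ k ∈ Finset.univ, HasFDerivAt (fun z : C2 => α k (z k))
      (deriv (α k) (z k) • (EuclideanSpace.proj k : C2 →L[ℝ] ℝ)) z := fun k _ =>
    (h k (z k)).hasDerivAt.comp_hasFDerivAt z (EuclideanSpace.proj k : C2 →L[ℝ] ℝ).hasFDerivAt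
  have h2 := HasFDerivAt.finsetProd h1
  have h3 : prodFn α = fun z : C2 => ∏ k, α k (z k) := rfl
  rw [h3, h2.fderiv, prodFn_update]
  simp only [sum_apply, smul_apply,
    PiLp.proj_apply, bv, smul_eq_mul]
  rw [Finset.sum_eq_single i (fun k _ hk => by simp [hk]) (by simp)]
  simp [mul_comm]

theorem pd_prodFn {α : Ix → ℝ → ℝ} (h : ∀ i, Differentiable ℝ (α i)) (i : Ix) :
    pd Set.univ (bv i) (fun z => (prodFn α z : ℂ)) =
      fun z => (prodFn (Function.update α i (deriv (α i))) z : ℂ) := by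
  funext z
  have hd : DifferentiableAt ℝ (prodFn α) z := by
    have h1 : ∀ k ∈ Finset.univ, HasFDerivAt (fun z : C2 => α k (z k))
        (deriv (α k) (z k) • (EuclideanSpace.proj k : C2 →L[ℝ] ℝ)) z := fun k _ =>
      (h k (z k)).hasDerivAt.comp_hasFDerivAt z (EuclideanSpace.proj k : C2 →L[ℝ] ℝ).hasFDerivAt
    exact (HasFDerivAt.finsetProd h1).differentiableAt
  rw [pd_eq_fderiv univ_mem, ← fderiv_prodFn h i z]
  have := (Complex.ofRealCLM.hasFDerivAt.comp z hd.hasFDerivAt).fderiv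
  simp only [Function.comp_def, Complex.ofRealCLM_apply] at this
  rw [this]
  simp

theorem lap_prodFn {α : Ix → ℝ → ℝ} (h : ∀ i, ContDiff ℝ 2 (α i)) (z : C2) :
    lap Set.univ bv (fun z => (prodFn α z : ℂ)) z =
      ∑ i, (prodFn (Function.update α i (deriv (deriv (α i)))) z : ℂ) := by
  unfold lap
  refine Finset.sum_congr rfl fun i _ => ?_
  rw [pd_prodFn (fun i => (h i).differentiable (by norm_num))]
  have hd : ∀ k, Differentiable ℝ (Function.update α i (deriv (α i)) k) := by
    intro k
    by_cases hk : k = i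
    · subst hk
      rw [Function.update_self]
      exact ((contDiff_succ_iff_deriv (n := 1)).1 (h k)).2.2.differentiable (by norm_num)
    · rw [Function.update_of_ne hk]
      exact (h k).differentiable (by norm_num)
  rw [pd_prodFn hd]
  simp

end Product

/-! ### Topology of the domain -/

section Domain

theorem isOpen_Omega : IsOpen Omega := by
  have : Omega = ⋂ j : Fin 2, {z : C2 | 0 < z (Sum.inr j)} := by
    ext z; simp [Omega]
  rw [this]
  exact isOpen_iInter_of_finite fun j => isOpen_lt continuous_const (by fun_prop)

/-- The closed domain, in coordinates. -/
theorem closure_Omega : closure Omega = {z : C2 | ∀ j : Fin 2, 0 ≤ z (Sum.inr j)} := by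
  apply Set.Subset.antisymm
  · refine closure_minimal (fun z hz j => (hz j).le) ?_
    have : {z : C2 | ∀ j : Fin 2, 0 ≤ z (Sum.inr j)} =
        ⋂ j : Fin 2, {z : C2 | 0 ≤ z (Sum.inr j)} := by ext z; simp
    rw [this]
    exact isClosed_iInter fun j => isClosed_le continuous_const (by fun_prop)
  · intro z hz
    have h1 : Tendsto (fun t : ℝ => z + t • (bv (Sum.inr 0) + bv (Sum.inr 1))) (𝓝[>] 0) (𝓝 z) := by
      have : Tendsto (fun t : ℝ => z + t • (bv (Sum.inr 0) + bv (Sum.inr 1))) (𝓝 0)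
          (𝓝 (z + (0 : ℝ) • (bv (Sum.inr 0) + bv (Sum.inr 1)))) :=
        Continuous.tendsto (by fun_prop) 0
      simp only [zero_smul, add_zero] at this
      exact this.mono_left nhdsWithin_le_nhds
    refine mem_closure_of_tendsto h1 ?_
    filter_upwards [self_mem_nhdsWithin] with t ht
    intro j
    have ht' : (0 : ℝ) < t := ht
    fin_cases j <;> simp [bv] <;> linarith [hz 0, hz 1]

theorem convex_Omega : Convex ℝ Omega := by
  intro z hz w hw a b ha hb hab j
  simp only [PiLp.add_apply, PiLp.smul_apply, smul_eq_mul]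
  rcases ha.eq_or_lt with rfl | ha'
  · have : b = 1 := by linarith
    subst this
    simpa using hw j
  · nlinarith [mul_pos ha' (hz j), mul_nonneg hb (hw j).le]

theorem Omega_subset : Omega ⊆ closure Omega := subset_closure

theorem interior_closure_Omega : interior (closure Omega) = Omega :=
  convex_Omega.interior_closure_eq_interior_of_nonempty_interior
    (by rw [isOpen_Omega.interior_eq]; exact ⟨bv (Sum.inr 0) + bv (Sum.inr 1), fun j => by
      fin_cases j <;> simp [bv]⟩) |>.trans isOpen_Omega.interior_eq

theorem uniqueDiffOn_closure_Omega : UniqueDiffOn ℝ (closure Omega) := by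
  refine uniqueDiffOn_convex convex_Omega.closure ?_
  rw [interior_closure_Omega]
  exact ⟨bv (Sum.inr 0) + bv (Sum.inr 1), fun j => by
      fin_cases j <;> simp [bv]⟩

theorem closure_Omega_subset_closure_interior :
    closure Omega ⊆ closure (interior (closure Omega)) := by
  rw [interior_closure_Omega]

end Domain

/-! ### Integration by parts against test functions -/

section Parts

/-- Integration by parts against a function with compact support in an open set. -/
theorem setIntegral_pd_mul {U : Set C2} (hU : IsOpen U) {h φ : C2 → ℂ} (hh : ContDiffOn ℝ 1 h U)
    (hφ : ContDiff ℝ 1 φ) (hc : HasCompactSupport φ) (hs : tsupport φ ⊆ U) (v : C2) :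
    ∫ z in U, pd U v h z * φ z = -∫ z in U, h z * pd Set.univ v φ z := by
  set F : C2 → ℂ := fun z => h z * φ z with hF
  have hsF : tsupport F ⊆ tsupport φ := closure_mono (Function.support_mul_subset_right _ _)
  have hcF : HasCompactSupport F := hc.mono' ((Function.support_mul_subset_right _ _).trans
    subset_closure)
  -- The product is continuously differentiable on the whole space, although `h` is regular on `U`
  -- only, because it vanishes near every point outside the support of `φ`.
  have hFd : ContDiff ℝ 1 F := by
    rw [contDiff_iff_contDiffAt]
    intro z
    by_cases hz : z ∈ tsupport φ
    · exact (hh.contDiffAt (hU.mem_nhds (hs hz))).mul hφ.contDiffAt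
    · have : F =ᶠ[𝓝 z] fun _ => 0 := by
        filter_upwards [(isClosed_tsupport φ).isOpen_compl.mem_nhds hz] with w hw
        simp [hF, image_eq_zero_of_notMem_tsupport hw]
      exact contDiffAt_const.congr_of_eventuallyEq this
  have e1 : ∀ z ∈ U, fderiv ℝ F z v = pd U v h z * φ z + h z * pd Set.univ v φ z := by
    intro z hz
    have d1 : DifferentiableAt ℝ h z :=
      (hh.contDiffAt (hU.mem_nhds hz)).differentiableAt (by norm_num)
    have d2 : DifferentiableAt ℝ φ z := hφ.contDiffAt.differentiableAt (by norm_num)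
    rw [hF, fderiv_fun_mul d1 d2, pd_eq_fderiv (hU.mem_nhds hz), pd_eq_fderiv univ_mem]
    simp
    ring
  have hi : Integrable (fun z => fderiv ℝ F z v) := by
    have hcont : Continuous (fun z => fderiv ℝ F z v) :=
      (hFd.continuous_fderiv (by norm_num)).clm_apply continuous_const
    exact hcont.integrable_of_hasCompactSupport (hcF.fderiv_apply (𝕜 := ℝ) v)
  -- Integration by parts against the constant `1`.
  have hi0 : ∫ z, fderiv ℝ F z v = 0 := by
    have := integral_mul_fderiv_eq_neg_fderiv_mul_of_integrable (μ := (volume : Measure C2))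
      (f := fun _ : C2 => (1 : ℂ)) (g := F) (v := v) (by simp) (by simpa using hi)
      (by simpa using hFd.continuous.integrable_of_hasCompactSupport hcF)
      (fun x _ => by fun_prop) (fun x _ => hFd.contDiffAt.differentiableAt (by norm_num))
    simpa using this
  have hsupp : Function.support (fun z => fderiv ℝ F z v) ⊆ U := by
    intro z hz
    by_contra hzU
    apply hz
    have : z ∉ tsupport F := fun h' => hzU (hs (hsF h'))
    have : fderiv ℝ F z = 0 := by
      by_contra hne
      exact this (support_fderiv_subset ℝ hne)
    simp [this]
  rw [← setIntegral_eq_integral_of_forall_compl_eq_zero (s := U)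
    (fun z hz => by by_contra hne; exact hz (hsupp hne))] at hi0
  rw [setIntegral_congr_fun hU.measurableSet e1] at hi0
  have i1 : IntegrableOn (fun z => h z * pd Set.univ v φ z) U := by
    have hc2 : HasCompactSupport (fun z => fderiv ℝ φ z v) := hc.fderiv_apply (𝕜 := ℝ) v
    have hcont : ContinuousOn (fun z => h z * pd Set.univ v φ z) (tsupport φ) := by
      refine (hh.continuousOn.mono hs).mul ?_
      have : pd Set.univ v φ = fun z => fderiv ℝ φ z v := by
        funext z; exact pd_eq_fderiv univ_mem v
      rw [this]
      exact ((hφ.continuous_fderiv (by norm_num)).clm_apply continuous_const).continuousOn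
    refine ((hcont.integrableOn_compact hc).of_forall_sdiff_eq_zero
      hU.measurableSet ?_)
    intro z hz
    have : fderiv ℝ φ z = 0 := by
      by_contra hne
      exact hz.2 (support_fderiv_subset ℝ hne)
    simp [pd_eq_fderiv univ_mem, this]
  have i2 : IntegrableOn (fun z => pd U v h z * φ z) U := by
    have : IntegrableOn (fun z => fderiv ℝ F z v - h z * pd Set.univ v φ z) U :=
      hi.integrableOn.sub i1
    refine this.congr_fun (fun z hz => ?_) hU.measurableSet
    simp only [e1 z hz]
    ring
  rw [integral_add i2 i1] at hi0
  exact eq_neg_of_add_eq_zero_left hi0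

theorem contDiffOn_pd {U : Set C2} (hU : IsOpen U) {h : C2 → ℂ} {n m : WithTop ℕ∞}
    (hh : ContDiffOn ℝ n h U) (hmn : m + 1 ≤ n) (v : C2) : ContDiffOn ℝ m (pd U v h) U :=
  (hh.fderivWithin hU.uniqueDiffOn hmn).clm_apply contDiffOn_const

theorem contDiff_pd {φ : C2 → ℂ} (hφ : ContDiff ℝ ∞ φ) (v : C2) :
    ContDiff ℝ ∞ (pd Set.univ v φ) := by
  have : DbarNeumann.pd Set.univ v φ = fun z => fderiv ℝ φ z v := by
    funext z; exact pd_eq_fderiv univ_mem v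
  rw [this]
  exact (hφ.fderiv_right (m := ∞) (by simp)).clm_apply contDiff_const

theorem tsupport_pd_subset (φ : C2 → ℂ) (v : C2) : tsupport (pd Set.univ v φ) ⊆ tsupport φ := by
  refine closure_minimal (fun z hz => ?_) (isClosed_tsupport φ)
  rw [Function.mem_support, pd_eq_fderiv univ_mem] at hz
  refine support_fderiv_subset ℝ (f := φ) (fun h0 => hz ?_)
  simp [h0]

theorem hasCompactSupport_pd {φ : C2 → ℂ} (hc : HasCompactSupport φ) (v : C2) :
    HasCompactSupport (pd Set.univ v φ) :=
  hc.of_isClosed_subset (isClosed_tsupport _) (tsupport_pd_subset φ v)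

/-- Smooth functions with compact support in `U`. -/
structure IsTest (U : Set C2) (φ : C2 → ℂ) : Prop where
  smooth : ContDiff ℝ ∞ φ
  compact : HasCompactSupport φ
  support : tsupport φ ⊆ U

theorem IsTest.pd {U : Set C2} {φ : C2 → ℂ} (hφ : IsTest U φ) (v : C2) :
    IsTest U (pd Set.univ v φ) :=
  ⟨contDiff_pd hφ.smooth v, hasCompactSupport_pd hφ.compact v,
    (tsupport_pd_subset φ v).trans hφ.support⟩

theorem setIntegral_mul_integrableOn {U : Set C2} (hU : IsOpen U) {h φ : C2 → ℂ}
    (hh : ContinuousOn h U) (hφ : IsTest U φ) : IntegrableOn (fun z => h z * φ z) U := by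
  refine (((hh.mono hφ.support).mul hφ.smooth.continuous.continuousOn).integrableOn_compact
    hφ.compact).of_forall_sdiff_eq_zero hU.measurableSet fun z hz => ?_
  simp [image_eq_zero_of_notMem_tsupport hz.2]

/-- Green's formula against a test function. -/
theorem setIntegral_lap {U : Set C2} (hU : IsOpen U) {h φ : C2 → ℂ} (hh : ContDiffOn ℝ 2 h U)
    (hφ : IsTest U φ) :
    ∫ z in U, h z * lap Set.univ bv φ z = ∫ z in U, lap U bv h z * φ z := by
  have one : (1 : WithTop ℕ∞) ≤ ∞ := by exact_mod_cast le_top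
  unfold lap
  simp only [Finset.mul_sum, Finset.sum_mul]
  rw [integral_finsetSum _ fun i _ => setIntegral_mul_integrableOn hU hh.continuousOn
      ((hφ.pd _).pd _),
    integral_finsetSum _ fun i _ => setIntegral_mul_integrableOn hU
      ((contDiffOn_pd hU (contDiffOn_pd hU hh (m := 1) (by norm_num) _) (m := 0) (by norm_num) _).continuousOn) hφ]
  refine Finset.sum_congr rfl fun i _ => ?_
  have h1 := setIntegral_pd_mul hU (hh.of_le (by norm_num)) ((hφ.pd (bv i)).smooth.of_le one)
    (hφ.pd _).compact (hφ.pd _).support (bv i)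
  have h2 := setIntegral_pd_mul hU (contDiffOn_pd hU hh (m := 1) (by norm_num) (bv i))
    (hφ.smooth.of_le one) hφ.compact hφ.support (bv i)
  rw [h2, h1]
  ring

end Parts


/-! ### Truncation of one-variable test functions -/

section Cutoff

/-- A smooth step: `0` up to `1`, and `1` from `2` on. -/
noncomputable def step (τ : ℝ) : ℝ := Real.smoothTransition (τ - 1)

theorem contDiff_step : ContDiff ℝ ∞ step :=
  Real.smoothTransition.contDiff.comp (contDiff_id.sub contDiff_const)

theorem step_eq_zero {τ : ℝ} (h : τ ≤ 1) : step τ = 0 :=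
  Real.smoothTransition.zero_of_nonpos (by linarith)

theorem step_eq_one {τ : ℝ} (h : 2 ≤ τ) : step τ = 1 :=
  Real.smoothTransition.one_of_one_le (by linarith)

theorem step_nonneg (τ : ℝ) : 0 ≤ step τ := Real.smoothTransition.nonneg _

theorem step_le_one (τ : ℝ) : step τ ≤ 1 := Real.smoothTransition.le_one _

theorem contDiff_deriv_of_top {f : ℝ → ℝ} (h : ContDiff ℝ ∞ f) : ContDiff ℝ ∞ (deriv f) :=
  (contDiff_infty_iff_deriv.1 h).2

theorem hasDerivAt_of_top {f : ℝ → ℝ} (h : ContDiff ℝ ∞ f) (τ : ℝ) :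
    HasDerivAt f (deriv f τ) τ :=
  ((contDiff_infty_iff_deriv.1 h).1 τ).hasDerivAt

theorem deriv_step_eq_zero {τ : ℝ} (h : τ < 1 ∨ 2 < τ) : deriv step τ = 0 := by
  rcases h with h | h
  · have : step =ᶠ[𝓝 τ] fun _ => 0 := by
      filter_upwards [gt_mem_nhds h] with x hx using step_eq_zero (le_of_lt hx)
    rw [this.deriv_eq, deriv_const]
  · have : step =ᶠ[𝓝 τ] fun _ => 1 := by
      filter_upwards [lt_mem_nhds h] with x hx using step_eq_one (le_of_lt hx)
    rw [this.deriv_eq, deriv_const]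

theorem deriv2_step_eq_zero {τ : ℝ} (h : τ < 1 ∨ 2 < τ) : deriv (deriv step) τ = 0 := by
  rcases h with h | h
  · have : deriv step =ᶠ[𝓝 τ] fun _ => 0 := by
      filter_upwards [gt_mem_nhds h] with x hx using deriv_step_eq_zero (Or.inl hx)
    rw [this.deriv_eq, deriv_const]
  · have : deriv step =ᶠ[𝓝 τ] fun _ => 0 := by
      filter_upwards [lt_mem_nhds h] with x hx using deriv_step_eq_zero (Or.inr hx)
    rw [this.deriv_eq, deriv_const]

theorem exists_bound_step : ∃ B : ℝ, 1 ≤ B ∧ ∀ τ, |deriv step τ| ≤ B ∧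
    |deriv (deriv step) τ| ≤ B := by
  have c1 : Continuous (deriv step) := (contDiff_deriv_of_top contDiff_step).continuous
  have c2 : Continuous (deriv (deriv step)) :=
    (contDiff_deriv_of_top (contDiff_deriv_of_top contDiff_step)).continuous
  obtain ⟨B₁, h₁⟩ := (isCompact_Icc (a := (1 : ℝ)) (b := 2)).exists_bound_of_continuousOn
    c1.continuousOn
  obtain ⟨B₂, h₂⟩ := (isCompact_Icc (a := (1 : ℝ)) (b := 2)).exists_bound_of_continuousOn
    c2.continuousOn
  refine ⟨max 1 (max B₁ B₂), le_max_left _ _, fun τ => ?_⟩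
  have hpos : (0 : ℝ) ≤ max 1 (max B₁ B₂) := zero_le_one.trans (le_max_left _ _)
  by_cases hτ : τ < 1 ∨ 2 < τ
  · rw [deriv_step_eq_zero hτ, deriv2_step_eq_zero hτ]
    simp [hpos]
  · push Not at hτ
    exact ⟨(h₁ τ hτ).trans (by simp), (h₂ τ hτ).trans (by simp)⟩

/-- Smooth, and dominated by `C m1` together with its first two derivatives. -/
structure Nice (C : ℝ) (α : ℝ → ℝ) : Prop where
  smooth : ContDiff ℝ ∞ α
  b0 : ∀ τ, |α τ| ≤ C * m1 τ
  b1 : ∀ τ, |deriv α τ| ≤ C * m1 τ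
  b2 : ∀ τ, |deriv (deriv α) τ| ≤ C * m1 τ

theorem Nice.nonneg {C : ℝ} {α : ℝ → ℝ} (h : Nice C α) : 0 ≤ C := by
  have := (abs_nonneg _).trans (h.b0 0)
  simpa [m1] using this

/-- Mean value inequality. Near a face the factor `|τ|` compensates one of the powers of `1 / s`
that appear when a cutoff at scale `s` is differentiated. -/
theorem Nice.abs_le {C : ℝ} {α : ℝ → ℝ} (h : Nice C α) (h0 : α 0 = 0) (τ : ℝ) :
    |α τ| ≤ C * |τ| := by
  have := convex_univ.norm_image_sub_le_of_norm_hasDerivWithin_le (f := α) (f' := deriv α)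
    (C := C) (x := 0) (y := τ) (s := Set.univ)
    (fun x _ => (hasDerivAt_of_top h.smooth x).hasDerivWithinAt)
    (fun x _ => (h.b1 x).trans (mul_le_of_le_one_right h.nonneg (m1_le_one x)))
    (Set.mem_univ _) (Set.mem_univ _)
  simpa [h0] using this

/-- Second derivative of a product with a function whose derivatives are given. -/
theorem deriv2_mul {α ρ ρ' ρ'' : ℝ → ℝ} (hα : ContDiff ℝ ∞ α) (h1 : ∀ τ, HasDerivAt ρ (ρ' τ) τ)
    (h2 : ∀ τ, HasDerivAt ρ' (ρ'' τ) τ) (τ : ℝ) :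
    deriv (fun τ => α τ * ρ τ) τ = deriv α τ * ρ τ + α τ * ρ' τ ∧
    deriv (deriv fun τ => α τ * ρ τ) τ =
      deriv (deriv α) τ * ρ τ + 2 * deriv α τ * ρ' τ + α τ * ρ'' τ := by
  have e1 : deriv (fun τ => α τ * ρ τ) = fun τ => deriv α τ * ρ τ + α τ * ρ' τ := by
    funext τ
    exact ((hasDerivAt_of_top hα τ).mul (h1 τ)).deriv
  refine ⟨congrFun e1 τ, ?_⟩
  rw [e1]
  have := (((hasDerivAt_of_top (contDiff_deriv_of_top hα) τ).mul (h1 τ)).add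
    ((hasDerivAt_of_top hα τ).mul (h2 τ))).deriv
  refine (Eq.trans ?_ this).trans (by ring)
  rfl

/-- Truncations of a function of one coordinate: `A s` is supported in `|τ| ≤ 2 / s`, and in
`s ≤ τ` when the coordinate is a `y`; its second derivative splits into a dominated part `β s` and
a part `γ s` living in `[s, 2 s]`. -/
structure CutData (i : Ix) (α : ℝ → ℝ) (D : ℝ) (A β γ : ℝ → ℝ → ℝ) : Prop where
  smooth : ∀ s ∈ Set.Ioo (0 : ℝ) (1 / 2), ContDiff ℝ ∞ (A s)
  smooth' : ∀ s ∈ Set.Ioo (0 : ℝ) (1 / 2), ContDiff ℝ ∞ (γ s)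
  supp : ∀ s ∈ Set.Ioo (0 : ℝ) (1 / 2), ∀ τ, A s τ ≠ 0 → |τ| ≤ 2 / s ∧ (i.isRight = true → s ≤ τ)
  supp' : ∀ s ∈ Set.Ioo (0 : ℝ) (1 / 2), ∀ τ, γ s τ ≠ 0 → i.isRight = true ∧ s ≤ τ ∧ τ ≤ 2 * s
  bound : ∀ s ∈ Set.Ioo (0 : ℝ) (1 / 2), ∀ τ, |A s τ| ≤ D * m1 τ ∧ |deriv (A s) τ| ≤ D * m1 τ ∧
    |β s τ| ≤ D * m1 τ ∧ |γ s τ| ≤ D / s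
  deriv2 : ∀ s ∈ Set.Ioo (0 : ℝ) (1 / 2), ∀ τ, deriv (deriv (A s)) τ = β s τ + γ s τ
  lim : ∀ τ, (i.isRight = true → 0 < τ) →
    ∀ᶠ s in 𝓝[>] (0 : ℝ), A s τ = α τ ∧ β s τ = deriv (deriv α) τ

theorem hasDerivAt_step_mul (f : ℝ → ℝ) (hf : ContDiff ℝ ∞ f) (c τ : ℝ) :
    HasDerivAt (fun τ => f (c * τ)) (c * deriv f (c * τ)) τ := by
  have := (hasDerivAt_of_top hf (c * τ)).comp τ ((hasDerivAt_id τ).const_mul c)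
  rw [mul_comm]
  simpa [Function.comp_def] using this

/-- An `x` coordinate has no boundary, so a cutoff at distance `1 / s` suffices. Its derivatives
bring factors `s` and stay dominated, which allows `γ = 0`. -/
theorem exists_cutData_left (j : Fin 2) {C : ℝ} {α : ℝ → ℝ} (h : Nice C α) :
    ∃ D A β γ, CutData (Sum.inl j) α D A β γ := by
  obtain ⟨B, hB1, hB⟩ := exists_bound_step
  have hC := h.nonneg
  have s1 := contDiff_step
  have s2 := contDiff_deriv_of_top contDiff_step
  set ρ : ℝ → ℝ → ℝ := fun s τ => 1 - step (s * τ) - step (-s * τ) with hρ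
  set ρ' : ℝ → ℝ → ℝ := fun s τ => -(s * deriv step (s * τ)) + s * deriv step (-s * τ) with hρ'
  set ρ'' : ℝ → ℝ → ℝ := fun s τ => -(s * (s * deriv (deriv step) (s * τ))) +
    s * (-s * deriv (deriv step) (-s * τ)) with hρ''
  have d1 : ∀ s τ, HasDerivAt (ρ s) (ρ' s τ) τ := by
    intro s τ
    have := ((hasDerivAt_const τ (1 : ℝ)).sub (hasDerivAt_step_mul step s1 s τ)).sub
      (hasDerivAt_step_mul step s1 (-s) τ)
    exact this.congr_deriv (by simp only [hρ']; ring)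
  have d2 : ∀ s τ, HasDerivAt (ρ' s) (ρ'' s τ) τ := by
    intro s τ
    exact ((hasDerivAt_step_mul _ s2 s τ).const_mul s).neg.add
      ((hasDerivAt_step_mul _ s2 (-s) τ).const_mul s)
  have bρ : ∀ s τ, 0 < s → |ρ s τ| ≤ 1 := by
    intro s τ hs
    simp only [hρ]
    rw [abs_le]
    have a1 := step_nonneg (s * τ)
    have a2 := step_le_one (s * τ)
    have a3 := step_nonneg (-s * τ)
    have a4 := step_le_one (-s * τ)
    constructor <;> linarith
  have bρ' : ∀ s τ, 0 < s → s < 1 / 2 → |ρ' s τ| ≤ B := by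
    intro s τ hs hs2
    simp only [hρ']
    have a1 := (hB (s * τ)).1
    have a2 := (hB (-s * τ)).1
    rw [abs_le] at a1 a2 ⊢
    constructor <;> nlinarith
  have bρ'' : ∀ s τ, 0 < s → s < 1 / 2 → |ρ'' s τ| ≤ B := by
    intro s τ hs hs2
    simp only [hρ'']
    have a1 := (hB (s * τ)).2
    have a2 := (hB (-s * τ)).2
    have hss : s * s ≤ 1 / 4 := by nlinarith
    have hss0 : 0 < s * s := by positivity
    rw [abs_le] at a1 a2 ⊢
    constructor <;> nlinarith
  -- In the second derivative, `1` accounts for `α'' ρ`, `2 B` for the mixed term `2 α' ρ'`, and `B`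
  -- for `α ρ''`.
  refine ⟨C * (1 + 3 * B), fun s τ => α τ * ρ s τ, fun s τ =>
    deriv (deriv α) τ * ρ s τ + 2 * deriv α τ * ρ' s τ + α τ * ρ'' s τ, fun _ _ => 0, ?_⟩
  refine ⟨fun s _ => ?_, fun s _ => contDiff_const, ?_, fun s _ τ h0 => absurd rfl h0, ?_, ?_, ?_⟩
  · exact h.smooth.mul ((contDiff_const.sub (s1.comp (contDiff_const.mul contDiff_id))).sub
      (s1.comp (contDiff_const.mul contDiff_id)))
  · intro s hs τ h0
    refine ⟨?_, by simp⟩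
    by_contra hlt
    push Not at hlt
    apply h0
    have hs0 := hs.1
    rw [div_lt_iff₀ hs0] at hlt
    have : ρ s τ = 0 := by
      simp only [hρ]
      rcases le_or_gt 0 τ with hτ | hτ
      · rw [abs_of_nonneg hτ] at hlt
        rw [step_eq_one (τ := s * τ) (by linarith), step_eq_zero (τ := -s * τ) (by nlinarith)]
        ring
      · rw [abs_of_neg hτ] at hlt
        rw [step_eq_one (τ := -s * τ) (by linarith), step_eq_zero (τ := s * τ) (by nlinarith)]
        ring
    simp [this]
  · intro s hs τ
    have hm := m1_pos τ
    have r0 := bρ s τ hs.1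
    have r1 := bρ' s τ hs.1 hs.2
    have r2 := bρ'' s τ hs.1 hs.2
    have e := (deriv2_mul h.smooth (d1 s) (d2 s) τ).1
    have a0 := h.b0 τ
    have a1 := h.b1 τ
    have a2 := h.b2 τ
    have hCm : 0 ≤ C * m1 τ := mul_nonneg hC hm.le
    have m00 : |α τ * ρ s τ| ≤ C * m1 τ * 1 := by rw [abs_mul]; gcongr
    have m10 : |deriv α τ * ρ s τ| ≤ C * m1 τ * 1 := by rw [abs_mul]; gcongr
    have m20 : |deriv (deriv α) τ * ρ s τ| ≤ C * m1 τ * 1 := by rw [abs_mul]; gcongr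
    have m01 : |α τ * ρ' s τ| ≤ C * m1 τ * B := by rw [abs_mul]; gcongr
    have m11 : |deriv α τ * ρ' s τ| ≤ C * m1 τ * B := by rw [abs_mul]; gcongr
    have m02 : |α τ * ρ'' s τ| ≤ C * m1 τ * B := by rw [abs_mul]; gcongr
    have hCB : 0 ≤ C * m1 τ * B := by positivity
    refine ⟨?_, ?_, ?_, ?_⟩
    · nlinarith
    · rw [e]
      refine (abs_add_le _ _).trans ?_
      nlinarith
    · refine (abs_add_three _ _ _).trans ?_
      rw [mul_assoc 2, abs_mul 2, abs_two]
      nlinarith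
    · simp only [abs_zero]
      have := hs.1
      positivity
  · intro s _ τ
    rw [(deriv2_mul h.smooth (d1 s) (d2 s) τ).2, add_zero]
  · intro τ _
    have hev : ∀ᶠ s in 𝓝[>] (0 : ℝ), s * |τ| < 1 := by
      have : Tendsto (fun s : ℝ => s * |τ|) (𝓝 0) (𝓝 (0 * |τ|)) := Continuous.tendsto (by fun_prop) 0
      rw [zero_mul] at this
      exact (this.mono_left nhdsWithin_le_nhds).eventually (gt_mem_nhds one_pos)
    filter_upwards [hev, self_mem_nhdsWithin] with s hs hs0
    have hs0' : 0 < s := hs0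
    have k1 : s * τ < 1 := (mul_le_mul_of_nonneg_left (le_abs_self τ) hs0'.le).trans_lt hs
    have k2 : -s * τ < 1 := by
      have := mul_le_mul_of_nonneg_left (neg_le_abs τ) hs0'.le
      linarith
    simp only [hρ, hρ', hρ'', step_eq_zero k1.le, step_eq_zero k2.le, deriv_step_eq_zero (Or.inl k1),
      deriv_step_eq_zero (Or.inl k2), deriv2_step_eq_zero (Or.inl k1),
      deriv2_step_eq_zero (Or.inl k2)]
    constructor <;> ring

/-- Derivatives of the inner cutoff `step (τ / s)` live in `[s, 2 s]`. A first derivative costs `1 /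
s`, which is absorbed by `|α τ| ≤ C τ`, so `A s` has a dominated derivative. In the second
derivative one factor `1 / s` survives, both in the mixed term and in `α ρ''`; these terms form `γ`.
-/
theorem exists_cutData_right (j : Fin 2) {C : ℝ} {α : ℝ → ℝ} (h : Nice C α) (h0 : α 0 = 0) :
    ∃ D A β γ, CutData (Sum.inr j) α D A β γ := by
  obtain ⟨B, hB1, hB⟩ := exists_bound_step
  have hC := h.nonneg
  have s1 := contDiff_step
  have s2 := contDiff_deriv_of_top contDiff_step
  have s3 := contDiff_deriv_of_top s2
  set ρ : ℝ → ℝ → ℝ := fun s τ => step (s⁻¹ * τ) - step (s * τ) with hρ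
  set ρ' : ℝ → ℝ → ℝ := fun s τ => s⁻¹ * deriv step (s⁻¹ * τ) - s * deriv step (s * τ) with hρ'
  set ρ'' : ℝ → ℝ → ℝ := fun s τ => s⁻¹ * (s⁻¹ * deriv (deriv step) (s⁻¹ * τ)) -
    s * (s * deriv (deriv step) (s * τ)) with hρ''
  have d1 : ∀ s τ, HasDerivAt (ρ s) (ρ' s τ) τ := fun s τ =>
    (hasDerivAt_step_mul step s1 s⁻¹ τ).sub (hasDerivAt_step_mul step s1 s τ)
  have d2 : ∀ s τ, HasDerivAt (ρ' s) (ρ'' s τ) τ := fun s τ =>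
    ((hasDerivAt_step_mul _ s2 s⁻¹ τ).const_mul s⁻¹).sub
      ((hasDerivAt_step_mul _ s2 s τ).const_mul s)
  have bρ : ∀ s τ, |ρ s τ| ≤ 1 := by
    intro s τ
    simp only [hρ]
    rw [abs_le]
    have a1 := step_nonneg (s * τ)
    have a2 := step_le_one (s * τ)
    have a3 := step_nonneg (s⁻¹ * τ)
    have a4 := step_le_one (s⁻¹ * τ)
    constructor <;> linarith
  have out : ∀ s τ : ℝ, 0 < s → ¬ (s ≤ τ ∧ τ ≤ 2 * s) → s⁻¹ * τ < 1 ∨ 2 < s⁻¹ * τ := by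
    intro s τ hs hn
    by_contra hcon
    push Not at hcon
    apply hn
    have e : τ = s * (s⁻¹ * τ) := by field_simp
    constructor
    · rw [e]; nlinarith
    · rw [e]; nlinarith
  -- The largest demand comes from the first derivative: `1` for `α' ρ`, `4 B` for the inner cutoff
  -- and `B` for the outer one.
  refine ⟨C * (1 + 5 * B), fun s τ => α τ * ρ s τ, fun s τ =>
    deriv (deriv α) τ * ρ s τ - 2 * deriv α τ * (s * deriv step (s * τ)) -
      α τ * (s * (s * deriv (deriv step) (s * τ))), fun s τ =>
    2 * deriv α τ * (s⁻¹ * deriv step (s⁻¹ * τ)) +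
      α τ * (s⁻¹ * (s⁻¹ * deriv (deriv step) (s⁻¹ * τ))), ?_⟩
  refine ⟨fun s _ => ?_, fun s _ => ?_, ?_, ?_, ?_, ?_, ?_⟩
  · exact h.smooth.mul ((s1.comp (contDiff_const.mul contDiff_id)).sub
      (s1.comp (contDiff_const.mul contDiff_id)))
  · exact ((contDiff_const.mul (contDiff_deriv_of_top h.smooth)).mul
      (contDiff_const.mul (s2.comp (contDiff_const.mul contDiff_id)))).add
      (h.smooth.mul (contDiff_const.mul (contDiff_const.mul
        (s3.comp (contDiff_const.mul contDiff_id)))))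
  · intro s hs τ hne
    have hs0 := hs.1
    have hs2 := hs.2
    have hinv : 2 < s⁻¹ := by
      rw [lt_inv_comm₀ two_pos hs0]; linarith
    by_contra hcon
    apply hne
    have : ρ s τ = 0 := by
      simp only [hρ]
      by_cases hτ : s ≤ τ
      · have hτ2 : ¬ |τ| ≤ 2 / s := fun h' => hcon ⟨h', fun _ => hτ⟩
        rw [abs_of_pos (hs0.trans_le hτ), not_le, div_lt_iff₀ hs0] at hτ2
        rw [step_eq_one (τ := s * τ) (by linarith), step_eq_one (τ := s⁻¹ * τ), sub_self]
        nlinarith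
      · push Not at hτ
        rw [step_eq_zero (τ := s⁻¹ * τ), step_eq_zero (τ := s * τ) (by nlinarith), sub_self]
        rw [inv_mul_le_iff₀ hs0]; linarith
    simp [this]
  · intro s hs τ hne
    refine ⟨rfl, ?_⟩
    by_contra hcon
    have := out s τ hs.1 hcon
    apply hne
    simp only [deriv_step_eq_zero this, deriv2_step_eq_zero this]
    ring
  · intro s hs τ
    have hs0 := hs.1
    have hs2 := hs.2
    have hm := m1_pos τ
    have r0 := bρ s τ
    have e := (deriv2_mul h.smooth (d1 s) (d2 s) τ).1
    have a0 := h.b0 τ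
    have a1 := h.b1 τ
    have a2 := h.b2 τ
    have hCm : 0 ≤ C * m1 τ := mul_nonneg hC hm.le
    have hCB : 0 ≤ C * m1 τ * B := by positivity
    have q1 : |s * deriv step (s * τ)| ≤ B := by
      rw [abs_mul, abs_of_pos hs0]
      nlinarith [(hB (s * τ)).1, abs_nonneg (deriv step (s * τ))]
    have q2 : |s * (s * deriv (deriv step) (s * τ))| ≤ B := by
      rw [abs_mul, abs_mul, abs_of_pos hs0]
      nlinarith [(hB (s * τ)).2, abs_nonneg (deriv (deriv step) (s * τ)),
        mul_nonneg hs0.le (abs_nonneg (deriv (deriv step) (s * τ)))]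
    have m00 : |α τ * ρ s τ| ≤ C * m1 τ * 1 := by rw [abs_mul]; gcongr
    have m10 : |deriv α τ * ρ s τ| ≤ C * m1 τ * 1 := by rw [abs_mul]; gcongr
    have m20 : |deriv (deriv α) τ * ρ s τ| ≤ C * m1 τ * 1 := by rw [abs_mul]; gcongr
    have p1 : |α τ * (s * deriv step (s * τ))| ≤ C * m1 τ * B := by rw [abs_mul]; gcongr
    have p1' : |deriv α τ * (s * deriv step (s * τ))| ≤ C * m1 τ * B := by rw [abs_mul]; gcongr
    have p2 : |α τ * (s * (s * deriv (deriv step) (s * τ)))| ≤ C * m1 τ * B := by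
      rw [abs_mul]; gcongr
    have near : s ≤ τ → τ ≤ 2 * s → |α τ| ≤ C * (2 * s) := fun h1 h2 => by
      refine (h.abs_le h0 τ).trans ?_
      rw [abs_of_pos (hs0.trans_le h1)]
      gcongr
    have hinv : s⁻¹ * s = 1 := inv_mul_cancel₀ hs0.ne'
    have hi0 : 0 < s⁻¹ := inv_pos.2 hs0
    have g1 : |α τ * (s⁻¹ * deriv step (s⁻¹ * τ))| ≤ 4 * (C * m1 τ * B) := by
      by_cases hn : s ≤ τ ∧ τ ≤ 2 * s
      -- On the strip `τ ≤ 2 s < 1`, so a bound by a constant is a bound by a multiple of the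
      -- weight.
      · have hm2 : 1 / 2 ≤ m1 τ := by
          unfold m1
          rw [one_div]
          exact inv_anti₀ (by positivity) (by nlinarith)
        rw [abs_mul, abs_mul, abs_of_pos hi0]
        calc |α τ| * (s⁻¹ * |deriv step (s⁻¹ * τ)|) ≤ (C * (2 * s)) * (s⁻¹ * B) := by
              gcongr
              · exact near hn.1 hn.2
              · exact (hB _).1
          _ = 2 * (C * B) * (s⁻¹ * s) := by ring
          _ = 2 * (C * B) := by rw [hinv, mul_one]
          _ ≤ 4 * (C * m1 τ * B) := by nlinarith [mul_nonneg hC (zero_le_one.trans hB1)]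
      · rw [deriv_step_eq_zero (out s τ hs0 hn)]
        simp; positivity
    refine ⟨?_, ?_, ?_, ?_⟩
    · nlinarith
    · rw [e]
      simp only [hρ', mul_sub]
      refine (abs_add_le _ _).trans ?_
      have := abs_sub (α τ * (s⁻¹ * deriv step (s⁻¹ * τ))) (α τ * (s * deriv step (s * τ)))
      nlinarith
    · rw [mul_assoc 2]
      refine (abs_sub _ _).trans ?_
      have := abs_sub (deriv (deriv α) τ * ρ s τ) (2 * (deriv α τ * (s * deriv step (s * τ))))
      rw [abs_mul 2, abs_two] at this
      nlinarith
    · have hD : C * (4 * B) * s⁻¹ ≤ C * (1 + 5 * B) / s := by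
        rw [div_eq_mul_inv]
        gcongr
        linarith
      refine le_trans ?_ hD
      by_cases hn : s ≤ τ ∧ τ ≤ 2 * s
      · refine (abs_add_le _ _).trans ?_
        have t1 : |2 * deriv α τ * (s⁻¹ * deriv step (s⁻¹ * τ))| ≤ 2 * C * (s⁻¹ * B) := by
          rw [abs_mul, abs_mul, abs_two, abs_mul s⁻¹, abs_of_pos hi0]
          gcongr
          · exact (h.b1 τ).trans (mul_le_of_le_one_right hC (m1_le_one τ))
          · exact (hB _).1
        have t2 : |α τ * (s⁻¹ * (s⁻¹ * deriv (deriv step) (s⁻¹ * τ)))| ≤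
            (C * (2 * s)) * (s⁻¹ * (s⁻¹ * B)) := by
          rw [abs_mul, abs_mul s⁻¹, abs_mul s⁻¹, abs_of_pos hi0]
          gcongr
          · exact near hn.1 hn.2
          · exact (hB _).2
        have t3 : (C * (2 * s)) * (s⁻¹ * (s⁻¹ * B)) = C * 2 * (s⁻¹ * B) * (s⁻¹ * s) := by ring
        rw [t3, hinv] at t2
        linarith
      · rw [deriv_step_eq_zero (out s τ hs0 hn), deriv2_step_eq_zero (out s τ hs0 hn)]
        simp; positivity
  · intro s _ τ
    rw [(deriv2_mul h.smooth (d1 s) (d2 s) τ).2]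
    simp only [hρ', hρ'']
    ring
  · intro τ hτ
    have hτ0 : 0 < τ := hτ rfl
    have hev : ∀ᶠ s in 𝓝[>] (0 : ℝ), s * τ < 1 := by
      have : Tendsto (fun s : ℝ => s * τ) (𝓝 0) (𝓝 (0 * τ)) := Continuous.tendsto (by fun_prop) 0
      rw [zero_mul] at this
      exact (this.mono_left nhdsWithin_le_nhds).eventually (gt_mem_nhds one_pos)
    have hev2 : ∀ᶠ s in 𝓝[>] (0 : ℝ), s < τ / 2 :=
      nhdsWithin_le_nhds (gt_mem_nhds (by positivity))
    filter_upwards [hev, hev2, self_mem_nhdsWithin] with s hs hs2 hs0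
    have hs0' : 0 < s := hs0
    have k2 : 2 ≤ s⁻¹ * τ := by
      rw [le_inv_mul_iff₀ hs0']; linarith
    simp only [hρ, step_eq_zero hs.le, step_eq_one k2, deriv_step_eq_zero (Or.inl hs),
      deriv2_step_eq_zero (Or.inl hs)]
    constructor <;> ring

end Cutoff

/-! ### Testing the weak equation with functions that vanish on the faces only -/

section WeakLimit

/-- The supports of the factors confine the product to a closed bounded box on which every `y_j ≥
s`, a compact subset of the open domain. -/
theorem isTest_prodFn {α : Ix → ℝ → ℝ} (hα : ∀ i, ContDiff ℝ ∞ (α i)) {s : ℝ} (hs : 0 < s)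
    (hsupp : ∀ i τ, α i τ ≠ 0 → |τ| ≤ 2 / s ∧ (i.isRight = true → s ≤ τ)) :
    IsTest Omega (fun z => (prodFn α z : ℂ)) := by
  set T : Set C2 := {z | (∀ i, |z i| ≤ 2 / s) ∧ ∀ j : Fin 2, s ≤ z (Sum.inr j)} with hT
  have hTc : IsClosed T := by
    have : T = (⋂ i, {z : C2 | |z i| ≤ 2 / s}) ∩ ⋂ j : Fin 2, {z : C2 | s ≤ z (Sum.inr j)} := by
      ext z; simp [hT]
    rw [this]
    exact (isClosed_iInter fun i => isClosed_le (by fun_prop) continuous_const).inter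
      (isClosed_iInter fun j => isClosed_le continuous_const (by fun_prop))
  have hTb : IsCompact T := by
    have hsub : T ⊆ (WithLp.toLp 2) '' (Set.univ.pi fun _ : Ix => Set.Icc (-(2 / s)) (2 / s)) := by
      intro z hz
      exact ⟨z.ofLp, fun i _ => abs_le.1 (hz.1 i), rfl⟩
    exact ((isCompact_univ_pi fun _ => isCompact_Icc).image
      (PiLp.continuous_toLp 2 _)).of_isClosed_subset hTc hsub
  have hsub : Function.support (fun z => (prodFn α z : ℂ)) ⊆ T := by
    intro z hz
    have h1 : ∀ i, α i (z i) ≠ 0 := by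
      intro i h0
      apply hz
      simp only [prodFn]
      rw [Finset.prod_eq_zero (Finset.mem_univ i) h0]
      simp
    exact ⟨fun i => (hsupp i _ (h1 i)).1, fun j => (hsupp _ _ (h1 (Sum.inr j))).2 rfl⟩
  have hts : tsupport (fun z => (prodFn α z : ℂ)) ⊆ T := closure_minimal hsub hTc
  refine ⟨Complex.ofRealCLM.contDiff.comp (contDiff_prodFn hα),
    hTb.of_isClosed_subset (isClosed_tsupport _) hts, fun z hz j => hs.trans_le ((hts hz).2 j)⟩

/-- The face `y_j = 0` does not contribute when `H` is tested against product functions whose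
factor in `y_j` is of size `1 / s` on `[s, 2 s]`. -/
def FaceNull (j : Fin 2) (H : C2 → ℂ) : Prop :=
  ∀ (α : ℝ → Ix → ℝ → ℝ) (D : ℝ),
    (∀ s ∈ Set.Ioo (0 : ℝ) (1 / 2), (∀ i, ContDiff ℝ ∞ (α s i)) ∧
      (∀ i τ, α s i τ ≠ 0 → |τ| ≤ 2 / s ∧ (i.isRight = true → s ≤ τ)) ∧
      (∀ i, i ≠ Sum.inr j → ∀ τ, |α s i τ| ≤ D * m1 τ ∧ |deriv (α s i) τ| ≤ D * m1 τ) ∧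
      ∀ τ, |α s (Sum.inr j) τ| ≤ D / s ∧ (α s (Sum.inr j) τ ≠ 0 → s ≤ τ ∧ τ ≤ 2 * s)) →
    Tendsto (fun s => ∫ z in Omega, H z * (prodFn (α s) z : ℂ)) (𝓝[>] 0) (𝓝 0)

theorem Ioo_half_mem : Set.Ioo (0 : ℝ) (1 / 2) ∈ 𝓝[>] (0 : ℝ) := Ioo_mem_nhdsGT (by norm_num)

/-- Dominated convergence with majorant `D ^ 4 ‖H‖ wt`, one factor `D` for each of the four
coordinates. -/
theorem tendsto_dominated_prodFn {H : C2 → ℂ} (hHc : ContinuousOn H Omega)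
    (hHi : IntegrableOn (fun z => H z * wt z) Omega) {A : ℝ → Ix → ℝ → ℝ} {α : Ix → ℝ → ℝ} {D : ℝ}
    (hm : ∀ s ∈ Set.Ioo (0 : ℝ) (1 / 2), ∀ i, Continuous (A s i))
    (hb : ∀ s ∈ Set.Ioo (0 : ℝ) (1 / 2), ∀ i τ, |A s i τ| ≤ D * m1 τ)
    (hl : ∀ i τ, (i.isRight = true → 0 < τ) → ∀ᶠ s in 𝓝[>] (0 : ℝ), A s i τ = α i τ) :
    Tendsto (fun s => ∫ z in Omega, H z * (prodFn (A s) z : ℂ)) (𝓝[>] 0)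
      (𝓝 (∫ z in Omega, H z * (prodFn α z : ℂ))) := by
  refine tendsto_integral_filter_of_dominated_convergence
    (fun z => D ^ 4 * ‖H z * wt z‖) ?_ ?_ (hHi.norm.const_mul _) ?_
  · filter_upwards [Ioo_half_mem] with s hs
    refine ContinuousOn.aestronglyMeasurable ?_ isOpen_Omega.measurableSet
    exact hHc.mul (Complex.continuous_ofReal.comp (continuous_prodFn (hm s hs))).continuousOn
  · filter_upwards [Ioo_half_mem] with s hs
    refine Eventually.of_forall fun z => ?_
    rw [norm_mul, norm_mul, Complex.norm_real, Complex.norm_real, Real.norm_eq_abs,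
      Real.norm_eq_abs, abs_of_pos (wt_pos z), mul_left_comm]
    refine mul_le_mul_of_nonneg_left ?_ (norm_nonneg _)
    have := abs_prodFn_le (z := z) (β := fun i τ => D * m1 τ) fun i => hb s hs i (z i)
    rwa [prodFn_const_mul D (fun _ => m1)] at this
  · refine (ae_restrict_iff' isOpen_Omega.measurableSet).2 (Eventually.of_forall fun z hz => ?_)
    refine tendsto_const_nhds.congr' ?_
    have : ∀ᶠ s in 𝓝[>] (0 : ℝ), ∀ i, A s i (z i) = α i (z i) := by
      rw [eventually_all]
      intro i
      refine hl i _ fun hi => ?_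
      cases i with
      | inl j => simp at hi
      | inr j => exact hz j
    filter_upwards [this] with s hs
    simp [prodFn, hs]

/-- A weak solution with null faces may be tested against product functions which are odd at the
faces. -/
theorem weak_identity {H R : C2 → ℂ} (hHc : ContinuousOn H Omega) (hRc : ContinuousOn R Omega)
    (hHi : IntegrableOn (fun z => H z * wt z) Omega)
    (hRi : IntegrableOn (fun z => R z * wt z) Omega)
    (htest : ∀ φ, IsTest Omega φ →
      ∫ z in Omega, H z * lap Set.univ bv φ z = -∫ z in Omega, R z * φ z)
    (hface : ∀ j, FaceNull j H) {α : Ix → ℝ → ℝ} {C : ℝ} (hα : ∀ i, Nice C (α i))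
    (h0 : ∀ j : Fin 2, α (Sum.inr j) 0 = 0) :
    ∑ i, ∫ z in Omega, H z * (prodFn (Function.update α i (deriv (deriv (α i)))) z : ℂ) =
      -∫ z in Omega, R z * (prodFn α z : ℂ) := by
  have hcut : ∀ i, ∃ D A β γ, CutData i (α i) D A β γ := by
    intro i
    cases i with
    | inl j => exact exists_cutData_left j (hα _)
    | inr j => exact exists_cutData_right j (hα _) (h0 j)
  choose D₀ A β γ hcut using hcut
  set D : ℝ := ∑ i, |D₀ i| with hD
  have hDi : ∀ i, D₀ i ≤ D := fun i => (le_abs_self _).trans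
    (Finset.single_le_sum (f := fun i => |D₀ i|) (fun _ _ => abs_nonneg _) (Finset.mem_univ i))
  have bd : ∀ i, ∀ s ∈ Set.Ioo (0 : ℝ) (1 / 2), ∀ τ, |A i s τ| ≤ D * m1 τ ∧
      |deriv (A i s) τ| ≤ D * m1 τ ∧ |β i s τ| ≤ D * m1 τ ∧ |γ i s τ| ≤ D / s := by
    intro i s hs τ
    obtain ⟨b1, b2, b3, b4⟩ := (hcut i).bound s hs τ
    have h1 : D₀ i * m1 τ ≤ D * m1 τ := mul_le_mul_of_nonneg_right (hDi i) (m1_pos τ).le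
    exact ⟨b1.trans h1, b2.trans h1, b3.trans h1,
      b4.trans (div_le_div_of_nonneg_right (hDi i) hs.1.le)⟩
  have hβc : ∀ i, ∀ s ∈ Set.Ioo (0 : ℝ) (1 / 2), Continuous (β i s) := by
    intro i s hs
    have : β i s = fun τ => deriv (deriv (A i s)) τ - γ i s τ := by
      funext τ; rw [(hcut i).deriv2 s hs τ]; ring
    rw [this]
    exact (contDiff_deriv_of_top (contDiff_deriv_of_top ((hcut i).smooth s hs))).continuous.sub
      ((hcut i).smooth' s hs).continuous
  set a : ℝ → Ix → ℝ → ℝ := fun s i => A i s with ha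
  -- the truncated identity
  have ident : ∀ s ∈ Set.Ioo (0 : ℝ) (1 / 2),
      ∑ i, ((∫ z in Omega, H z * (prodFn (Function.update (a s) i (β i s)) z : ℂ)) +
        ∫ z in Omega, H z * (prodFn (Function.update (a s) i (γ i s)) z : ℂ)) =
      -∫ z in Omega, R z * (prodFn (a s) z : ℂ) := by
    intro s hs
    have sm : ∀ i, ContDiff ℝ ∞ (a s i) := fun i => (hcut i).smooth s hs
    have tst : IsTest Omega (fun z => (prodFn (a s) z : ℂ)) :=
      isTest_prodFn sm hs.1 fun i => (hcut i).supp s hs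
    rw [← htest _ tst]
    have hsplit : ∀ z, H z * lap Set.univ bv (fun z => (prodFn (a s) z : ℂ)) z =
        ∑ i, (H z * (prodFn (Function.update (a s) i (β i s)) z : ℂ) +
          H z * (prodFn (Function.update (a s) i (γ i s)) z : ℂ)) := by
      intro z
      rw [lap_prodFn (fun i => contDiff_infty.1 (sm i) 2), Finset.mul_sum]
      refine Finset.sum_congr rfl fun i _ => ?_
      rw [prodFn_update, prodFn_update, prodFn_update, (hcut i).deriv2 s hs]
      push_cast
      ring
    have iβ : ∀ i, IntegrableOn
        (fun z => H z * (prodFn (Function.update (a s) i (β i s)) z : ℂ)) Omega := by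
      intro i
      refine (hHi.norm.const_mul (D ^ 4)).mono' ?_ ?_
      · refine ContinuousOn.aestronglyMeasurable ?_ isOpen_Omega.measurableSet
        refine hHc.mul (Complex.continuous_ofReal.comp (continuous_prodFn fun k => ?_)).continuousOn
        by_cases hk : k = i
        · subst hk; simpa using hβc k s hs
        · rw [Function.update_of_ne hk]; exact (sm k).continuous
      · refine Eventually.of_forall fun z => ?_
        rw [norm_mul, norm_mul, Complex.norm_real, Complex.norm_real, Real.norm_eq_abs,
          Real.norm_eq_abs, abs_of_pos (wt_pos z), mul_left_comm]
        refine mul_le_mul_of_nonneg_left ?_ (norm_nonneg _)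
        have := abs_prodFn_le (z := z) (α := Function.update (a s) i (β i s))
          (β := fun i τ => D * m1 τ) fun k => by
            by_cases hk : k = i
            · subst hk; simpa using (bd k s hs _).2.2.1
            · rw [Function.update_of_ne hk]; exact (bd k s hs _).1
        rwa [prodFn_const_mul D (fun _ => m1)] at this
    have iγ : ∀ i, IntegrableOn
        (fun z => H z * (prodFn (Function.update (a s) i (γ i s)) z : ℂ)) Omega := by
      intro i
      refine setIntegral_mul_integrableOn isOpen_Omega hHc
        (isTest_prodFn (fun k => ?_) hs.1 fun k τ hτ => ?_)
      · by_cases hk : k = i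
        · subst hk; simpa using (hcut k).smooth' s hs
        · rw [Function.update_of_ne hk]; exact sm k
      · by_cases hk : k = i
        · subst hk
          rw [Function.update_self] at hτ
          obtain ⟨_, h2, h3⟩ := (hcut k).supp' s hs τ hτ
          refine ⟨?_, fun _ => h2⟩
          rw [abs_of_pos (hs.1.trans_le h2), le_div_iff₀ hs.1]
          nlinarith [hs.1, hs.2]
        · rw [Function.update_of_ne hk] at hτ; exact (hcut k).supp s hs τ hτ
    simp only [hsplit]
    rw [integral_finsetSum Finset.univ (f := fun i z =>
      H z * (prodFn (Function.update (a s) i (β i s)) z : ℂ) +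
      H z * (prodFn (Function.update (a s) i (γ i s)) z : ℂ)) fun i _ => (iβ i).add (iγ i)]
    refine Finset.sum_congr rfl fun i _ => ?_
    rw [← integral_add (iβ i) (iγ i)]
  have limβ : ∀ i, Tendsto
      (fun s => ∫ z in Omega, H z * (prodFn (Function.update (a s) i (β i s)) z : ℂ)) (𝓝[>] 0)
      (𝓝 (∫ z in Omega, H z * (prodFn (Function.update α i (deriv (deriv (α i)))) z : ℂ))) := by
    intro i
    refine tendsto_dominated_prodFn hHc hHi (D := D)
      (A := fun s => Function.update (a s) i (β i s)) (fun s hs k => ?_) (fun s hs k τ => ?_)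
      fun k τ hτ => ?_
    · by_cases hk : k = i
      · subst hk; simpa using hβc k s hs
      · simp only [Function.update_of_ne hk]; exact ((hcut k).smooth s hs).continuous
    · by_cases hk : k = i
      · subst hk; simpa using (bd k s hs τ).2.2.1
      · simp only [Function.update_of_ne hk]; exact (bd k s hs τ).1
    · filter_upwards [(hcut k).lim τ hτ] with s hs
      by_cases hk : k = i
      · subst hk; simpa using hs.2
      · simp only [Function.update_of_ne hk]; exact hs.1
  -- In the `x` directions `γ` vanishes; in a `y` direction the factor of size `1 / s` on the strip
  -- is exactly what `FaceNull` allows.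
  have limγ : ∀ i, Tendsto
      (fun s => ∫ z in Omega, H z * (prodFn (Function.update (a s) i (γ i s)) z : ℂ)) (𝓝[>] 0)
      (𝓝 0) := by
    intro i
    cases i with
    | inl j =>
      refine tendsto_const_nhds.congr' ?_
      filter_upwards [Ioo_half_mem] with s hs
      have : γ (Sum.inl j) s = 0 := by
        funext τ
        by_contra hne
        simpa using ((hcut (Sum.inl j)).supp' s hs τ hne).1
      have e : ∀ z, prodFn (Function.update (a s) (Sum.inl j) (γ (Sum.inl j) s)) z = 0 := by
        intro z; rw [prodFn_update, this]; simp
      simp [e]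
    | inr j =>
      refine hface j _ D fun s hs => ⟨fun k => ?_, fun k τ hτ => ?_, fun k hk τ => ?_, fun τ => ?_⟩
      · by_cases hk : k = Sum.inr j
        · subst hk; simpa using (hcut _).smooth' s hs
        · rw [Function.update_of_ne hk]; exact (hcut k).smooth s hs
      · by_cases hk : k = Sum.inr j
        · subst hk
          rw [Function.update_self] at hτ
          obtain ⟨_, h2, h3⟩ := (hcut _).supp' s hs τ hτ
          refine ⟨?_, fun _ => h2⟩
          rw [abs_of_pos (hs.1.trans_le h2), le_div_iff₀ hs.1]
          nlinarith [hs.1, hs.2]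
        · rw [Function.update_of_ne hk] at hτ; exact (hcut k).supp s hs τ hτ
      · rw [Function.update_of_ne hk]
        exact ⟨(bd k s hs τ).1, (bd k s hs τ).2.1⟩
      · rw [Function.update_self]
        exact ⟨(bd _ s hs τ).2.2.2, fun hne => ((hcut _).supp' s hs τ hne).2⟩
  have limR : Tendsto (fun s => -∫ z in Omega, R z * (prodFn (a s) z : ℂ)) (𝓝[>] 0)
      (𝓝 (-∫ z in Omega, R z * (prodFn α z : ℂ))) := by
    refine (tendsto_dominated_prodFn hRc hRi (D := D) (fun s hs k => ?_) (fun s hs k τ => ?_)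
      fun k τ hτ => ?_).neg
    · exact ((hcut k).smooth s hs).continuous
    · exact (bd k s hs τ).1
    · filter_upwards [(hcut k).lim τ hτ] with s hs using hs.1
  have limL := tendsto_finsetSum Finset.univ fun i _ => (limβ i).add (limγ i)
  simp only [add_zero] at limL
  refine tendsto_nhds_unique (limL.congr' ?_) limR
  filter_upwards [Ioo_half_mem] with s hs using ident s hs

end WeakLimit


/-! ### From slice norms to negligible boundary strips -/

section Slices

/-- The point of `C2` on the slice `y_j = s` with the remaining coordinates `w`. -/
noncomputable def slicePt (j : Fin 2) (p : (R2 × ℝ) × ℝ) : C2 :=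
  pt p.1.1 (WithLp.toLp 2 (Function.update (fun _ => p.1.2) j p.2))

theorem measurePreserving_pt : MeasurePreserving (fun p : R2 × (Fin 2 → ℝ) =>
    pt p.1 (WithLp.toLp 2 p.2)) := by
  have h1 : MeasurePreserving (fun p : R2 × (Fin 2 → ℝ) => (p.1.ofLp, p.2)) :=
    (PiLp.volume_preserving_ofLp (Fin 2)).prod (MeasurePreserving.id _)
  have h2 := (volume_measurePreserving_sumPiEquivProdPi_symm (fun _ : Ix => ℝ)).comp h1
  have h3 := (PiLp.volume_preserving_toLp Ix).comp h2
  convert h3 using 1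
  funext p
  ext i
  cases i <;> rfl

theorem measurePreserving_slicePt (j : Fin 2) : MeasurePreserving (slicePt j) := by
  have ha : MeasurePreserving (MeasurableEquiv.prodAssoc : (R2 × ℝ) × ℝ ≃ᵐ R2 × ℝ × ℝ) :=
    volume_preserving_prodAssoc
  have hs : MeasurePreserving (fun p : ℝ × ℝ => (Function.update (fun _ => p.1) j p.2 : Fin 2 → ℝ)) := by
    have h2 := (volume_preserving_finTwoArrow ℝ).symm
    have hj : j = 0 ∨ j = 1 := by fin_cases j <;> simp
    rcases hj with rfl | rfl
    · have e : (fun p : ℝ × ℝ => (Function.update (fun _ => p.1) 0 p.2 : Fin 2 → ℝ)) =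
          MeasurableEquiv.finTwoArrow.symm ∘ Prod.swap := by
        funext p k
        have hk : k = 0 ∨ k = 1 := by fin_cases k <;> simp
        rcases hk with rfl | rfl <;> rfl
      rw [e]
      exact h2.comp (Measure.measurePreserving_swap (μ := (volume : Measure ℝ))
        (ν := (volume : Measure ℝ)))
    · have e : (fun p : ℝ × ℝ => (Function.update (fun _ => p.1) 1 p.2 : Fin 2 → ℝ)) =
          MeasurableEquiv.finTwoArrow.symm := by
        funext p k
        have hk : k = 0 ∨ k = 1 := by fin_cases k <;> simp
        rcases hk with rfl | rfl <;> rfl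
      rw [e]
      exact h2
  exact measurePreserving_pt.comp (((MeasurePreserving.id (volume : Measure R2)).prod hs).comp ha)

theorem slicePt_self (j : Fin 2) (p : (R2 × ℝ) × ℝ) : slicePt j p (Sum.inr j) = p.2 :=
  Function.update_self (β := fun _ => ℝ) j p.2 (fun _ => p.1.2)

theorem slicePt_other {j k : Fin 2} (h : k ≠ j) (p : (R2 × ℝ) × ℝ) :
    slicePt j p (Sum.inr k) = p.1.2 :=
  Function.update_of_ne (β := fun _ => ℝ) h p.2 (fun _ => p.1.2)

theorem slicePt_left (j k : Fin 2) (p : (R2 × ℝ) × ℝ) :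
    slicePt j p (Sum.inl k) = p.1.1 k := rfl

theorem slicePt_mem_Omega (j : Fin 2) (p : (R2 × ℝ) × ℝ) :
    slicePt j p ∈ Omega ↔ 0 < p.1.2 ∧ 0 < p.2 := by
  have : ∃ k : Fin 2, k ≠ j := ⟨j + 1, by fin_cases j <;> simp⟩
  constructor
  · intro h
    obtain ⟨k, hk⟩ := this
    exact ⟨by simpa [slicePt_other hk] using h k, by simpa [slicePt_self] using h j⟩
  · rintro ⟨h1, h2⟩ k
    by_cases hk : k = j
    · subst hk; rwa [slicePt_self]
    · rwa [slicePt_other hk]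

theorem continuous_slicePt (j : Fin 2) : Continuous (slicePt j) := by
  have : slicePt j = fun p => WithLp.toLp 2 (Sum.elim (fun k => p.1.1 k)
      (Function.update (fun _ => p.1.2) j p.2)) := rfl
  rw [this]
  refine (PiLp.continuous_toLp 2 _).comp (continuous_pi fun i => ?_)
  cases i with
  | inl k => simp only [Sum.elim_inl]; fun_prop
  | inr k =>
    simp only [Sum.elim_inr]
    by_cases hk : k = j
    · subst hk; simp only [Function.update_self]; fun_prop
    · simp only [Function.update_of_ne hk]; fun_prop

/-- The weight in the three variables of a slice. -/
noncomputable def wt3 (w : R2 × ℝ) : ℝ := m1 (w.1 0) * m1 (w.1 1) * m1 w.2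

theorem integrable_m1_R2 : Integrable (fun x : R2 => m1 (x 0) * m1 (x 1)) := by
  have := (Integrable.fintype_prod (f := fun _ : Fin 2 => m1) (μ := fun _ => volume)
    fun _ => integrable_m1)
  rw [← volume_pi] at this
  have h2 := (PiLp.volume_preserving_ofLp (Fin 2)).integrable_comp_of_integrable this
  simpa [Function.comp_def, Fin.prod_univ_two] using h2

theorem integrable_wt3 : Integrable wt3 := integrable_m1_R2.mul_prod integrable_m1

theorem wt3_le_one (w : R2 × ℝ) : wt3 w ≤ 1 := by
  unfold wt3
  exact mul_le_one₀ (mul_le_one₀ (m1_le_one _) (m1_pos _).le (m1_le_one _)) (m1_pos _).le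
    (m1_le_one _)

/-- The weight living on the strip `s ≤ y_j ≤ 2 s`. -/
noncomputable def stripWt (j : Fin 2) (s : ℝ) (z : C2) : ℝ :=
  (Set.Icc s (2 * s)).indicator (fun _ => s⁻¹) (z (Sum.inr j)) *
    ∏ i ∈ Finset.univ.erase (Sum.inr j), m1 (z i)

theorem prod_erase_slicePt (j : Fin 2) (p : (R2 × ℝ) × ℝ) :
    ∏ i ∈ Finset.univ.erase (Sum.inr j : Ix), m1 (slicePt j p i) = wt3 p.1 := by
  fin_cases j
  · have : (Finset.univ.erase (Sum.inr 0 : Ix)) = {Sum.inl 0, Sum.inl 1, Sum.inr 1} := by decide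
    simp only [Fin.zero_eta]
    rw [this, Finset.prod_insert (by decide), Finset.prod_insert (by decide),
      Finset.prod_singleton, slicePt_left, slicePt_left, slicePt_other (by decide)]
    simp [wt3, mul_assoc]
  · have : (Finset.univ.erase (Sum.inr 1 : Ix)) = {Sum.inl 0, Sum.inl 1, Sum.inr 0} := by decide
    simp only [Fin.mk_one]
    rw [this, Finset.prod_insert (by decide), Finset.prod_insert (by decide),
      Finset.prod_singleton, slicePt_left, slicePt_left, slicePt_other (by decide)]
    simp [wt3, mul_assoc]

theorem stripWt_nonneg (j : Fin 2) {s : ℝ} (hs : 0 < s) (z : C2) : 0 ≤ stripWt j s z := by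
  unfold stripWt
  refine mul_nonneg (Set.indicator_nonneg (fun _ _ => (inv_pos.2 hs).le) _)
    (Finset.prod_nonneg fun _ _ => (m1_pos _).le)

/-- The factor in `y_j` is at most `D / s` and supported on the strip, and each of the other three
is at most `D m1`: four factors `D` in all. -/
theorem abs_prodFn_le_stripWt {j : Fin 2} {s D : ℝ} (hs : 0 < s) {α : Ix → ℝ → ℝ}
    (h1 : ∀ i, i ≠ Sum.inr j → ∀ τ, |α i τ| ≤ D * m1 τ)
    (h2 : ∀ τ, |α (Sum.inr j) τ| ≤ D / s ∧ (α (Sum.inr j) τ ≠ 0 → s ≤ τ ∧ τ ≤ 2 * s)) (z : C2) :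
    |prodFn α z| ≤ D ^ 4 * stripWt j s z := by
  have hD : 0 ≤ D / s := (abs_nonneg _).trans (h2 0).1
  have e : prodFn α z = α (Sum.inr j) (z (Sum.inr j)) *
      ∏ k ∈ Finset.univ.erase (Sum.inr j), α k (z k) := by
    have := prodFn_update α (Sum.inr j) (α (Sum.inr j)) z
    rwa [Function.update_eq_self] at this
  rw [e, abs_mul, Finset.abs_prod, stripWt]
  have c1 : |α (Sum.inr j) (z (Sum.inr j))| ≤
      D * (Set.Icc s (2 * s)).indicator (fun _ => s⁻¹) (z (Sum.inr j)) := by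
    by_cases h0 : α (Sum.inr j) (z (Sum.inr j)) = 0
    · rw [h0, abs_zero]
      have hD' : 0 ≤ D := by
        rw [div_eq_mul_inv] at hD
        exact nonneg_of_mul_nonneg_left hD (inv_pos.2 hs)
      exact mul_nonneg hD' (Set.indicator_nonneg (fun _ _ => (inv_pos.2 hs).le) _)
    · rw [Set.indicator_of_mem (Set.mem_Icc.2 ((h2 _).2 h0)), ← div_eq_mul_inv]
      exact (h2 _).1
  have c2 : ∏ k ∈ Finset.univ.erase (Sum.inr j : Ix), |α k (z k)| ≤
      ∏ k ∈ Finset.univ.erase (Sum.inr j : Ix), (D * m1 (z k)) :=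
    Finset.prod_le_prod (fun _ _ => abs_nonneg _) fun k hk => h1 k (Finset.ne_of_mem_erase hk) _
  rw [Finset.prod_mul_distrib, Finset.prod_const, Finset.card_erase_of_mem (Finset.mem_univ _)] at c2
  simp only [Finset.card_univ, Fintype.card_sum, Fintype.card_fin] at c2
  calc _ ≤ (D * (Set.Icc s (2 * s)).indicator (fun _ => s⁻¹) (z (Sum.inr j))) *
        (D ^ 3 * ∏ k ∈ Finset.univ.erase (Sum.inr j : Ix), m1 (z k)) :=
        mul_le_mul c1 c2 (Finset.prod_nonneg fun _ _ => abs_nonneg _) ((abs_nonneg _).trans c1)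
    _ = _ := by ring

theorem lintegral_slice {F : C2 → ENNReal} (hF : AEMeasurable F) (j : Fin 2) :
    ∫⁻ z, F z = ∫⁻ τ : ℝ, ∫⁻ w : R2 × ℝ, F (slicePt j (w, τ)) := by
  rw [← (measurePreserving_slicePt j).map_eq, lintegral_map' _ (measurePreserving_slicePt j).aemeasurable]
  · rw [Measure.volume_eq_prod, lintegral_prod_symm]
    exact (hF.comp_quasiMeasurePreserving (measurePreserving_slicePt j).quasiMeasurePreserving)
  · rwa [(measurePreserving_slicePt j).map_eq]

/-- If the slice norms of `h` tend to zero, then `h` is negligible on thin strips. -/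
theorem tendsto_strip {j : Fin 2} {h : C2 → ℂ} (hc : ContinuousOn h Omega) {q : ENNReal}
    (hq1 : 2 < q) (hq2 : q < ⊤) (hs : Tendsto (sliceNorm j q h) (𝓝[>] 0) (𝓝 0)) :
    Tendsto (fun s => ∫⁻ z in Omega, ‖h z‖ₑ * ENNReal.ofReal (stripWt j s z)) (𝓝[>] 0) (𝓝 0) := by
  set r : ℝ := q.toReal with hr
  have hr2 : 2 < r := by
    have := (ENNReal.toReal_lt_toReal (by simp) hq2.ne).2 hq1
    simpa using this
  have hconj := Real.HolderConjugate.conjExponent (show 1 < r by linarith)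
  set r' := r.conjExponent with hr'
  have hr'1 : 1 ≤ r' := hconj.symm.lt.le
  set K : ENNReal := (∫⁻ w : R2 × ℝ, ENNReal.ofReal (wt3 w)) ^ (1 / r') with hK
  have hKtop : K ≠ ⊤ := by
    refine ENNReal.rpow_ne_top_of_nonneg (by positivity) ?_
    exact (integrable_wt3.lintegral_lt_top).ne
  set S : Set (R2 × ℝ) := {w | 0 < w.2} with hS
  have hSm : MeasurableSet S := measurableSet_lt measurable_const measurable_snd
  have cw : Continuous wt3 := by
    unfold wt3
    exact ((continuous_m1.comp (by fun_prop)).mul (continuous_m1.comp (by fun_prop))).mul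
      (continuous_m1.comp (by fun_prop))
  -- Hölder on a slice
  have holder : ∀ τ : ℝ, 0 < τ →
      ∫⁻ w in S, ‖h (slicePt j (w, τ))‖ₑ * ENNReal.ofReal (wt3 w) ≤ sliceNorm j q h τ * K := by
    intro τ hτ
    have hm : AEMeasurable (fun w : R2 × ℝ => ‖h (slicePt j (w, τ))‖ₑ) (volume.restrict S) := by
      have : ContinuousOn (fun w : R2 × ℝ => h (slicePt j (w, τ))) S :=
        hc.comp ((continuous_slicePt j).comp (by fun_prop)).continuousOn fun w hw =>
          (slicePt_mem_Omega j _).2 ⟨hw, hτ⟩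
      exact (this.aestronglyMeasurable hSm).enorm
    have hg : AEMeasurable (fun w : R2 × ℝ => ENNReal.ofReal (wt3 w)) (volume.restrict S) :=
      (cw.measurable.ennreal_ofReal).aemeasurable
    refine (ENNReal.lintegral_mul_le_Lp_mul_Lq _ hconj hm hg).trans ?_
    refine mul_le_mul' (le_of_eq ?_) ?_
    · unfold sliceNorm
      rw [eLpNorm_eq_lintegral_rpow_enorm_toReal (by rintro rfl; simp at hq1) hq2.ne]
      rfl
    -- As `wt3 ≤ 1` and `r' ≥ 1`, the power `wt3 ^ r'` is at most `wt3`, which is integrable. The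
    -- resulting constant `K` does not depend on the slice.
    · refine ENNReal.rpow_le_rpow ?_ (by positivity)
      refine (setLIntegral_le_lintegral _ _).trans (lintegral_mono fun w => ?_)
      refine ENNReal.rpow_le_self_of_le_one ?_ hr'1
      exact ENNReal.ofReal_le_one.2 (wt3_le_one w)
  -- Fubini
  have fub : ∀ s : ℝ, 0 < s → ∫⁻ z in Omega, ‖h z‖ₑ * ENNReal.ofReal (stripWt j s z) =
      ∫⁻ τ in Set.Icc s (2 * s), ENNReal.ofReal s⁻¹ *
        ∫⁻ w in S, ‖h (slicePt j (w, τ))‖ₑ * ENNReal.ofReal (wt3 w) := by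
    intro s hs0
    have hmeas : Measurable (stripWt j s) := by
      unfold stripWt
      refine Measurable.mul ?_ ?_
      · exact (measurable_const.indicator measurableSet_Icc).comp (by fun_prop)
      · exact Finset.measurable_fun_prod _ fun i _ => continuous_m1.measurable.comp (by fun_prop)
    have hFm : AEMeasurable (Omega.indicator fun z => ‖h z‖ₑ * ENNReal.ofReal (stripWt j s z)) := by
      refine (aemeasurable_indicator_iff isOpen_Omega.measurableSet).2 ?_
      exact (hc.aestronglyMeasurable isOpen_Omega.measurableSet).enorm.mul
        hmeas.ennreal_ofReal.aemeasurable
    rw [← lintegral_indicator isOpen_Omega.measurableSet, lintegral_slice hFm j,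
      ← lintegral_indicator measurableSet_Icc]
    refine lintegral_congr fun τ => ?_
    by_cases hτ : τ ∈ Set.Icc s (2 * s)
    · rw [Set.indicator_of_mem hτ, ← lintegral_indicator hSm, ← lintegral_const_mul' _ _ (by simp)]
      refine lintegral_congr fun w => ?_
      by_cases hw : w ∈ S
      · rw [Set.indicator_of_mem hw, Set.indicator_of_mem ((slicePt_mem_Omega j (w, τ)).2
          ⟨hw, hs0.trans_le hτ.1⟩), stripWt, prod_erase_slicePt, slicePt_self,
          Set.indicator_of_mem hτ, ENNReal.ofReal_mul (inv_pos.2 hs0).le]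
        ring
      · rw [Set.indicator_of_notMem hw, Set.indicator_of_notMem, mul_zero]
        intro hmem
        exact hw ((slicePt_mem_Omega j _).1 hmem).1
    · rw [Set.indicator_of_notMem hτ]
      refine (lintegral_congr fun w => ?_).trans lintegral_zero
      refine Set.indicator_apply_eq_zero.2 fun _ => ?_
      rw [stripWt, slicePt_self, Set.indicator_of_notMem hτ]
      simp
  rw [ENNReal.tendsto_nhds_zero] at hs ⊢
  intro ε hε
  by_cases hε' : ε = ⊤
  · subst hε'; simp
  -- Dividing by `K + 1` avoids a separate case `K = 0`.
  have hδ : 0 < ε / (K + 1) := ENNReal.div_pos hε.ne' (by simp [hKtop])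
  obtain ⟨δ, hδ0, hδ1⟩ := mem_nhdsGT_iff_exists_Ioo_subset.1 (hs _ hδ)
  have hδ0' : (0 : ℝ) < δ := hδ0
  -- For `s < δ / 2` all slices of the strip `[s, 2 s]` are below the threshold, and the weight `1 /
  -- s` turns the integral over the strip into an average.
  filter_upwards [Ioo_mem_nhdsGT (show (0 : ℝ) < δ / 2 by positivity)] with s hs1
  rw [fub s hs1.1]
  calc _ ≤ ∫⁻ τ in Set.Icc s (2 * s), ENNReal.ofReal s⁻¹ * ε := by
        refine setLIntegral_mono' measurableSet_Icc fun τ hτ => ?_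
        gcongr
        have hτ0 : 0 < τ := hs1.1.trans_le hτ.1
        refine (holder τ hτ0).trans ?_
        have : sliceNorm j q h τ ≤ ε / (K + 1) := hδ1 ⟨hτ0, by linarith [hτ.2, hs1.2]⟩
        calc sliceNorm j q h τ * K ≤ ε / (K + 1) * (K + 1) := by
              gcongr; exact le_self_add
          _ = ε := ENNReal.div_mul_cancel (by simp) (by simp [hKtop])
    _ = ε := by
        rw [setLIntegral_const, Real.volume_Icc, show 2 * s - s = s by ring, mul_right_comm,
          ← ENNReal.ofReal_mul (inv_pos.2 hs1.1).le, inv_mul_cancel₀ hs1.1.ne']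
        simp

/-- A bound by strip integrals for integrals against product functions. -/
theorem tendsto_of_strip {j : Fin 2} {h : C2 → ℂ}
    (hs : Tendsto (fun s => ∫⁻ z in Omega, ‖h z‖ₑ * ENNReal.ofReal (stripWt j s z)) (𝓝[>] 0) (𝓝 0))
    {ψ : ℝ → C2 → ℂ} {D : ℝ}
    (hψ : ∀ s ∈ Set.Ioo (0 : ℝ) (1 / 2), ∀ z, ‖ψ s z‖ ≤ D * stripWt j s z) :
    Tendsto (fun s => ∫ z in Omega, h z * ψ s z) (𝓝[>] 0) (𝓝 0) := by
  have h1 : Tendsto (fun s => ENNReal.ofReal D * ∫⁻ z in Omega, ‖h z‖ₑ *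
      ENNReal.ofReal (stripWt j s z)) (𝓝[>] 0) (𝓝 0) := by
    have := ENNReal.Tendsto.const_mul hs (a := ENNReal.ofReal D) (Or.inr (by simp))
    simpa using this
  rw [tendsto_iff_enorm_sub_tendsto_zero]
  simp only [sub_zero]
  refine tendsto_of_tendsto_of_tendsto_of_le_of_le' tendsto_const_nhds h1
    (Eventually.of_forall fun _ => zero_le) ?_
  filter_upwards [Ioo_half_mem] with s hs'
  refine (enorm_integral_le_lintegral_enorm _).trans ?_
  rw [← lintegral_const_mul' _ _ (by simp)]
  refine lintegral_mono fun z => ?_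
  rw [enorm_mul, mul_left_comm]
  gcongr
  rw [← ENNReal.ofReal_mul', ← ofReal_norm]
  · exact ENNReal.ofReal_le_ofReal (hψ s hs' z)
  · exact stripWt_nonneg j hs'.1 z

theorem faceNull_of_strip {j : Fin 2} {h : C2 → ℂ}
    (hs : Tendsto (fun s => ∫⁻ z in Omega, ‖h z‖ₑ * ENNReal.ofReal (stripWt j s z))
      (𝓝[>] 0) (𝓝 0)) : FaceNull j h := by
  intro α D hα
  refine tendsto_of_strip hs (D := D ^ 4) fun s hs' z => ?_
  rw [Complex.norm_real, Real.norm_eq_abs]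
  obtain ⟨_, _, h3, h4⟩ := hα s hs'
  exact abs_prodFn_le_stripWt hs'.1 (fun i hi τ => (h3 i hi τ).1) h4 z

/-- The derivative `∂/∂z̄_k` of a function negligible near the face `y_j = 0`, `j ≠ k`, does not
see that face. -/
theorem faceNull_dbar {j k : Fin 2} (hjk : k ≠ j) {h : C2 → ℂ} (hh : ContDiffOn ℝ 1 h Omega)
    (hs : Tendsto (fun s => ∫⁻ z in Omega, ‖h z‖ₑ * ENNReal.ofReal (stripWt j s z))
      (𝓝[>] 0) (𝓝 0)) : FaceNull j (dbar k h) := by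
  intro α D hα
  have hne : ∀ i : Ix, i = Sum.inl k ∨ i = Sum.inr k → i ≠ Sum.inr j := by
    rintro i (rfl | rfl) <;> simp [hjk]
  have lim : ∀ i : Ix, i = Sum.inl k ∨ i = Sum.inr k →
      Tendsto (fun s => ∫ z in Omega, pd Omega (bv i) h z * (prodFn (α s) z : ℂ)) (𝓝[>] 0)
        (𝓝 0) := by
    intro i hi
    -- Both directions in `∂/∂z̄_k` are tangential to the face `y_j = 0`. Integrating by parts, the
    -- derivative lands on a factor other than the one in `y_j`; this is why `FaceNull` also bounds
    -- the derivatives of those factors.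
    have h0 : Tendsto (fun s => ∫ z in Omega, h z *
        (prodFn (Function.update (α s) i (deriv (α s i))) z : ℂ)) (𝓝[>] 0) (𝓝 0) := by
      refine tendsto_of_strip hs (D := D ^ 4) fun s hs' z => ?_
      rw [Complex.norm_real, Real.norm_eq_abs]
      obtain ⟨_, _, h3, h4⟩ := hα s hs'
      refine abs_prodFn_le_stripWt hs'.1 (fun l hl τ => ?_) ?_ z
      · by_cases hli : l = i
        · subst hli; simpa using (h3 l hl τ).2
        · rw [Function.update_of_ne hli]; exact (h3 l hl τ).1
      · rw [Function.update_of_ne (hne i hi).symm]; exact h4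
    have h0' := h0.neg
    rw [neg_zero] at h0'
    refine h0'.congr' ?_
    filter_upwards [Ioo_half_mem] with s hs'
    obtain ⟨h1, h2, _, _⟩ := hα s hs'
    have tst := isTest_prodFn h1 hs'.1 h2
    rw [setIntegral_pd_mul isOpen_Omega hh (contDiff_infty.1 tst.smooth 1) tst.compact tst.support,
      pd_prodFn fun i => (h1 i).differentiable (by simp)]
  have htot := ((lim (Sum.inl k) (Or.inl rfl)).add
    ((lim (Sum.inr k) (Or.inr rfl)).const_mul Complex.I)).const_mul (1 / 2 : ℂ)
  simp only [mul_zero, add_zero] at htot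
  refine htot.congr' ?_
  filter_upwards [Ioo_half_mem] with s hs'
  obtain ⟨h1, h2, _, _⟩ := hα s hs'
  have tst := isTest_prodFn h1 hs'.1 h2
  have ii : ∀ i, IntegrableOn (fun z => pd Omega (bv i) h z * (prodFn (α s) z : ℂ)) Omega := fun i =>
    setIntegral_mul_integrableOn isOpen_Omega
      (contDiffOn_pd isOpen_Omega hh (m := 0) (by norm_num) _).continuousOn tst
  rw [← integral_const_mul, ← integral_add (ii _) ((ii _).const_mul _), ← integral_const_mul]
  refine setIntegral_congr_fun isOpen_Omega.measurableSet fun z hz => ?_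
  simp only [dbar, pd_eq_fderiv (isOpen_Omega.mem_nhds hz), bv]
  ring

theorem lintegral_stripWt (j : Fin 2) {s : ℝ} (hs : 0 < s) :
    ∫⁻ z, ENNReal.ofReal (stripWt j s z) = ∫⁻ w, ENNReal.ofReal (wt3 w) := by
  have hmeas : Measurable (stripWt j s) := by
    unfold stripWt
    refine Measurable.mul ?_ ?_
    · exact (measurable_const.indicator measurableSet_Icc).comp (by fun_prop)
    · exact Finset.measurable_fun_prod _ fun i _ => continuous_m1.measurable.comp (by fun_prop)
  rw [lintegral_slice hmeas.ennreal_ofReal.aemeasurable j]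
  have : ∀ τ : ℝ, ∫⁻ w : R2 × ℝ, ENNReal.ofReal (stripWt j s (slicePt j (w, τ))) =
      (Set.Icc s (2 * s)).indicator (fun _ => ENNReal.ofReal s⁻¹ * ∫⁻ w, ENNReal.ofReal (wt3 w)) τ := by
    intro τ
    simp only [stripWt, slicePt_self, prod_erase_slicePt]
    by_cases hτ : τ ∈ Set.Icc s (2 * s)
    · simp only [Set.indicator_of_mem hτ, ENNReal.ofReal_mul (inv_pos.2 hs).le]
      rw [lintegral_const_mul' _ _ (by simp)]
    · simp [Set.indicator_of_notMem hτ]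
  simp only [this]
  rw [lintegral_indicator measurableSet_Icc, setLIntegral_const, Real.volume_Icc,
    show 2 * s - s = s by ring, mul_right_comm,
    ← ENNReal.ofReal_mul (inv_pos.2 hs).le, inv_mul_cancel₀ hs.ne']
  simp

/-- Functions of size `y_j` near the face `y_j = 0` do not see that face. -/
theorem faceNull_of_bound {j : Fin 2} {h : C2 → ℂ} {C : ℝ}
    (hb : ∀ z ∈ Omega, ‖h z‖ ≤ C * z (Sum.inr j)) : FaceNull j h := by
  refine faceNull_of_strip ?_
  set I : ENNReal := ∫⁻ w, ENNReal.ofReal (wt3 w) with hI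
  have hItop : I ≠ ⊤ := integrable_wt3.lintegral_lt_top.ne
  have h1 : Tendsto (fun s : ℝ => ENNReal.ofReal (C * (2 * s)) * I) (𝓝[>] 0) (𝓝 0) := by
    have : Tendsto (fun s : ℝ => ENNReal.ofReal (C * (2 * s))) (𝓝[>] 0) (𝓝 0) := by
      have h2 : Tendsto (fun s : ℝ => ENNReal.ofReal (C * (2 * s))) (𝓝 0)
          (𝓝 (ENNReal.ofReal (C * (2 * 0)))) :=
        (ENNReal.continuous_ofReal.comp (by fun_prop : Continuous fun s : ℝ => C * (2 * s))).tendsto 0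
      simp only [mul_zero, ENNReal.ofReal_zero] at h2
      exact h2.mono_left nhdsWithin_le_nhds
    have h3 := ENNReal.Tendsto.mul_const this (b := I) (Or.inr hItop)
    simpa using h3
  refine tendsto_of_tendsto_of_tendsto_of_le_of_le' tendsto_const_nhds h1
    (Eventually.of_forall fun _ => zero_le) ?_
  filter_upwards [self_mem_nhdsWithin] with s hs
  have hs0 : (0 : ℝ) < s := hs
  have hC : 0 ≤ C := by
    have h2 := hb (bv (Sum.inr 0) + bv (Sum.inr 1)) (fun k => by fin_cases k <;> simp [bv])
    have h3 : (bv (Sum.inr 0) + bv (Sum.inr 1)) (Sum.inr j) = 1 := by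
      fin_cases j <;> simp [bv]
    rw [h3, mul_one] at h2
    exact (norm_nonneg _).trans h2
  rw [hI, ← lintegral_stripWt j hs0, ← lintegral_const_mul' _ _ (by simp)]
  refine (setLIntegral_mono' isOpen_Omega.measurableSet fun z hz => ?_).trans
    (setLIntegral_le_lintegral _ _)
  by_cases hτ : z (Sum.inr j) ∈ Set.Icc s (2 * s)
  · gcongr
    rw [← ofReal_norm]
    refine ENNReal.ofReal_le_ofReal ((hb z hz).trans ?_)
    gcongr
    exact hτ.2
  · simp [stripWt, Set.indicator_of_notMem hτ]

theorem FaceNull.sub {j : Fin 2} {h h' : C2 → ℂ} (h1 : FaceNull j h) (h2 : FaceNull j h')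
    (c1 : ContinuousOn h Omega) (c2 : ContinuousOn h' Omega) :
    FaceNull j (fun z => h z - h' z) := by
  intro α D hα
  have h3 := (h1 α D hα).sub (h2 α D hα)
  rw [sub_zero] at h3
  refine h3.congr' ?_
  filter_upwards [Ioo_half_mem] with s hs
  have tst := isTest_prodFn (hα s hs).1 hs.1 (hα s hs).2.1
  rw [← integral_sub (setIntegral_mul_integrableOn isOpen_Omega c1 tst)
    (setIntegral_mul_integrableOn isOpen_Omega c2 tst)]
  simp only [sub_mul]

end Slices


/-! ### The one-dimensional heat kernel -/

section Gauss

/-- The heat kernel of the line. -/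
noncomputable def g1 (t τ : ℝ) : ℝ := (√(4 * Real.pi * t))⁻¹ * Real.exp (-(τ ^ 2 / (4 * t)))

/-- The second derivative of `g1 t`. -/
noncomputable def g2 (t τ : ℝ) : ℝ := (τ ^ 2 / (4 * t ^ 2) - 1 / (2 * t)) * g1 t τ

theorem g1_pos {t : ℝ} (ht : 0 < t) (τ : ℝ) : 0 < g1 t τ := by
  unfold g1
  have := Real.pi_pos
  positivity

theorem g1_even (t τ : ℝ) : g1 t (-τ) = g1 t τ := by simp [g1]

theorem contDiff_g1 (t : ℝ) : ContDiff ℝ ∞ (g1 t) := by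
  unfold g1
  fun_prop

theorem hasDerivAt_g1 (t τ : ℝ) : HasDerivAt (g1 t) (-(τ / (2 * t)) * g1 t τ) τ := by
  have h1 : HasDerivAt (fun τ : ℝ => -(τ ^ 2 / (4 * t))) (-(2 * τ / (4 * t))) τ := by
    have := ((hasDerivAt_pow 2 τ).div_const (4 * t)).fun_neg
    simpa using this
  have h2 := h1.exp.const_mul (√(4 * Real.pi * t))⁻¹
  refine h2.congr_deriv ?_
  unfold g1
  rw [show 2 * τ / (4 * t) = τ / (2 * t) by
    rw [show 4 * t = 2 * (2 * t) by ring, mul_div_mul_left _ _ two_ne_zero]]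
  ring

theorem deriv_g1 (t : ℝ) : deriv (g1 t) = fun τ => -(τ / (2 * t)) * g1 t τ :=
  funext fun τ => (hasDerivAt_g1 t τ).deriv

theorem deriv2_g1 {t : ℝ} (ht : t ≠ 0) : deriv (deriv (g1 t)) = g2 t := by
  funext τ
  rw [deriv_g1]
  have h1 : HasDerivAt (fun τ : ℝ => -(τ / (2 * t))) (-(1 / (2 * t))) τ :=
    ((hasDerivAt_id τ).div_const _).neg
  refine ((h1.mul (hasDerivAt_g1 t τ)).deriv).trans ?_
  unfold g2
  field_simp
  ring

/-- The heat equation on the line. -/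
theorem hasDerivAt_g1_time {t : ℝ} (ht : 0 < t) (τ : ℝ) :
    HasDerivAt (fun t => g1 t τ) (g2 t τ) t := by
  have hpos : 0 < 4 * Real.pi * t := by have := Real.pi_pos; positivity
  have h1 : HasDerivAt (fun t : ℝ => 4 * Real.pi * t) (4 * Real.pi) t := by
    simpa using (hasDerivAt_id t).const_mul (4 * Real.pi)
  have h2 := (h1.sqrt hpos.ne').fun_inv (Real.sqrt_pos.2 hpos).ne'
  have h3 : HasDerivAt (fun t : ℝ => -(τ ^ 2 / (4 * t))) (τ ^ 2 / (4 * t ^ 2)) t := by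
    have := ((hasDerivAt_inv ht.ne').const_mul (τ ^ 2 / 4)).fun_neg
    refine (this.congr_deriv ?_).congr_of_eventuallyEq (Eventually.of_forall fun x => ?_)
    · field_simp
    · ring
  refine (h2.mul h3.exp).congr_deriv ?_
  unfold g2 g1
  rw [Real.sq_sqrt hpos.le]
  have hs := Real.sqrt_pos.2 hpos
  have hs2 := Real.sq_sqrt hpos.le
  field_simp
  ring

theorem measurable_g1 : Measurable (fun p : ℝ × ℝ => g1 p.1 p.2) := by
  unfold g1
  fun_prop

theorem integral_g1 {t : ℝ} (ht : 0 < t) : ∫ τ, g1 t τ = 1 := by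
  unfold g1
  rw [integral_const_mul]
  have h : ∀ τ : ℝ, Real.exp (-(τ ^ 2 / (4 * t))) = Real.exp (-(1 / (4 * t)) * τ ^ 2) := by
    intro τ; congr 1; ring
  simp only [h]
  rw [integral_gaussian, div_div_eq_mul_div, div_one, show Real.pi * (4 * t) = 4 * Real.pi * t by ring,
    inv_mul_cancel₀]
  have := Real.pi_pos
  positivity

theorem integrable_g1 {t : ℝ} (ht : 0 < t) : Integrable (g1 t) :=
  Integrable.of_integral_ne_zero (by rw [integral_g1 ht]; exact one_ne_zero)

/-- A Peetre inequality: translating the weight costs a constant depending on the shift only. -/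
theorem m1_sub_le (a τ : ℝ) : m1 (τ - a) ≤ 2 * (1 + a ^ 2) * m1 τ := by
  unfold m1
  rw [← div_eq_mul_inv, le_div_iff₀ (by positivity), inv_mul_le_iff₀ (by positivity)]
  nlinarith [sq_nonneg (τ - 2 * a), sq_nonneg (a * (τ - a)), sq_nonneg (τ - a)]

/-- For times in a compact interval of positive numbers, `g1 t` times `(1 + τ²)²` is uniformly
bounded. One factor `1 + τ²` absorbs the polynomials that appear in the first two derivatives, the
other becomes `m1`. -/
theorem exists_g1_bound {t₁ t₂ : ℝ} (h1 : 0 < t₁) (h12 : t₁ ≤ t₂) :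
    ∃ C, ∀ t ∈ Set.Icc t₁ t₂, Nice C (g1 t) := by
  -- The bound `c ≤ 1` gives `1 + τ² ≤ c⁻¹ exp (c τ²)`, and `c ≤ 1 / (8 t₂)` makes the square of
  -- this exponential at most `exp (τ² / (4 t))`.
  set c : ℝ := min (1 / (8 * t₂)) 1 with hc
  have ht2 : 0 < t₂ := h1.trans_le h12
  have hc0 : 0 < c := lt_min (by positivity) one_pos
  set A : ℝ := (√(4 * Real.pi * t₁))⁻¹ * (c⁻¹) ^ 2 with hA
  have hA0 : 0 ≤ A := by positivity
  have main : ∀ t ∈ Set.Icc t₁ t₂, ∀ τ, g1 t τ * (1 + τ ^ 2) ^ 2 ≤ A := by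
    intro t ht τ
    have ht0 : 0 < t := h1.trans_le ht.1
    have e1 : (√(4 * Real.pi * t))⁻¹ ≤ (√(4 * Real.pi * t₁))⁻¹ := by
      have := Real.pi_pos
      refine inv_anti₀ (by positivity) (Real.sqrt_le_sqrt ?_)
      have := ht.1
      gcongr
    have e2 : 1 + τ ^ 2 ≤ c⁻¹ * Real.exp (c * τ ^ 2) := by
      have h3 := Real.add_one_le_exp (c * τ ^ 2)
      rw [le_inv_mul_iff₀ hc0]
      have : c ≤ 1 := min_le_right _ _
      nlinarith
    have e3 : (1 + τ ^ 2) ^ 2 ≤ (c⁻¹) ^ 2 * Real.exp (τ ^ 2 / (4 * t)) := by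
      calc (1 + τ ^ 2) ^ 2 ≤ (c⁻¹ * Real.exp (c * τ ^ 2)) ^ 2 := by gcongr
        _ = (c⁻¹) ^ 2 * Real.exp (2 * (c * τ ^ 2)) := by
            rw [mul_pow, ← Real.exp_nat_mul]; norm_num
        _ ≤ _ := by
            gcongr
            have h4 : c ≤ 1 / (8 * t₂) := min_le_left _ _
            have h5 : 1 / (8 * t₂) ≤ 1 / (8 * t) := by
              have := ht.2
              gcongr
            have h6 : 2 * (c * τ ^ 2) ≤ 2 * (1 / (8 * t) * τ ^ 2) := by
              have := h4.trans h5
              gcongr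
            refine h6.trans (le_of_eq ?_)
            field_simp
            ring
    unfold g1
    rw [mul_assoc]
    calc _ ≤ (√(4 * Real.pi * t₁))⁻¹ * (Real.exp (-(τ ^ 2 / (4 * t))) *
          ((c⁻¹) ^ 2 * Real.exp (τ ^ 2 / (4 * t)))) := by gcongr
      _ = A * (Real.exp (-(τ ^ 2 / (4 * t))) * Real.exp (τ ^ 2 / (4 * t))) := by rw [hA]; ring
      _ = A := by rw [← Real.exp_add]; simp
  have main' : ∀ t ∈ Set.Icc t₁ t₂, ∀ τ, g1 t τ * (1 + τ ^ 2) ≤ A * m1 τ := by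
    intro t ht τ
    have := main t ht τ
    unfold m1
    rw [← div_eq_mul_inv, le_div_iff₀ (by positivity)]
    linarith
  refine ⟨A * (1 + 1 / (2 * t₁) + 1 / (4 * t₁ ^ 2)), fun t ht => ?_⟩
  have ht0 : 0 < t := h1.trans_le ht.1
  have b1 : 1 / (2 * t) ≤ 1 / (2 * t₁) := by have := ht.1; gcongr
  have b2 : 1 / (4 * t ^ 2) ≤ 1 / (4 * t₁ ^ 2) := by have := ht.1; gcongr
  have q1 : 0 < 1 / (2 * t₁) := by positivity
  have q2 : 0 < 1 / (4 * t₁ ^ 2) := by positivity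
  refine ⟨contDiff_g1 t, fun τ => ?_, fun τ => ?_, fun τ => ?_⟩
  · rw [abs_of_pos (g1_pos ht0 τ)]
    have h := main' t ht τ
    have hg := g1_pos ht0 τ
    have hm := m1_pos τ
    have : 0 ≤ A * m1 τ := by positivity
    nlinarith [mul_nonneg hg.le (sq_nonneg τ)]
  · rw [deriv_g1, abs_mul, abs_neg, abs_div, abs_of_pos (g1_pos ht0 τ),
      abs_of_pos (show 0 < 2 * t by positivity)]
    have h := main' t ht τ
    have hg := g1_pos ht0 τ
    have hm := m1_pos τ
    have hAm : 0 ≤ A * m1 τ := by positivity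
    have : |τ| ≤ 1 + τ ^ 2 := by
      rw [← sq_abs τ]; nlinarith [sq_nonneg (|τ| - 1), abs_nonneg τ]
    calc |τ| / (2 * t) * g1 t τ = 1 / (2 * t) * (g1 t τ * |τ|) := by ring
      _ ≤ 1 / (2 * t₁) * (g1 t τ * (1 + τ ^ 2)) := by gcongr
      _ ≤ 1 / (2 * t₁) * (A * m1 τ) := by gcongr
      _ ≤ _ := by nlinarith
  · rw [deriv2_g1 ht0.ne', g2, abs_mul, abs_of_pos (g1_pos ht0 τ)]
    have h := main' t ht τ
    have hg := g1_pos ht0 τ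
    have hm := m1_pos τ
    have hAm : 0 ≤ A * m1 τ := by positivity
    have : |τ ^ 2 / (4 * t ^ 2) - 1 / (2 * t)| ≤
        (1 / (2 * t₁) + 1 / (4 * t₁ ^ 2)) * (1 + τ ^ 2) := by
      refine (abs_sub _ _).trans ?_
      rw [abs_of_nonneg (by positivity), abs_of_nonneg (by positivity)]
      have : τ ^ 2 / (4 * t ^ 2) = 1 / (4 * t ^ 2) * τ ^ 2 := by ring
      rw [this]
      nlinarith [sq_nonneg τ]
    calc _ ≤ (1 / (2 * t₁) + 1 / (4 * t₁ ^ 2)) * (1 + τ ^ 2) * g1 t τ := by gcongr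
      _ = (1 / (2 * t₁) + 1 / (4 * t₁ ^ 2)) * (g1 t τ * (1 + τ ^ 2)) := by ring
      _ ≤ (1 / (2 * t₁) + 1 / (4 * t₁ ^ 2)) * (A * m1 τ) := by gcongr
      _ ≤ _ := by nlinarith

theorem Nice.mono {C D : ℝ} {α : ℝ → ℝ} (h : Nice C α) (hCD : C ≤ D) : Nice D α := by
  have q : ∀ τ, C * m1 τ ≤ D * m1 τ := fun τ => mul_le_mul_of_nonneg_right hCD (m1_pos τ).le
  exact ⟨h.smooth, fun τ => (h.b0 τ).trans (q τ), fun τ => (h.b1 τ).trans (q τ),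
    fun τ => (h.b2 τ).trans (q τ)⟩

theorem Nice.comp_sub {C : ℝ} {α : ℝ → ℝ} (h : Nice C α) (a : ℝ) :
    Nice (C * (2 * (1 + a ^ 2))) (fun τ => α (τ - a)) := by
  have q : ∀ τ, C * m1 (τ - a) ≤ C * (2 * (1 + a ^ 2)) * m1 τ := fun τ => by
    rw [mul_assoc]
    exact mul_le_mul_of_nonneg_left (m1_sub_le a τ) h.nonneg
  have e1 : deriv (fun τ => α (τ - a)) = fun τ => deriv α (τ - a) := by
    funext τ; exact deriv_comp_sub_const _ a τ
  have e2 : deriv (deriv (fun τ => α (τ - a))) = fun τ => deriv (deriv α) (τ - a) := by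
    rw [e1]; funext τ; exact deriv_comp_sub_const _ a τ
  refine ⟨h.smooth.comp (contDiff_id.sub contDiff_const), fun τ => (h.b0 _).trans (q τ),
    fun τ => ?_, fun τ => ?_⟩
  · rw [e1]; exact (h.b1 _).trans (q τ)
  · rw [e2]; exact (h.b2 _).trans (q τ)

theorem deriv2_sub {α β : ℝ → ℝ} (h : ContDiff ℝ ∞ α) (h' : ContDiff ℝ ∞ β) (τ : ℝ) :
    deriv (fun τ => α τ - β τ) τ = deriv α τ - deriv β τ ∧
    deriv (deriv fun τ => α τ - β τ) τ = deriv (deriv α) τ - deriv (deriv β) τ := by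
  have e1 : deriv (fun τ => α τ - β τ) = fun τ => deriv α τ - deriv β τ := by
    funext τ
    exact ((hasDerivAt_of_top h τ).sub (hasDerivAt_of_top h' τ)).deriv
  refine ⟨congrFun e1 τ, ?_⟩
  rw [e1]
  exact ((hasDerivAt_of_top (contDiff_deriv_of_top h) τ).sub
    (hasDerivAt_of_top (contDiff_deriv_of_top h') τ)).deriv

theorem Nice.sub {C D : ℝ} {α β : ℝ → ℝ} (h : Nice C α) (h' : Nice D β) :
    Nice (C + D) (fun τ => α τ - β τ) := by
  refine ⟨h.smooth.sub h'.smooth, fun τ => ?_, fun τ => ?_, fun τ => ?_⟩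
  · rw [add_mul]
    exact (abs_sub _ _).trans (add_le_add (h.b0 τ) (h'.b0 τ))
  · rw [add_mul, (deriv2_sub h.smooth h'.smooth τ).1]
    exact (abs_sub _ _).trans (add_le_add (h.b1 τ) (h'.b1 τ))
  · rw [add_mul, (deriv2_sub h.smooth h'.smooth τ).2]
    exact (abs_sub _ _).trans (add_le_add (h.b2 τ) (h'.b2 τ))

end Gauss

/-! ### The heat kernel of `ℝ⁴` as an approximate identity, and its large-time decay -/

section Heat

/-- The heat kernel of `C2`. -/
noncomputable def hk (t : ℝ) : C2 → ℝ := prodFn fun _ => g1 t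

theorem hk_pos {t : ℝ} (ht : 0 < t) (z : C2) : 0 < hk t z := by
  unfold hk prodFn
  exact Finset.prod_pos fun _ _ => g1_pos ht _

theorem integrable_hk {t : ℝ} (ht : 0 < t) : Integrable (hk t) :=
  integrable_prodFn fun _ => integrable_g1 ht

theorem integral_hk {t : ℝ} (ht : 0 < t) : ∫ z, hk t z = 1 := by
  unfold hk
  rw [integral_prodFn]
  simp [integral_g1 ht]

theorem continuous_hk (t : ℝ) : Continuous (hk t) :=
  continuous_prodFn fun _ => (contDiff_g1 t).continuous

theorem measurable_hk : Measurable (fun p : ℝ × C2 => hk p.1 p.2) := by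
  unfold hk prodFn
  exact Finset.measurable_fun_prod _ fun i _ =>
    measurable_g1.comp (measurable_fst.prodMk (by fun_prop))

theorem hk_eq {t : ℝ} (ht : 0 < t) (z : C2) :
    hk t z = ((4 * Real.pi * t) ^ 2)⁻¹ * Real.exp (-(‖z‖ ^ 2 / (4 * t))) := by
  unfold hk prodFn g1
  rw [Finset.prod_mul_distrib, Finset.prod_const, ← Real.exp_sum, EuclideanSpace.real_norm_sq_eq]
  have hp : 0 ≤ 4 * Real.pi * t := by have := Real.pi_pos; positivity
  congr 1
  · rw [inv_pow]
    congr 1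
    have : (Finset.univ : Finset Ix).card = 2 * 2 := by simp
    rw [this, pow_mul, Real.sq_sqrt hp]
  · rw [Finset.sum_neg_distrib, Finset.sum_div]

theorem hk_le {t : ℝ} (ht : 0 < t) (z : C2) : hk t z ≤ ((4 * Real.pi * t) ^ 2)⁻¹ := by
  rw [hk_eq ht]
  refine mul_le_of_le_one_right (by positivity) (Real.exp_le_one_iff.2 ?_)
  have : 0 ≤ ‖z‖ ^ 2 / (4 * t) := by positivity
  linarith

/-- Each coordinate contributes a factor `(1 + ‖z‖²) m1 (z i) ≥ 1`. So decay of order `‖z‖⁻⁸`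
implies domination by the weight. -/
theorem one_le_mul_wt (z : C2) : 1 ≤ (1 + ‖z‖ ^ 2) ^ 4 * wt z := by
  have h : (1 + ‖z‖ ^ 2) ^ 4 * wt z = ∏ i : Ix, ((1 + ‖z‖ ^ 2) * m1 (z i)) := by
    rw [Finset.prod_mul_distrib, Finset.prod_const]
    simp [wt, prodFn]
  rw [h]
  calc (1 : ℝ) = ∏ i : Ix, (1 : ℝ) := by simp
    _ ≤ _ := Finset.prod_le_prod (fun _ _ => zero_le_one) fun i _ => by
        have h1 : |z i| ≤ ‖z‖ := PiLp.norm_apply_le z i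
        have h2 : z i ^ 2 ≤ ‖z‖ ^ 2 := by rw [← sq_abs]; gcongr
        unfold m1
        rw [← div_eq_mul_inv, le_div_iff₀ (by positivity)]
        linarith

/-- With `x = ‖z‖² / (4 t)` the kernel is `(4πt)⁻² exp (-x)`. The bound `x⁴ exp (-x) ≤ 24` yields
four powers of `t`; two of them pay for the prefactor, and the other two give `t² ≤ t`. The kernel
away from the origin thus tends to zero with an integrable majorant. -/
theorem hk_le_wt {δ : ℝ} (hδ : 0 < δ) : ∃ C, 0 ≤ C ∧ ∀ t ∈ Set.Ioc (0 : ℝ) 1, ∀ z : C2, δ ≤ ‖z‖ →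
    hk t z ≤ C * t * wt z := by
  set c : ℝ := 1 + (δ ^ 2)⁻¹ with hc
  refine ⟨((4 * Real.pi) ^ 2)⁻¹ * (c * 4) ^ 4 * 24, by positivity, fun t ht z hz => ?_⟩
  have ht0 := ht.1
  have hx : 1 + ‖z‖ ^ 2 ≤ c * ‖z‖ ^ 2 := by
    have h1 : δ ^ 2 ≤ ‖z‖ ^ 2 := by gcongr
    have h2 : 1 ≤ (δ ^ 2)⁻¹ * ‖z‖ ^ 2 := by
      rw [le_inv_mul_iff₀ (by positivity)]; linarith
    rw [hc]; linarith
  set x : ℝ := ‖z‖ ^ 2 / (4 * t) with hxdef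
  have hx0 : 0 ≤ x := by positivity
  have hzx : ‖z‖ ^ 2 = 4 * t * x := by rw [hxdef]; field_simp
  have hexp : x ^ 4 * Real.exp (-x) ≤ 24 := by
    have := Real.pow_div_factorial_le_exp x hx0 4
    rw [Real.exp_neg, ← div_eq_mul_inv, div_le_iff₀ (Real.exp_pos x)]
    have h24 : ((Nat.factorial 4 : ℕ) : ℝ) = 24 := by norm_num [Nat.factorial]
    rw [h24, div_le_iff₀ (by norm_num)] at this
    linarith
  have hw := wt_pos z
  calc hk t z = hk t z * 1 := (mul_one _).symm
    _ ≤ hk t z * ((1 + ‖z‖ ^ 2) ^ 4 * wt z) := by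
        have := one_le_mul_wt z
        have := (hk_pos ht0 z).le
        gcongr
    _ ≤ hk t z * ((c * ‖z‖ ^ 2) ^ 4 * wt z) := by
        have := (hk_pos ht0 z).le
        gcongr
    _ = ((4 * Real.pi) ^ 2)⁻¹ * (c * 4) ^ 4 * (x ^ 4 * Real.exp (-x)) * t ^ 2 * wt z := by
        rw [hk_eq ht0, ← hxdef, hzx]
        field_simp
    _ ≤ ((4 * Real.pi) ^ 2)⁻¹ * (c * 4) ^ 4 * 24 * t * wt z := by
        have : t ^ 2 ≤ t := by nlinarith [ht.2]
        gcongr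

/-- Decomposability into a small bounded part and an integrable part. -/
def SmallPlusInt (F : C2 → ℂ) : Prop :=
  ∀ κ : ℝ, 0 < κ → ∃ b : C2 → ℝ, Integrable b ∧ ∀ z, ‖F z‖ ≤ κ + b z

theorem SmallPlusInt.add {F G : C2 → ℂ} (hF : SmallPlusInt F) (hG : SmallPlusInt G) :
    SmallPlusInt (fun z => F z + G z) := by
  intro κ hκ
  obtain ⟨b, hb, h1⟩ := hF (κ / 2) (by positivity)
  obtain ⟨b', hb', h2⟩ := hG (κ / 2) (by positivity)
  refine ⟨fun z => b z + b' z, hb.add hb', fun z => (norm_add_le _ _).trans ?_⟩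
  linarith [h1 z, h2 z]

/-- The bounded part of `F` uses the integrability of `k`, the integrable part uses its boundedness.
-/
theorem SmallPlusInt.integrable_mul {F : C2 → ℂ} (hF : SmallPlusInt F)
    (hm : AEStronglyMeasurable F) {k : C2 → ℝ} (hk : Integrable k) {M : ℝ} (hM : ∀ z, |k z| ≤ M) :
    Integrable (fun z => F z * (k z : ℂ)) := by
  obtain ⟨b, hb, h1⟩ := hF 1 one_pos
  refine Integrable.mono' (g := fun z => |k z| + M * ‖b z‖) (hk.abs.add (hb.norm.const_mul M))
    (hm.mul (Complex.continuous_ofReal.comp_aestronglyMeasurable hk.1)) (Eventually.of_forall fun z => ?_)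
  rw [norm_mul, Complex.norm_real, Real.norm_eq_abs]
  have h2 : ‖F z‖ ≤ 1 + ‖b z‖ := (h1 z).trans (by gcongr; exact le_abs_self _)
  calc ‖F z‖ * |k z| ≤ (1 + ‖b z‖) * |k z| := by gcongr
    _ = |k z| + |k z| * ‖b z‖ := by ring
    _ ≤ _ := by gcongr; exact hM z

theorem abs_hk_sub_le {t : ℝ} (ht : 0 < t) (p z : C2) :
    |hk t (z - p)| ≤ ((4 * Real.pi * t) ^ 2)⁻¹ := by
  rw [abs_of_pos (hk_pos ht _)]; exact hk_le ht _

/-- The heat evolution tends to zero for large times. -/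
theorem tendsto_heat_atTop {F : C2 → ℂ} (hF : SmallPlusInt F) (p : C2) :
    Tendsto (fun t => ∫ z, F z * (hk t (z - p) : ℂ)) atTop (𝓝 0) := by
  rw [Metric.tendsto_nhds]
  intro ε hε
  obtain ⟨b, hb, h1⟩ := hF (ε / 2) (by positivity)
  set I := ∫ z, ‖b z‖ with hI
  have hI0 : 0 ≤ I := integral_nonneg fun _ => norm_nonneg _
  -- The part of `F` bounded by `ε / 2` contributes at most that much, since the kernel has mass
  -- one; the integrable part is killed by the sup bound of order `t⁻²`.
  have hlim : Tendsto (fun t : ℝ => ((4 * Real.pi * t) ^ 2)⁻¹ * I) atTop (𝓝 (0 * I)) := by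
    refine Tendsto.mul_const _ (tendsto_inv_atTop_zero.comp ((tendsto_pow_atTop two_ne_zero).comp ?_))
    exact tendsto_id.const_mul_atTop (by have := Real.pi_pos; positivity)
  rw [zero_mul] at hlim
  filter_upwards [hlim.eventually (gt_mem_nhds (show 0 < ε / 2 by positivity)),
    eventually_gt_atTop 0] with t ht ht0
  rw [dist_zero_right]
  have hi : Integrable (fun z => ε / 2 * hk t (z - p) + ((4 * Real.pi * t) ^ 2)⁻¹ * ‖b z‖) :=
    (((integrable_hk ht0).comp_sub_right p).const_mul _).add (hb.norm.const_mul _)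
  calc ‖∫ z, F z * (hk t (z - p) : ℂ)‖
      ≤ ∫ z, (ε / 2 * hk t (z - p) + ((4 * Real.pi * t) ^ 2)⁻¹ * ‖b z‖) := by
        refine norm_integral_le_of_norm_le hi (Eventually.of_forall fun z => ?_)
        rw [norm_mul, Complex.norm_real, Real.norm_eq_abs, abs_of_pos (hk_pos ht0 _)]
        have h2 : ‖F z‖ ≤ ε / 2 + ‖b z‖ := (h1 z).trans (by gcongr; exact le_abs_self _)
        have h3 := hk_le ht0 (z - p)
        have h4 := (hk_pos ht0 (z - p)).le
        nlinarith [mul_le_mul_of_nonneg_right h2 h4, mul_le_mul_of_nonneg_right h3 (norm_nonneg (b z))]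
    _ = ε / 2 + ((4 * Real.pi * t) ^ 2)⁻¹ * I := by
        rw [integral_add (((integrable_hk ht0).comp_sub_right p).const_mul _) (hb.norm.const_mul _),
          integral_const_mul, integral_const_mul, integral_sub_right_eq_self (hk t) p,
          integral_hk ht0, mul_one]
    _ < ε := by linarith

/-- The heat kernel is an approximate identity. -/
theorem tendsto_heat_zero {F : C2 → ℂ} (hF : SmallPlusInt F) (hm : AEStronglyMeasurable F) {p : C2}
    (hc : ContinuousAt F p) :
    Tendsto (fun t => ∫ z, F z * (hk t (z - p) : ℂ)) (𝓝[>] 0) (𝓝 (F p)) := by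
  rw [Metric.tendsto_nhds]
  intro ε hε
  obtain ⟨b, hb, h1⟩ := hF 1 one_pos
  obtain ⟨δ, hδ, hδ2⟩ := Metric.continuousAt_iff.1 hc (ε / 2) (by positivity)
  obtain ⟨C, hC0, hC⟩ := hk_le_wt hδ
  set m : C2 → ℝ := fun z => (1 + ‖F p‖) * wt (z - p) + ‖b z‖ with hmdef
  have hmi : Integrable m := ((integrable_wt.comp_sub_right p).const_mul _).add hb.norm
  set I := ∫ z, m z with hI
  have hlim : Tendsto (fun t : ℝ => C * t * I) (𝓝[>] 0) (𝓝 0) := by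
    have : Tendsto (fun t : ℝ => C * t * I) (𝓝 0) (𝓝 (C * 0 * I)) := Continuous.tendsto (by fun_prop) 0
    simp only [mul_zero, zero_mul] at this
    exact this.mono_left nhdsWithin_le_nhds
  filter_upwards [hlim.eventually (gt_mem_nhds (show 0 < ε / 2 by positivity)),
    Ioc_mem_nhdsGT one_pos] with t ht ht1
  have ht0 := ht1.1
  have hsi : Integrable (fun z => hk t (z - p)) := (integrable_hk ht0).comp_sub_right p
  have hFi : Integrable (fun z => F z * (hk t (z - p) : ℂ)) :=
    hF.integrable_mul hm hsi (abs_hk_sub_le ht0 p)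
  have hone : ∫ z, F p * (hk t (z - p) : ℂ) = F p := by
    rw [integral_const_mul, integral_complex_ofReal, integral_sub_right_eq_self (hk t) p,
      integral_hk ht0]
    simp
  have hi : Integrable (fun z => ε / 2 * hk t (z - p) + C * t * m z) :=
    (hsi.const_mul _).add (hmi.const_mul _)
  rw [dist_eq_norm]
  calc ‖(∫ z, F z * (hk t (z - p) : ℂ)) - F p‖
      = ‖∫ z, (F z * (hk t (z - p) : ℂ) - F p * (hk t (z - p) : ℂ))‖ := by
        have hpi : Integrable (fun z => F p * (hk t (z - p) : ℂ)) := hsi.ofReal.const_mul (F p)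
        rw [integral_sub hFi hpi, hone]
    _ ≤ ∫ z, (ε / 2 * hk t (z - p) + C * t * m z) := by
        refine norm_integral_le_of_norm_le hi (Eventually.of_forall fun z => ?_)
        rw [← sub_mul, norm_mul, Complex.norm_real, Real.norm_eq_abs, abs_of_pos (hk_pos ht0 _)]
        have h4 := (hk_pos ht0 (z - p)).le
        have hm0 : 0 ≤ m z := by
          have := (wt_pos (z - p)).le
          positivity
        -- Near `p` continuity makes the difference at most `ε / 2`; far from `p` the kernel is of
        -- size `t` times the weight.
        by_cases hz : dist z p < δ
        · have := hδ2 hz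
          rw [dist_eq_norm] at this
          have h5 : 0 ≤ C * t * m z := by positivity
          nlinarith [mul_le_mul_of_nonneg_right this.le h4]
        · rw [not_lt, dist_eq_norm] at hz
          have h6 := hC t ht1 (z - p) hz
          have h7 : ‖F z - F p‖ ≤ (1 + ‖F p‖) + ‖b z‖ := by
            refine (norm_sub_le _ _).trans ?_
            linarith [(h1 z).trans (add_le_add_right (le_abs_self (b z)) 1), Real.norm_eq_abs (b z)]
          have h8 : hk t (z - p) ≤ C * t := h6.trans (mul_le_of_le_one_right (by positivity) (wt_le_one _))
          calc ‖F z - F p‖ * hk t (z - p) ≤ ((1 + ‖F p‖) + ‖b z‖) * hk t (z - p) := by gcongr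
            _ = (1 + ‖F p‖) * hk t (z - p) + ‖b z‖ * hk t (z - p) := by ring
            _ ≤ (1 + ‖F p‖) * (C * t * wt (z - p)) + ‖b z‖ * (C * t) := by gcongr
            _ = C * t * m z := by rw [hmdef]; ring
            _ ≤ _ := by
              have : 0 ≤ ε / 2 * hk t (z - p) := by positivity
              linarith
    _ = ε / 2 + C * t * I := by
        rw [integral_add (hsi.const_mul _) (hmi.const_mul _), integral_const_mul, integral_const_mul,
          integral_sub_right_eq_self (hk t) p, integral_hk ht0, mul_one]
    _ < ε := by linarith

end Heat


/-! ### The Dirichlet heat kernel by reflection -/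

section Kernel

/-- The sign `-1` for `true` and `1` for `false`. -/
def bsgn (b : Bool) : ℝ := if b then -1 else 1

/-- The reflections of `C2` in the coordinates `y₁`, `y₂`. -/
noncomputable def refl (p : Bool × Bool) (a : C2) : C2 :=
  WithLp.toLp 2 (Sum.elim (fun j => a (Sum.inl j))
    ![bsgn p.1 * a (Sum.inr 0), bsgn p.2 * a (Sum.inr 1)])

/-- The sign of a reflection. -/
def sg (p : Bool × Bool) : ℝ := bsgn p.1 * bsgn p.2

theorem contDiff_refl (p : Bool × Bool) {n : WithTop ℕ∞} : ContDiff ℝ n (refl p) := by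
  have h : ∀ i : Ix, ContDiff ℝ n (fun a : C2 => a i) := fun i => by fun_prop
  refine contDiff_euclidean.2 fun i => ?_
  rcases i with j | j
  · exact h _
  · rcases (by fin_cases j <;> simp : j = 0 ∨ j = 1) with rfl | rfl
    · exact contDiff_const.mul (h _)
    · exact contDiff_const.mul (h _)

theorem refl_id (a : C2) : refl (false, false) a = a := by
  ext i
  rcases i with j | j
  · rfl
  · rcases (by fin_cases j <;> simp : j = 0 ∨ j = 1) with rfl | rfl <;> simp [refl, bsgn]

/-- The factors of the heat kernel of `Omega` with vanishing boundary values. -/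
noncomputable def kn (t : ℝ) (a : C2) : Ix → ℝ → ℝ
  | Sum.inl j => fun τ => g1 t (τ - a (Sum.inl j))
  | Sum.inr j => fun τ => g1 t (τ - a (Sum.inr j)) - g1 t (τ - -a (Sum.inr j))

/-- Method of images: expanding the two differences gives the heat kernels centred at the four
reflected points, with alternating signs. -/
theorem prodFn_kn (t : ℝ) (a z : C2) :
    prodFn (kn t a) z = ∑ p : Bool × Bool, sg p * hk t (z - refl p a) := by
  simp [prodFn, hk, kn, sg, refl, bsgn, Fintype.prod_sum_type, Fin.prod_univ_two,
    Fintype.sum_prod_type]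
  ring

theorem exists_kn_bound {t₁ t₂ : ℝ} (h1 : 0 < t₁) (h12 : t₁ ≤ t₂) (a : C2) :
    ∃ C, ∀ t ∈ Set.Icc t₁ t₂, ∀ i, Nice C (kn t a i) := by
  obtain ⟨C, hC⟩ := exists_g1_bound h1 h12
  have hC0 : 0 ≤ C := (hC t₁ ⟨le_rfl, h12⟩).nonneg
  refine ⟨∑ i : Ix, (C * (2 * (1 + a i ^ 2)) + C * (2 * (1 + (-a i) ^ 2))), fun t ht i => ?_⟩
  refine Nice.mono (C := C * (2 * (1 + a i ^ 2)) + C * (2 * (1 + (-a i) ^ 2))) ?_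
    (Finset.single_le_sum (f := fun i : Ix => C * (2 * (1 + a i ^ 2)) + C * (2 * (1 + (-a i) ^ 2)))
      (fun i _ => by positivity) (Finset.mem_univ i))
  rcases i with j | j
  · exact ((hC t ht).comp_sub _).mono (le_add_of_nonneg_right (by positivity))
  · exact ((hC t ht).comp_sub _).sub ((hC t ht).comp_sub _)

theorem kn_zero (t : ℝ) (a : C2) (j : Fin 2) : kn t a (Sum.inr j) 0 = 0 := by
  simp only [kn]
  rw [← g1_even t (0 - -a (Sum.inr j))]
  simp

theorem hasDerivAt_kn_time {t : ℝ} (ht : 0 < t) (a : C2) (i : Ix) (τ : ℝ) :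
    HasDerivAt (fun t => kn t a i τ) (deriv (deriv (kn t a i)) τ) t := by
  have e : ∀ b τ : ℝ, deriv (deriv (fun τ => g1 t (τ - b))) τ = g2 t (τ - b) := by
    intro b τ
    have e1 : deriv (fun τ => g1 t (τ - b)) = fun τ => deriv (g1 t) (τ - b) := by
      funext τ; exact deriv_comp_sub_const _ b τ
    rw [e1, deriv_comp_sub_const, deriv2_g1 ht.ne']
  have sm : ∀ b : ℝ, ContDiff ℝ ∞ (fun τ => g1 t (τ - b)) := fun b =>
    (contDiff_g1 t).comp (contDiff_id.sub contDiff_const)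
  rcases i with j | j
  · simp only [kn]
    rw [e]
    exact hasDerivAt_g1_time ht _
  · simp only [kn]
    rw [(deriv2_sub (sm _) (sm _) τ).2, e, e]
    exact (hasDerivAt_g1_time ht _).sub (hasDerivAt_g1_time ht _)

/-- Every factor solves the heat equation in its own coordinate, so the product rule in time
reproduces the Laplacian one coordinate at a time. -/
theorem hasDerivAt_prodFn_kn {t : ℝ} (ht : 0 < t) (a z : C2) :
    HasDerivAt (fun t => prodFn (kn t a) z)
      (∑ i, prodFn (Function.update (kn t a) i (deriv (deriv (kn t a i)))) z) t := by
  have := HasDerivAt.fun_finsetProd (u := Finset.univ) (x := t)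
    (f := fun i t => kn t a i (z i)) (f' := fun i => deriv (deriv (kn t a i)) (z i))
    (fun i _ => hasDerivAt_kn_time ht a i (z i))
  refine this.congr_deriv (Finset.sum_congr rfl fun i _ => ?_)
  rw [prodFn_update, smul_eq_mul, mul_comm]

theorem abs_prodFn_le_wt {α : Ix → ℝ → ℝ} {C : ℝ} (h : ∀ i τ, |α i τ| ≤ C * m1 τ) (z : C2) :
    |prodFn α z| ≤ C ^ 4 * wt z := by
  refine (abs_prodFn_le (β := fun _ τ => C * m1 τ) fun i => h i _).trans ?_
  rw [prodFn_const_mul]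
  rfl

theorem Nice.update {α : Ix → ℝ → ℝ} {C : ℝ} (h : ∀ i, Nice C (α i)) (i k : Ix) (τ : ℝ) :
    |Function.update α i (deriv (deriv (α i))) k τ| ≤ C * m1 τ := by
  by_cases hk : k = i
  · subst hk
    rw [Function.update_self]
    exact (h k).b2 τ
  · rw [Function.update_of_ne hk]
    exact (h k).b0 τ

theorem continuous_prodFn_update {α : Ix → ℝ → ℝ} (h : ∀ i, ContDiff ℝ ∞ (α i)) (i : Ix) :
    Continuous (prodFn (Function.update α i (deriv (deriv (α i))))) := by
  refine continuous_prodFn fun k => ?_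
  by_cases hk : k = i
  · subst hk
    rw [Function.update_self]
    exact (contDiff_deriv_of_top (contDiff_deriv_of_top (h k))).continuous
  · rw [Function.update_of_ne hk]
    exact (h k).continuous

/-- The bounds of `exists_kn_bound` are uniform for times in `[t / 2, 2 t]`, which allows
differentiation under the integral sign. -/
theorem hasDerivAt_integral_kn {H : C2 → ℂ} (hm : AEStronglyMeasurable H)
    (hi : Integrable (fun z => H z * wt z)) {t : ℝ} (ht : 0 < t) (a : C2) :
    HasDerivAt (fun t => ∫ z, H z * (prodFn (kn t a) z : ℂ))
      (∑ i, ∫ z, H z * (prodFn (Function.update (kn t a) i (deriv (deriv (kn t a i)))) z : ℂ)) t := by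
  obtain ⟨C, hC⟩ := exists_kn_bound (show 0 < t / 2 by positivity)
    (show t / 2 ≤ 2 * t by linarith) a
  have hs : Set.Icc (t / 2) (2 * t) ∈ 𝓝 t := Icc_mem_nhds (by linarith) (by linarith)
  have htm : t ∈ Set.Icc (t / 2) (2 * t) := mem_of_mem_nhds hs
  have nb : ∀ k : C2 → ℝ, (∀ z, |k z| ≤ C ^ 4 * wt z) → ∀ z,
      ‖H z * (k z : ℂ)‖ ≤ C ^ 4 * ‖H z * wt z‖ := by
    intro k hk z
    rw [norm_mul, norm_mul, Complex.norm_real, Complex.norm_real, Real.norm_eq_abs,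
      Real.norm_eq_abs, abs_of_pos (wt_pos z)]
    calc ‖H z‖ * |k z| ≤ ‖H z‖ * (C ^ 4 * wt z) := by gcongr; exact hk z
      _ = _ := by ring
  have hmc : ∀ k : C2 → ℝ, Continuous k → AEStronglyMeasurable (fun z => H z * (k z : ℂ)) :=
    fun k hk => hm.mul (Complex.continuous_ofReal.comp hk).aestronglyMeasurable
  have hck : ∀ t, 0 < t → Continuous (prodFn (kn t a)) := fun t ht => by
    obtain ⟨C, hC⟩ := exists_kn_bound ht le_rfl a
    exact continuous_prodFn fun i => (hC t ⟨le_rfl, le_rfl⟩ i).smooth.continuous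
  have hint : ∀ k : C2 → ℝ, Continuous k → (∀ z, |k z| ≤ C ^ 4 * wt z) →
      Integrable (fun z => H z * (k z : ℂ)) := fun k hk hb =>
    (hi.norm.const_mul (C ^ 4)).mono' (hmc k hk) (Eventually.of_forall (nb k hb))
  set F' : ℝ → C2 → ℂ := fun t z => ∑ i, H z *
    (prodFn (Function.update (kn t a) i (deriv (deriv (kn t a i)))) z : ℂ) with hF'
  have hsi : ∀ i ∈ (Finset.univ : Finset Ix), Integrable fun z => H z *
      (prodFn (Function.update (kn t a) i (deriv (deriv (kn t a i)))) z : ℂ) := fun i _ =>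
    hint _ (continuous_prodFn_update (fun i => (hC t htm i).smooth) i)
      (abs_prodFn_le_wt (Nice.update (hC t htm) i))
  have key := hasDerivAt_integral_of_dominated_loc_of_deriv_le (μ := volume) (x₀ := t)
    (F := fun t z => H z * (prodFn (kn t a) z : ℂ)) (F' := F')
    (bound := fun z => 4 * (C ^ 4 * ‖H z * wt z‖)) hs
    (by
      filter_upwards [lt_mem_nhds ht] with s hs
      exact hmc _ (hck s hs))
    (hint _ (hck t ht) (abs_prodFn_le_wt fun i => (hC t htm i).b0))
    (integrable_finsetSum _ hsi).1
    (Eventually.of_forall fun z s hs => by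
      refine (norm_sum_le _ _).trans ?_
      refine (Finset.sum_le_card_nsmul _ _ (C ^ 4 * ‖H z * wt z‖) fun i _ =>
        nb _ (abs_prodFn_le_wt (Nice.update (hC s hs) i)) z).trans (le_of_eq ?_)
      simp)
    ((hi.norm.const_mul _).const_mul _)
    (Eventually.of_forall fun z s hs => by
      have hs0 : 0 < s := lt_of_lt_of_le (by positivity) hs.1
      have := ((hasDerivAt_prodFn_kn hs0 a z).ofReal_comp).const_mul (H z)
      refine this.congr_deriv ?_
      rw [hF', Complex.ofReal_sum, Finset.mul_sum])
  refine key.2.congr_deriv ?_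
  exact integral_finsetSum _ hsi

end Kernel

/-! ### Heat potentials and their regularity -/

section Potential

/-- The measure over which the heat potentials are integrated. -/
noncomputable def htm : Measure (ℝ × C2) := (volume.restrict (Set.Ioi 0)).prod volume

/-- The time integral of the heat evolution of `F`. -/
noncomputable def heatPot (F : C2 → ℂ) (a : C2) : ℂ := ∫ q, F (a + q.2) * (hk q.1 q.2 : ℂ) ∂htm

theorem ae_htm_pos : ∀ᵐ q ∂htm, 0 < q.1 :=
  Measure.quasiMeasurePreserving_fst.ae (ae_restrict_mem measurableSet_Ioi)

/-- For `t ≤ 1` the kernel has mass one and `wt ≤ 1`; for `t ≥ 1` the kernel in dimension four is at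
most `t⁻²`. Both ends of the time integral therefore converge. -/
theorem exists_integral_wt_hk_le : ∃ C, ∀ t, 0 < t → ∫ z, wt z * hk t z ≤ C * m1 t := by
  have hI : 0 ≤ ∫ z, wt z := integral_nonneg fun z => (wt_pos z).le
  refine ⟨2 + 2 * ∫ z, wt z, fun t ht => ?_⟩
  have hi : Integrable fun z => wt z * hk t z := by
    refine (integrable_hk ht).mono' (continuous_wt.mul (continuous_hk t)).aestronglyMeasurable
      (Eventually.of_forall fun z => ?_)
    rw [Real.norm_eq_abs, abs_of_pos (mul_pos (wt_pos z) (hk_pos ht z))]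
    exact mul_le_of_le_one_left (hk_pos ht z).le (wt_le_one z)
  unfold m1
  rw [← div_eq_mul_inv, le_div_iff₀ (by positivity)]
  rcases le_total t 1 with h | h
  · have h1 : ∫ z, wt z * hk t z ≤ 1 := by
      rw [← integral_hk ht]
      exact integral_mono hi (integrable_hk ht) fun z =>
        mul_le_of_le_one_left (hk_pos ht z).le (wt_le_one z)
    have h0 : 0 ≤ ∫ z, wt z * hk t z := integral_nonneg fun z =>
      (mul_pos (wt_pos z) (hk_pos ht z)).le
    nlinarith
  · have h1 : ∫ z, wt z * hk t z ≤ (t ^ 2)⁻¹ * ∫ z, wt z := by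
      rw [← integral_const_mul]
      refine integral_mono hi (integrable_wt.const_mul _) fun z => ?_
      show wt z * hk t z ≤ (t ^ 2)⁻¹ * wt z
      rw [mul_comm]
      refine mul_le_mul_of_nonneg_right ((hk_le ht z).trans ?_) (wt_pos z).le
      refine inv_anti₀ (by positivity) ?_
      have : 1 ≤ 4 * Real.pi := by linarith [Real.pi_gt_three]
      gcongr
      nlinarith
    have h2 : (∫ z, wt z * hk t z) * t ^ 2 ≤ ∫ z, wt z := by
      rw [← le_div_iff₀ (by positivity), div_eq_inv_mul]
      exact h1
    have h3 : (∫ z, wt z * hk t z) ≤ (∫ z, wt z * hk t z) * t ^ 2 := by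
      refine le_mul_of_one_le_right (integral_nonneg fun z =>
        (mul_pos (wt_pos z) (hk_pos ht z)).le) (by nlinarith)
    linarith

theorem integrable_wt_mul_hk : Integrable (fun q : ℝ × C2 => wt q.2 * hk q.1 q.2) htm := by
  obtain ⟨C, hC⟩ := exists_integral_wt_hk_le
  have hm : AEStronglyMeasurable (fun q : ℝ × C2 => wt q.2 * hk q.1 q.2) htm :=
    ((continuous_wt.measurable.comp measurable_snd).mul measurable_hk).aestronglyMeasurable
  refine (integrable_prod_iff hm).2 ⟨?_, ?_⟩
  · filter_upwards [ae_restrict_mem measurableSet_Ioi] with t ht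
    refine (integrable_hk ht).mono' (continuous_wt.mul (continuous_hk t)).aestronglyMeasurable
      (Eventually.of_forall fun z => ?_)
    rw [Real.norm_eq_abs, abs_of_pos (mul_pos (wt_pos z) (hk_pos ht z))]
    exact mul_le_of_le_one_left (hk_pos ht z).le (wt_le_one z)
  · refine ((integrable_m1.const_mul C).restrict (s := Set.Ioi 0)).mono'
      hm.norm.integral_prod_right' ?_
    filter_upwards [ae_restrict_mem measurableSet_Ioi] with t ht
    rw [Real.norm_eq_abs, abs_of_nonneg (integral_nonneg fun _ => norm_nonneg _)]
    refine le_trans (le_of_eq ?_) (hC t ht)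
    refine integral_congr_ae (Eventually.of_forall fun z => ?_)
    show ‖wt z * hk t z‖ = _
    rw [Real.norm_eq_abs, abs_of_pos (mul_pos (wt_pos z) (hk_pos ht z))]

theorem wt_add_le (a z : C2) : wt (z - a) ≤ (∏ i, (2 * (1 + a i ^ 2))) * wt z := by
  unfold wt prodFn
  rw [← Finset.prod_mul_distrib]
  exact Finset.prod_le_prod (fun i _ => (m1_pos _).le) fun i _ => m1_sub_le _ _

theorem Dec0.le_wt_on {K : Set C2} {F : C2 → ℂ} (hF : Dec0 K F) :
    ∃ M, 0 ≤ M ∧ ∀ z ∈ K, ‖F z‖ ≤ M * wt z := by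
  obtain ⟨M, hM0, hM⟩ := hF.bound 8
  refine ⟨M, hM0, fun z hz => ?_⟩
  have h1 : (1 + ‖z‖ ^ 2) ^ 4 ≤ (1 + ‖z‖) ^ 8 := by
    rw [show (8 : ℕ) = 2 * 4 by norm_num, pow_mul]
    gcongr
    nlinarith [norm_nonneg z]
  have hw := wt_pos z
  calc ‖F z‖ = 1 * ‖F z‖ := (one_mul _).symm
    _ ≤ ((1 + ‖z‖ ^ 2) ^ 4 * wt z) * ‖F z‖ := by gcongr; exact one_le_mul_wt z
    _ ≤ ((1 + ‖z‖) ^ 8 * wt z) * ‖F z‖ := by gcongr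
    _ = ((1 + ‖z‖) ^ 8 * ‖F z‖) * wt z := by ring
    _ ≤ M * wt z := by gcongr; exact hM z hz

theorem Dec0.le_wt {F : C2 → ℂ} (hF : Dec0 Set.univ F) : ∃ M, 0 ≤ M ∧ ∀ z, ‖F z‖ ≤ M * wt z := by
  obtain ⟨M, hM0, hM⟩ := hF.le_wt_on
  exact ⟨M, hM0, fun z => hM z (Set.mem_univ z)⟩

/-- Translates of a function decaying faster than every power are locally uniformly dominated. -/
theorem exists_translate_bound {F : C2 → ℂ} (hF : Dec0 Set.univ F) (a : C2) :
    ∃ M, 0 ≤ M ∧ ∀ b ∈ Metric.ball a 1, ∀ z, ‖F (b + z)‖ ≤ M * wt z := by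
  obtain ⟨M, hM0, hM⟩ := hF.le_wt
  refine ⟨M * ∏ i, (2 * (1 + (|a i| + 1) ^ 2)), by positivity, fun b hb z => ?_⟩
  refine (hM _).trans ?_
  rw [mul_assoc]
  refine mul_le_mul_of_nonneg_left ?_ hM0
  have := wt_add_le (-b) z
  rw [sub_neg_eq_add, add_comm z b] at this
  refine this.trans (mul_le_mul_of_nonneg_right ?_ (wt_pos z).le)
  refine Finset.prod_le_prod (fun _ _ => by positivity) fun i _ => ?_
  have h1 : |b i - a i| ≤ ‖b - a‖ := PiLp.norm_apply_le (b - a) i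
  rw [Metric.mem_ball, dist_eq_norm] at hb
  have h2 : |b i| ≤ |a i| + 1 := by
    have := abs_add_le (b i - a i) (a i)
    rw [sub_add_cancel] at this
    linarith
  have h3 : (-b) i ^ 2 ≤ (|a i| + 1) ^ 2 := by
    rw [PiLp.neg_apply, neg_sq, ← sq_abs]
    gcongr
  linarith

theorem aestronglyMeasurable_heatPot {G : Type*} [NormedAddCommGroup G] [NormedSpace ℝ G]
    {F : C2 → G} (hF : Continuous F) (a : C2) :
    AEStronglyMeasurable (fun q : ℝ × C2 => hk q.1 q.2 • F (a + q.2)) htm :=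
  measurable_hk.aestronglyMeasurable.smul
    (hF.comp (continuous_const.add continuous_snd)).aestronglyMeasurable

theorem integrable_heatPot {F : C2 → ℂ} (hF : Dec0 Set.univ F) (a : C2) :
    Integrable (fun q : ℝ × C2 => F (a + q.2) * (hk q.1 q.2 : ℂ)) htm := by
  obtain ⟨M, _, hM⟩ := exists_translate_bound hF a
  refine (integrable_wt_mul_hk.const_mul M).mono' ?_ ?_
  · have := aestronglyMeasurable_heatPot (continuousOn_univ.1 hF.1) a
    refine this.congr (Eventually.of_forall fun q => ?_)
    simp [mul_comm]
  · filter_upwards [ae_htm_pos] with q hq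
    rw [norm_mul, Complex.norm_real, Real.norm_eq_abs, abs_of_pos (hk_pos hq _), ← mul_assoc]
    exact mul_le_mul_of_nonneg_right (hM a (Metric.mem_ball_self one_pos) _) (hk_pos hq _).le

theorem continuous_heatPot {F : C2 → ℂ} (hF : Dec0 Set.univ F) : Continuous (heatPot F) := by
  refine continuous_iff_continuousAt.2 fun a => ?_
  obtain ⟨M, _, hM⟩ := exists_translate_bound hF a
  refine continuousAt_of_dominated (bound := fun q => M * (wt q.2 * hk q.1 q.2))
    (Eventually.of_forall fun b => (integrable_heatPot hF b).1) ?_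
    (integrable_wt_mul_hk.const_mul M) ?_
  · filter_upwards [Metric.ball_mem_nhds a one_pos] with b hb
    filter_upwards [ae_htm_pos] with q hq
    rw [norm_mul, Complex.norm_real, Real.norm_eq_abs, abs_of_pos (hk_pos hq _), ← mul_assoc]
    exact mul_le_mul_of_nonneg_right (hM b hb _) (hk_pos hq _).le
  · refine Eventually.of_forall fun q => ?_
    exact (((continuousOn_univ.1 hF.1).comp (continuous_id.add continuous_const)).mul
      continuous_const).continuousAt

theorem norm_clm_le (L : C2 →L[ℝ] ℂ) : ‖L‖ ≤ ∑ i, ‖L (bv i)‖ := by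
  refine L.opNorm_le_bound (Finset.sum_nonneg fun _ _ => norm_nonneg _) fun v => ?_
  have hv : v = ∑ i, v i • bv i := by
    ext k
    rcases k with j | j <;>
      rcases (by fin_cases j <;> simp : j = 0 ∨ j = 1) with rfl | rfl <;> simp [bv]
  calc ‖L v‖ = ‖∑ i, v i • L (bv i)‖ := by
        conv_lhs => rw [hv, map_sum]
        simp only [map_smul]
    _ ≤ ∑ i, ‖v i • L (bv i)‖ := norm_sum_le _ _
    _ ≤ ∑ i, ‖L (bv i)‖ * ‖v‖ := Finset.sum_le_sum fun i _ => by
        rw [norm_smul, mul_comm]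
        exact mul_le_mul_of_nonneg_left (PiLp.norm_apply_le v i) (norm_nonneg _)
    _ = _ := by rw [Finset.sum_mul]

theorem contDiff_of_dec_univ {n : ℕ} {F : C2 → ℂ} (hF : Dec n Set.univ F) : ContDiff ℝ n F :=
  contDiffOn_univ.1 (hF.contDiffOn)

/-- The variable `a` enters through `F (a + ·)` only, so the derivative falls on the density and
never on the singular kernel. Translates of the derivative of `F` by points near `a` share one
majorant, a multiple of `wt`. -/
theorem hasFDerivAt_heatPot {F : C2 → ℂ} (hF : Dec 1 Set.univ F) (a : C2) :
    HasFDerivAt (heatPot F) (∫ q, (hk q.1 q.2 : ℝ) • fderiv ℝ F (a + q.2) ∂htm) a ∧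
      Integrable (fun q : ℝ × C2 => (hk q.1 q.2 : ℝ) • fderiv ℝ F (a + q.2)) htm := by
  have hc1 : ContDiff ℝ 1 F := by exact_mod_cast contDiff_of_dec_univ hF
  have hb : ∃ M, ∀ b ∈ Metric.ball a 1, ∀ z, ‖fderiv ℝ F (b + z)‖ ≤ M * wt z := by
    choose M _ hM using fun i => exists_translate_bound (hF.pd (bv i)).dec0 a
    refine ⟨∑ i, M i, fun b hb z => (norm_clm_le _).trans ?_⟩
    rw [Finset.sum_mul]
    refine Finset.sum_le_sum fun i _ => ?_
    have := hM i b hb z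
    rwa [pd_eq_fderiv univ_mem] at this
  obtain ⟨M, hM⟩ := hb
  have bnd : ∀ᵐ q ∂htm, ∀ b ∈ Metric.ball a 1,
      ‖(hk q.1 q.2 : ℝ) • fderiv ℝ F (b + q.2)‖ ≤ M * (wt q.2 * hk q.1 q.2) := by
    filter_upwards [ae_htm_pos] with q hq b hb
    rw [norm_smul, Real.norm_eq_abs, abs_of_pos (hk_pos hq _), mul_comm, ← mul_assoc]
    exact mul_le_mul_of_nonneg_right (hM b hb _) (hk_pos hq _).le
  have hme := aestronglyMeasurable_heatPot (hc1.continuous_fderiv one_ne_zero) a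
  refine ⟨?_, (integrable_wt_mul_hk.const_mul M).mono' hme ?_⟩
  · refine hasFDerivAt_integral_of_dominated_of_fderiv_le
      (F' := fun b (q : ℝ × C2) => (hk q.1 q.2 : ℝ) • fderiv ℝ F (b + q.2))
      (Metric.ball_mem_nhds a one_pos)
      (Eventually.of_forall fun b => (integrable_heatPot hF.dec0 b).1)
      (integrable_heatPot hF.dec0 a) hme bnd (integrable_wt_mul_hk.const_mul M)
      (Eventually.of_forall fun q b _ => ?_)
    have h1 : HasFDerivAt (fun b => F (b + q.2)) (fderiv ℝ F (b + q.2)) b :=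
      (hasFDerivAt_comp_add_right q.2).2 (hc1.differentiable one_ne_zero (b + q.2)).hasFDerivAt
    refine (h1.const_smul (hk q.1 q.2)).congr_of_eventuallyEq (Eventually.of_forall fun b => ?_)
    show F (b + q.2) * (hk q.1 q.2 : ℂ) = hk q.1 q.2 • F (b + q.2)
    rw [Complex.real_smul, mul_comm]
  · filter_upwards [bnd] with q hq
    exact hq a (Metric.mem_ball_self one_pos)

/-- Heat potentials inherit the regularity of their density. -/
theorem contDiff_heatPot : ∀ {n : ℕ} {F : C2 → ℂ}, Dec n Set.univ F → ContDiff ℝ n (heatPot F)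
  | 0, _, hF => contDiff_zero.2 (continuous_heatPot hF)
  | n + 1, F, hF => by
    have h1 : Dec 1 Set.univ F := hF.mono (by omega)
    have : ((n + 1 : ℕ) : WithTop ℕ∞) = (n : WithTop ℕ∞) + 1 := by norm_cast
    rw [this, contDiff_succ_iff_fderiv_apply]
    refine ⟨fun a => (hasFDerivAt_heatPot h1 a).1.differentiableAt, fun h => by simp at h,
      fun v => ?_⟩
    have : (fun a => fderiv ℝ (heatPot F) a v) = heatPot (pd Set.univ v F) := by
      funext a
      rw [(hasFDerivAt_heatPot h1 a).1.fderiv, ContinuousLinearMap.integral_apply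
        (hasFDerivAt_heatPot h1 a).2]
      refine integral_congr_ae (Eventually.of_forall fun q => ?_)
      show (hk q.1 q.2 • fderiv ℝ F (a + q.2)) v = pd Set.univ v F (a + q.2) * _
      rw [pd_eq_fderiv univ_mem]
      simp [mul_comm]
    rw [this]
    exact contDiff_heatPot (hF.pd v)

end Potential


/-! ### Representation of weak solutions by alternating heat potentials -/

section Representation

theorem smallPlusInt_of_le_wt {F : C2 → ℂ} {M : ℝ} (h : ∀ z, ‖F z‖ ≤ M * wt z) : SmallPlusInt F :=
  fun _ hκ => ⟨fun z => M * wt z, integrable_wt.const_mul M, fun z => (h z).trans (by linarith)⟩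

theorem integral_mul_prodFn_kn {F : C2 → ℂ} (hF : SmallPlusInt F) (hm : AEStronglyMeasurable F)
    {t : ℝ} (ht : 0 < t) (a : C2) :
    ∫ z, F z * (prodFn (kn t a) z : ℂ) =
      ∑ p : Bool × Bool, (sg p : ℂ) * ∫ z, F z * (hk t (z - refl p a) : ℂ) := by
  have hi : ∀ p ∈ (Finset.univ : Finset (Bool × Bool)),
      Integrable fun z => (sg p : ℂ) * (F z * (hk t (z - refl p a) : ℂ)) := fun p _ =>
    (hF.integrable_mul hm ((integrable_hk ht).comp_sub_right _) (abs_hk_sub_le ht _)).const_mul _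
  have e : ∀ z, F z * (prodFn (kn t a) z : ℂ) =
      ∑ p : Bool × Bool, (sg p : ℂ) * (F z * (hk t (z - refl p a) : ℂ)) := by
    intro z
    rw [prodFn_kn, Complex.ofReal_sum, Finset.mul_sum]
    refine Finset.sum_congr rfl fun p _ => ?_
    push_cast
    ring
  simp only [e]
  rw [integral_finsetSum _ hi]
  exact Finset.sum_congr rfl fun p _ => integral_const_mul _ _

/-- The alternating sum of the heat potentials at the reflected points. -/
noncomputable def altPot (R : C2 → ℂ) (a : C2) : ℂ :=
  ∑ p : Bool × Bool, (sg p : ℂ) * heatPot R (refl p a)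

theorem integral_translate (F : C2 → ℂ) (t : ℝ) (a : C2) :
    ∫ z, F (a + z) * (hk t z : ℂ) = ∫ z, F z * (hk t (z - a) : ℂ) := by
  rw [← integral_add_left_eq_self (fun z => F z * (hk t (z - a) : ℂ)) a]
  simp

/-- For each image a translation moves the reflected point from the kernel to the density, and
Fubini identifies the time integral with `heatPot`. -/
theorem altPot_eq {R : C2 → ℂ} (hR : Dec0 Set.univ R) (a : C2) :
    IntegrableOn (fun t => ∫ z, R z * (prodFn (kn t a) z : ℂ)) (Set.Ioi 0) ∧
    ∫ t in Set.Ioi (0 : ℝ), ∫ z, R z * (prodFn (kn t a) z : ℂ) = altPot R a := by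
  obtain ⟨M, _, hM⟩ := hR.le_wt
  have hRm : AEStronglyMeasurable R := (continuousOn_univ.1 hR.1).aestronglyMeasurable
  have e : ∀ t ∈ Set.Ioi (0 : ℝ), ∫ z, R z * (prodFn (kn t a) z : ℂ) =
      ∑ p : Bool × Bool, (sg p : ℂ) * ∫ z, R (refl p a + z) * (hk t z : ℂ) := by
    intro t ht
    rw [integral_mul_prodFn_kn (smallPlusInt_of_le_wt hM) hRm ht]
    exact Finset.sum_congr rfl fun p _ => by rw [integral_translate]
  have hi : ∀ p ∈ (Finset.univ : Finset (Bool × Bool)), IntegrableOn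
      (fun t => (sg p : ℂ) * ∫ z, R (refl p a + z) * (hk t z : ℂ)) (Set.Ioi 0) := fun p _ =>
    (integrable_heatPot hR (refl p a)).integral_prod_left.const_mul _
  refine ⟨(integrable_finsetSum _ hi).congr ?_, ?_⟩
  · filter_upwards [ae_restrict_mem measurableSet_Ioi] with t ht
    exact (e t ht).symm
  · rw [setIntegral_congr_fun measurableSet_Ioi e, integral_finsetSum _ hi]
    refine Finset.sum_congr rfl fun p _ => ?_
    rw [integral_const_mul]
    congr 1
    exact (integral_prod _ (integrable_heatPot hR (refl p a))).symm

/-- A nontrivial reflection makes at least one `y_j` negative. Consequently a function extended by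
zero vanishes in a neighbourhood of the three other images. -/
theorem refl_notMem_closure {a : C2} (ha : a ∈ Omega) {p : Bool × Bool} (hp : p ≠ (false, false)) :
    refl p a ∈ (closure Omega)ᶜ := by
  rw [closure_Omega]
  intro h
  have h0 := h 0
  have h1 := h 1
  have a0 := ha 0
  have a1 := ha 1
  rcases p with ⟨_ | _, _ | _⟩ <;> simp [refl, bsgn] at h0 h1 hp
  all_goals linarith

/-- A weak solution with null faces is the alternating potential of its Laplacian. -/
theorem representation {H R : C2 → ℂ} (hHc : ContinuousOn H Omega) (hH0 : ∀ z ∉ Omega, H z = 0)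
    (hHs : SmallPlusInt H) (hR : Dec0 Set.univ R) (hR0 : ∀ z ∉ Omega, R z = 0)
    (htest : ∀ φ, IsTest Omega φ →
      ∫ z in Omega, H z * lap Set.univ bv φ z = -∫ z in Omega, R z * φ z)
    (hface : ∀ j, FaceNull j H) {a : C2} (ha : a ∈ Omega) : H a = altPot R a := by
  have hHm : AEStronglyMeasurable H := by
    have h1 := (hHc.aestronglyMeasurable isOpen_Omega.measurableSet (μ := volume))
    rw [← aestronglyMeasurable_indicator_iff isOpen_Omega.measurableSet] at h1
    refine h1.congr (Eventually.of_forall fun z => ?_)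
    by_cases hz : z ∈ Omega
    · exact Set.indicator_of_mem hz _
    · rw [Set.indicator_of_notMem hz, hH0 z hz]
  have hfull : ∀ (G : C2 → ℂ), (∀ z ∉ Omega, G z = 0) → ∀ k : C2 → ℂ,
      ∫ z in Omega, G z * k z = ∫ z, G z * k z := fun G hG k =>
    setIntegral_eq_integral_of_forall_compl_eq_zero fun z hz => by rw [hG z hz, zero_mul]
  have hHi : Integrable (fun z => H z * (wt z : ℂ)) :=
    hHs.integrable_mul hHm integrable_wt (M := 1) fun z => by
      rw [abs_of_pos (wt_pos z)]; exact wt_le_one z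
  obtain ⟨M, _, hM⟩ := hR.le_wt
  have hRm : AEStronglyMeasurable R := (continuousOn_univ.1 hR.1).aestronglyMeasurable
  have hRi : Integrable (fun z => R z * (wt z : ℂ)) :=
    (smallPlusInt_of_le_wt hM).integrable_mul hRm integrable_wt (M := 1) fun z => by
      rw [abs_of_pos (wt_pos z)]; exact wt_le_one z
  set ψ : ℝ → ℂ := fun t => ∫ z, H z * (prodFn (kn t a) z : ℂ) with hψ
  set ρ : ℝ → ℂ := fun t => ∫ z, R z * (prodFn (kn t a) z : ℂ) with hρ
  -- By the heat equation the time derivative puts the Laplacian on the kernel; the kernel vanishes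
  -- on the faces, so `weak_identity` converts this into `-ρ`.
  have hderiv : ∀ t ∈ Set.Ioi (0 : ℝ), HasDerivAt ψ (-ρ t) t := by
    intro t ht
    obtain ⟨C, hC⟩ := exists_kn_bound (show (0 : ℝ) < t from ht) le_rfl a
    have h1 := hasDerivAt_integral_kn hHm hHi ht a
    refine h1.congr_deriv ?_
    have h2 := weak_identity hHc ((continuousOn_univ.1 hR.1).continuousOn) hHi.integrableOn
      hRi.integrableOn htest hface (hC t ⟨le_rfl, le_rfl⟩) (kn_zero t a)
    rw [hfull R hR0] at h2
    simp only [hfull H hH0] at h2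
    exact h2
  -- As `t → 0` each image contributes its value of `H`, and only `a` itself lies in the domain.
  have hlim0 : Tendsto ψ (𝓝[>] 0) (𝓝 (H a)) := by
    have h1 : Tendsto (fun t => ∑ p : Bool × Bool, (sg p : ℂ) * ∫ z, H z * (hk t (z - refl p a) : ℂ))
        (𝓝[>] 0) (𝓝 (∑ p : Bool × Bool, (sg p : ℂ) * H (refl p a))) := by
      refine tendsto_finsetSum _ fun p _ => Tendsto.const_mul _ ?_
      refine tendsto_heat_zero hHs hHm ?_
      by_cases hp : p = (false, false)
      · rw [hp, refl_id]
        exact hHc.continuousAt (isOpen_Omega.mem_nhds ha)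
      · have hn := (isClosed_closure (s := Omega)).isOpen_compl.mem_nhds (refl_notMem_closure ha hp)
        refine (continuousAt_const (y := (0 : ℂ))).congr ?_
        filter_upwards [hn] with z hz
        exact (hH0 z fun h => hz (subset_closure h)).symm
    have h2 : ∑ p : Bool × Bool, (sg p : ℂ) * H (refl p a) = H a := by
      rw [Finset.sum_eq_single (false, false)]
      · rw [refl_id]; simp [sg, bsgn]
      · intro p _ hp
        rw [hH0 _ fun h => refl_notMem_closure ha hp (subset_closure h), mul_zero]
      · simp
    rw [h2] at h1
    refine h1.congr' ?_
    filter_upwards [self_mem_nhdsWithin] with t ht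
    exact (integral_mul_prodFn_kn hHs hHm ht a).symm
  have hlim1 : Tendsto ψ atTop (𝓝 0) := by
    have h1 : Tendsto (fun t => ∑ p : Bool × Bool, (sg p : ℂ) * ∫ z, H z * (hk t (z - refl p a) : ℂ))
        atTop (𝓝 (∑ p : Bool × Bool, (sg p : ℂ) * 0)) :=
      tendsto_finsetSum _ fun p _ => Tendsto.const_mul _ (tendsto_heat_atTop hHs _)
    simp only [mul_zero, Finset.sum_const_zero] at h1
    refine h1.congr' ?_
    filter_upwards [eventually_gt_atTop 0] with t ht
    exact (integral_mul_prodFn_kn hHs hHm ht a).symm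
  obtain ⟨hρi, hρe⟩ := altPot_eq hR a
  -- The formula for `ψ` is meaningless at time `0`. Assigning the limit value makes it continuous
  -- there, as the fundamental theorem of calculus on the half-line requires.
  set Ψ := Function.update ψ 0 (H a) with hΨ
  have hne : ∀ t : ℝ, t ≠ 0 → Ψ t = ψ t := fun t ht => Function.update_of_ne ht _ _
  have hkey := integral_Ioi_of_hasDerivAt_of_tendsto (f := Ψ) (f' := fun t => -ρ t) (a := 0) (m := 0)
    (by
      refine continuousWithinAt_Ioi_iff_Ici.1 ?_
      show Tendsto Ψ (𝓝[>] 0) (𝓝 (Ψ 0))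
      rw [show Ψ 0 = H a from Function.update_self _ _ _]
      refine hlim0.congr' ?_
      filter_upwards [self_mem_nhdsWithin] with t ht
      exact (hne t (show (0 : ℝ) < t from ht).ne').symm)
    (fun t ht => (hderiv t ht).congr_of_eventuallyEq (by
      filter_upwards [lt_mem_nhds (show (0 : ℝ) < t from ht)] with s hs
      exact hne s hs.ne'))
    hρi.neg
    (hlim1.congr' (by
      filter_upwards [eventually_gt_atTop 0] with s hs
      exact (hne s hs.ne').symm))
  rw [integral_neg, hρe, hΨ, Function.update_self, zero_sub, neg_inj] at hkey
  exact hkey.symm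

end Representation

/-! ### Integrability of the potential on horizontal slices -/

section Slices

/-- With `x = τ² / (4 t)` one has `|τ| ≤ √(4 t) exp x`. The exponential cancels the Gaussian, and
the square root is compensated by the normalization of the kernel. -/
theorem abs_deriv_g1_le {t : ℝ} (ht : 0 < t) (τ : ℝ) : |deriv (g1 t) τ| ≤ t⁻¹ := by
  rw [deriv_g1, abs_mul, abs_neg, abs_div, abs_of_pos (g1_pos ht τ), abs_of_pos (by positivity : 0 < 2 * t)]
  set x := τ ^ 2 / (4 * t) with hx
  have hx0 : 0 ≤ x := by positivity
  have h1 : |τ| ≤ √(4 * t) * Real.exp x := by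
    rw [← Real.sqrt_sq_eq_abs, ← Real.sqrt_sq (Real.exp_pos x).le, ← Real.sqrt_mul (by positivity)]
    refine Real.sqrt_le_sqrt ?_
    have h2 : τ ^ 2 = 4 * t * x := by rw [hx]; field_simp
    rw [h2]
    have h3 := Real.add_one_le_exp x
    have : x ≤ Real.exp x ^ 2 := by nlinarith
    gcongr
  have h2 : √(4 * t) ≤ √(4 * Real.pi * t) := by
    refine Real.sqrt_le_sqrt ?_
    nlinarith [Real.pi_gt_three]
  have h3 : 0 < √(4 * t) := Real.sqrt_pos.2 (by positivity)
  unfold g1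
  rw [← hx]
  calc |τ| / (2 * t) * ((√(4 * Real.pi * t))⁻¹ * Real.exp (-x))
      ≤ (√(4 * t) * Real.exp x) / (2 * t) * ((√(4 * t))⁻¹ * Real.exp (-x)) := by gcongr
    _ = (√(4 * t) * (√(4 * t))⁻¹) * (Real.exp x * Real.exp (-x)) / (2 * t) := by ring
    _ = 1 / (2 * t) := by rw [mul_inv_cancel₀ h3.ne', ← Real.exp_add]; simp
    _ ≤ t⁻¹ := by rw [← one_div]; gcongr; linarith

/-- The weighted mass of the odd heat kernel decays. -/
theorem exists_integral_odd_g1_le (b : ℝ) : ∃ C, ∀ t, 0 < t →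
    Integrable (fun τ => m1 τ * |g1 t (τ - b) - g1 t (τ - -b)|) ∧
    ∫ τ, m1 τ * |g1 t (τ - b) - g1 t (τ - -b)| ≤ C * (1 + t)⁻¹ := by
  have hI : 0 ≤ ∫ τ, m1 τ := integral_nonneg fun τ => (m1_pos τ).le
  refine ⟨4 + 4 * |b| * ∫ τ, m1 τ, fun t ht => ?_⟩
  have hg : ∀ c, Integrable fun τ => g1 t (τ - c) := fun c => (integrable_g1 ht).comp_sub_right c
  have hd : Integrable fun τ => |g1 t (τ - b) - g1 t (τ - -b)| := ((hg b).sub (hg (-b))).abs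
  have hi : Integrable fun τ => m1 τ * |g1 t (τ - b) - g1 t (τ - -b)| := by
    refine hd.mono' (continuous_m1.aestronglyMeasurable.mul hd.1) (Eventually.of_forall fun τ => ?_)
    rw [Real.norm_eq_abs, abs_mul, abs_abs, abs_of_pos (m1_pos τ)]
    exact mul_le_of_le_one_left (abs_nonneg _) (m1_le_one τ)
  refine ⟨hi, ?_⟩
  rw [← div_eq_mul_inv, le_div_iff₀ (by positivity)]
  have h0 : 0 ≤ ∫ τ, m1 τ * |g1 t (τ - b) - g1 t (τ - -b)| :=
    integral_nonneg fun τ => mul_nonneg (m1_pos τ).le (abs_nonneg _)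
  have hb : 0 ≤ |b| := abs_nonneg b
  rcases le_total t 1 with h | h
  · have h1 : ∫ τ, m1 τ * |g1 t (τ - b) - g1 t (τ - -b)| ≤ 2 := by
      calc _ ≤ ∫ τ, (g1 t (τ - b) + g1 t (τ - -b)) := by
            refine integral_mono hi ((hg b).add (hg (-b))) fun τ => ?_
            refine (mul_le_of_le_one_left (abs_nonneg _) (m1_le_one τ)).trans ?_
            refine (abs_sub _ _).trans ?_
            rw [abs_of_pos (g1_pos ht _), abs_of_pos (g1_pos ht _)]
        _ = 2 := by
            rw [integral_add (hg b) (hg (-b)), integral_sub_right_eq_self (g1 t),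
              integral_sub_right_eq_self (g1 t), integral_g1 ht]
            norm_num
    have : 0 ≤ |b| * ∫ τ, m1 τ := mul_nonneg hb hI
    nlinarith
  -- For large times the two Gaussians, centred at distance `2 |b|`, differ by at most this distance
  -- times the slope bound `t⁻¹`.
  · have h1 : ∫ τ, m1 τ * |g1 t (τ - b) - g1 t (τ - -b)| ≤ (2 * |b| * t⁻¹) * ∫ τ, m1 τ := by
      rw [← integral_const_mul]
      refine integral_mono hi (integrable_m1.const_mul _) fun τ => ?_
      show m1 τ * _ ≤ 2 * |b| * t⁻¹ * m1 τ
      rw [mul_comm]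
      refine mul_le_mul_of_nonneg_right ?_ (m1_pos τ).le
      have := convex_univ.norm_image_sub_le_of_norm_hasDerivWithin_le (f := g1 t)
        (f' := deriv (g1 t)) (C := t⁻¹) (x := τ - -b) (y := τ - b)
        (fun x _ => (hasDerivAt_of_top (contDiff_g1 t) x).hasDerivWithinAt)
        (fun x _ => abs_deriv_g1_le ht x) (Set.mem_univ _) (Set.mem_univ _)
      rw [Real.norm_eq_abs, Real.norm_eq_abs] at this
      refine this.trans (le_of_eq ?_)
      rw [show τ - b - (τ - -b) = -(2 * b) by ring, abs_neg, abs_mul, abs_two]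
      ring
    have h2 : t⁻¹ * (1 + t) ≤ 2 := by
      rw [inv_mul_le_iff₀ ht]; linarith
    calc _ ≤ (2 * |b| * t⁻¹) * (∫ τ, m1 τ) * (1 + t) := by gcongr
      _ = 2 * |b| * (∫ τ, m1 τ) * (t⁻¹ * (1 + t)) := by ring
      _ ≤ 2 * |b| * (∫ τ, m1 τ) * 2 := by gcongr
      _ ≤ _ := by linarith

theorem integrable_R2_mul {f g : ℝ → ℝ} (hf : Integrable f) (hg : Integrable g) :
    Integrable (fun x : R2 => f (x 0) * g (x 1)) := by
  have := (Integrable.fintype_prod (f := ![f, g]) (μ := fun _ => volume)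
    fun i => by fin_cases i; exacts [hf, hg])
  rw [← volume_pi] at this
  have h2 := (PiLp.volume_preserving_ofLp (Fin 2)).integrable_comp_of_integrable this
  simpa [Function.comp_def, Fin.prod_univ_two] using h2

theorem integral_R2_mul (f g : ℝ → ℝ) :
    ∫ x : R2, f (x 0) * g (x 1) = (∫ τ, f τ) * ∫ τ, g τ := by
  have h1 : ∫ x : R2, f (x 0) * g (x 1) = ∫ x : Fin 2 → ℝ, f (x 0) * g (x 1) :=
    (PiLp.volume_preserving_ofLp (Fin 2)).integral_comp
      (MeasurableEquiv.toLp 2 (Fin 2 → ℝ)).symm.measurableEmbedding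
      (fun x : Fin 2 → ℝ => f (x 0) * g (x 1))
  rw [h1]
  have := integral_fintype_prod_volume_eq_prod (fun i : Fin 2 => ![f, g] i)
  simpa [Fin.prod_univ_two] using this

/-- The horizontal slices of the alternating potential are integrable. -/
theorem integrable_altPot_slice {R : C2 → ℂ} (hR : Dec0 Set.univ R) (y : R2) :
    Integrable (fun x : R2 => altPot R (pt x y)) := by
  obtain ⟨M, hM0, hM⟩ := hR.le_wt
  have hRc := continuousOn_univ.1 hR.1
  choose C hC using exists_integral_odd_g1_le
  -- The integral over `x` uses up the two horizontal factors, which have mass one. The two vertical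
  -- Gaussians alone would leave `1 / t`, not integrable at infinity; the odd differences in `Y`
  -- give `1 / (1 + t)` each. This is why the alternating sum is estimated as a whole.
  set X : ℝ × C2 → R2 → ℝ := fun q x =>
    g1 q.1 (x 0 - q.2 (Sum.inl 0)) * g1 q.1 (x 1 - q.2 (Sum.inl 1)) with hX
  set Y : ℝ × C2 → ℝ := fun q => kn q.1 (pt 0 y) (Sum.inr 0) (q.2 (Sum.inr 0)) *
    kn q.1 (pt 0 y) (Sum.inr 1) (q.2 (Sum.inr 1)) with hY
  set G : R2 × (ℝ × C2) → ℂ := fun w => R w.2.2 * (prodFn (kn w.2.1 (pt w.1 y)) w.2.2 : ℂ) with hG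
  have hsplit : ∀ x q, prodFn (kn q.1 (pt x y)) q.2 = X q x * Y q := by
    intro x q
    simp only [prodFn, hX, hY, Fintype.prod_sum_type, Fin.prod_univ_two, kn, pt, Sum.elim_inl,
      Sum.elim_inr]
    rw [← g1_even _ (x 0 - _), ← g1_even _ (x 1 - _), neg_sub, neg_sub]
  have hmk : ∀ j, Measurable fun q : ℝ × C2 => kn q.1 (pt 0 y) (Sum.inr j) (q.2 (Sum.inr j)) := by
    intro j
    have h : ∀ c : ℝ, Measurable fun q : ℝ × C2 => g1 q.1 (q.2 (Sum.inr j) - c) := fun c =>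
      measurable_g1.comp (measurable_fst.prodMk (by fun_prop))
    exact (h _).sub (h _)
  have hmX : Measurable fun w : R2 × (ℝ × C2) => X w.2 w.1 := by
    have h : ∀ j, Measurable fun w : R2 × (ℝ × C2) => g1 w.2.1 (w.1 j - w.2.2 (Sum.inl j)) :=
      fun j => measurable_g1.comp (Measurable.prodMk (by fun_prop) (by fun_prop))
    exact (h 0).mul (h 1)
  have hmY : Measurable Y := (hmk 0).mul (hmk 1)
  have hmG : AEStronglyMeasurable G (volume.prod htm) := by
    have h : G = fun w => R w.2.2 * ((X w.2 w.1 * Y w.2 : ℝ) : ℂ) := by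
      funext w
      simp only [hG, hsplit]
    rw [h]
    refine (hRc.measurable.comp (measurable_snd.comp measurable_snd)).aestronglyMeasurable.mul ?_
    exact (Complex.measurable_ofReal.comp (hmX.mul (hmY.comp measurable_snd))).aestronglyMeasurable
  have hXi : ∀ q : ℝ × C2, 0 < q.1 → Integrable (X q) ∧ ∫ x, X q x = 1 := by
    intro q hq
    have h : ∀ c, Integrable fun τ => g1 q.1 (τ - c) := fun c => (integrable_g1 hq).comp_sub_right c
    refine ⟨integrable_R2_mul (h _) (h _), ?_⟩
    rw [hX]
    refine (integral_R2_mul (fun τ => g1 q.1 (τ - _)) (fun τ => g1 q.1 (τ - _))).trans ?_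
    rw [integral_sub_right_eq_self (g1 q.1), integral_sub_right_eq_self (g1 q.1), integral_g1 hq,
      one_mul]
  have hnorm : ∀ q : ℝ × C2, 0 < q.1 → ∀ x, ‖G (x, q)‖ = X q x * (‖R q.2‖ * |Y q|) := by
    intro q hq x
    have h0 : 0 < X q x := mul_pos (g1_pos hq _) (g1_pos hq _)
    simp only [hG, hsplit]
    rw [norm_mul, Complex.norm_real, Real.norm_eq_abs, abs_mul, abs_of_pos h0]
    ring
  have hYi : Integrable (fun q => ‖R q.2‖ * |Y q|) htm := by
    set P : ℝ → Ix → ℝ → ℝ := fun t i => match i with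
      | Sum.inl _ => m1
      | Sum.inr j => fun τ => m1 τ * |g1 t (τ - y j) - g1 t (τ - -y j)| with hP
    have hPi : ∀ t, 0 < t → Integrable (prodFn (P t)) := fun t ht => integrable_prodFn fun i => by
      rcases i with j | j
      · exact integrable_m1
      · exact (hC (y j) t ht).1
    have hPle : ∀ t, 0 < t → ∫ z, prodFn (P t) z ≤
        ((∫ τ, m1 τ) ^ 2 * (C (y 0) * C (y 1))) * m1 t := by
      intro t ht
      rw [integral_prodFn]
      simp only [hP, Fintype.prod_sum_type, Fin.prod_univ_two]
      have p0 : ∀ j, 0 ≤ ∫ τ, m1 τ * |g1 t (τ - y j) - g1 t (τ - -y j)| := fun j =>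
        integral_nonneg fun τ => mul_nonneg (m1_pos τ).le (abs_nonneg _)
      have h0 := (hC (y 0) t ht).2
      have h1 := (hC (y 1) t ht).2
      have c0 : 0 ≤ C (y 0) * (1 + t)⁻¹ := (p0 0).trans h0
      have c1 : 0 ≤ C (y 1) * (1 + t)⁻¹ := (p0 1).trans h1
      have ht1 : (0 : ℝ) < 1 + t := by positivity
      have cc : 0 ≤ C (y 0) * C (y 1) := by
        rw [← div_eq_mul_inv, le_div_iff₀ ht1, zero_mul] at c0 c1
        exact mul_nonneg c0 c1
      have hI : 0 ≤ (∫ τ, m1 τ) * ∫ τ, m1 τ := mul_self_nonneg _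
      calc _ ≤ ((∫ τ, m1 τ) * ∫ τ, m1 τ) * ((C (y 0) * (1 + t)⁻¹) * (C (y 1) * (1 + t)⁻¹)) := by
            refine mul_le_mul_of_nonneg_left (mul_le_mul h0 h1 (p0 1) c0) hI
        _ = ((∫ τ, m1 τ) ^ 2 * (C (y 0) * C (y 1))) * ((1 + t)⁻¹ * (1 + t)⁻¹) := by ring
        _ ≤ _ := by
            refine mul_le_mul_of_nonneg_left ?_ (mul_nonneg (sq_nonneg _) cc)
            unfold m1
            rw [← mul_inv]
            exact inv_anti₀ (by positivity) (by nlinarith)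
    have hle : ∀ q : ℝ × C2, ‖R q.2‖ * |Y q| ≤ M * prodFn (P q.1) q.2 := by
      intro q
      have e : prodFn (P q.1) q.2 = wt q.2 * |Y q| := by
        simp only [prodFn, hP, wt, hY, kn, pt, Fintype.prod_sum_type, Fin.prod_univ_two, abs_mul,
          Sum.elim_inr]
        ring
      rw [e, ← mul_assoc]
      exact mul_le_mul_of_nonneg_right (hM _) (abs_nonneg _)
    have hm : AEStronglyMeasurable (fun q => ‖R q.2‖ * |Y q|) htm :=
      ((hRc.measurable.comp measurable_snd).norm.mul hmY.abs).aestronglyMeasurable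
    have hsl : ∀ t, 0 < t → Integrable fun z => ‖R z‖ * |Y (t, z)| := fun t ht => by
      refine ((hPi t ht).const_mul M).mono' ?_ (Eventually.of_forall fun z => ?_)
      · exact (hRc.measurable.norm.mul (hmY.comp measurable_prodMk_left).abs).aestronglyMeasurable
      · rw [Real.norm_eq_abs, abs_of_nonneg (by positivity)]
        exact hle (t, z)
    refine (integrable_prod_iff hm).2 ⟨?_, ?_⟩
    · filter_upwards [ae_restrict_mem measurableSet_Ioi] with t ht
      exact hsl t ht
    · refine ((integrable_m1.const_mul
        (M * ((∫ τ, m1 τ) ^ 2 * (C (y 0) * C (y 1))))).restrict (s := Set.Ioi 0)).mono'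
        hm.norm.integral_prod_right' ?_
      filter_upwards [ae_restrict_mem measurableSet_Ioi] with t ht
      rw [Real.norm_eq_abs, abs_of_nonneg (integral_nonneg fun _ => norm_nonneg _)]
      calc ∫ z, ‖‖R z‖ * |Y (t, z)|‖ ≤ ∫ z, M * prodFn (P t) z := by
            refine integral_mono (hsl t ht).norm ((hPi t ht).const_mul M) fun z => ?_
            show ‖‖R z‖ * |Y (t, z)|‖ ≤ _
            rw [Real.norm_eq_abs, abs_of_nonneg (by positivity)]
            exact hle (t, z)
        _ ≤ M * (((∫ τ, m1 τ) ^ 2 * (C (y 0) * C (y 1))) * m1 t) := by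
            rw [integral_const_mul]
            exact mul_le_mul_of_nonneg_left (hPle t ht) hM0
        _ = _ := by ring
  have : SFinite htm := by unfold htm; infer_instance
  have hGi : Integrable G (volume.prod htm) := by
    refine (integrable_prod_iff' hmG).2 ⟨?_, ?_⟩
    · filter_upwards [ae_htm_pos] with q hq
      have h1 := (((hXi q hq).1.mul_const (Y q)).ofReal (𝕜 := ℂ)).const_mul (R q.2)
      refine h1.congr (Eventually.of_forall fun x => ?_)
      simp only [hG, hsplit]
      rfl
    · refine hYi.congr ?_
      filter_upwards [ae_htm_pos] with q hq
      simp only [hnorm q hq]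
      rw [integral_mul_const, (hXi q hq).2, one_mul]
  refine hGi.integral_prod_left.congr ?_
  filter_upwards [hGi.prod_right_ae] with x hx
  rw [← (altPot_eq hR (pt x y)).2]
  exact integral_prod _ hx

end Slices


/-! ### Passage to and from Schwartz functions, and extension by zero -/

section Conversion

variable {E : Type*} [NormedAddCommGroup E] [NormedSpace ℝ E] {K S : Set E} {h : E → ℂ}

theorem one_add_pow_le {x : ℝ} (hx : 0 ≤ x) (k : ℕ) : (1 + x) ^ k ≤ 2 ^ k * (1 + x ^ k) := by
  rcases le_total x 1 with h | h
  · calc (1 + x) ^ k ≤ (2 : ℝ) ^ k := by gcongr; linarith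
      _ ≤ 2 ^ k * (1 + x ^ k) := le_mul_of_one_le_right (by positivity) (by
          have : 0 ≤ x ^ k := by positivity
          linarith)
  · calc (1 + x) ^ k ≤ (2 * x) ^ k := by gcongr; linarith
      _ = 2 ^ k * x ^ k := mul_pow _ _ _
      _ ≤ _ := by gcongr; linarith

theorem IsSchwartzOn.pd {K : Set C2} (hK : UniqueDiffOn ℝ K) {h : C2 → ℂ} (hh : IsSchwartzOn K h)
    (v : C2) : IsSchwartzOn K (pd K v h) := by
  have hc : ContDiffOn ℝ ∞ (fderivWithin ℝ h K) K := hh.1.fderivWithin hK (by simp)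
  refine ⟨hc.clm_apply contDiffOn_const, fun k n => ?_⟩
  obtain ⟨M, hM⟩ := hh.2 k (n + 1)
  refine ⟨‖v‖ * M, fun z hz => ?_⟩
  have h1 : ‖iteratedFDerivWithin ℝ n (DbarNeumann.pd K v h) K z‖ ≤
      ‖v‖ * ‖iteratedFDerivWithin ℝ n (fderivWithin ℝ h K) K z‖ :=
    norm_iteratedFDerivWithin_clm_apply_const (hc z hz) hK hz (by exact_mod_cast le_top)
  rw [norm_iteratedFDerivWithin_fderivWithin hK hz] at h1
  calc _ ≤ ‖z‖ ^ k * (‖v‖ * ‖iteratedFDerivWithin ℝ (n + 1) h K z‖) := by gcongr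
    _ = ‖v‖ * (‖z‖ ^ k * ‖iteratedFDerivWithin ℝ (n + 1) h K z‖) := by ring
    _ ≤ _ := by gcongr; exact hM z hz

theorem IsSchwartzOn.dec {K : Set C2} (hK : UniqueDiffOn ℝ K) : ∀ {N : ℕ} {h : C2 → ℂ},
    IsSchwartzOn K h → Dec N K h := by
  have base : ∀ {h : C2 → ℂ}, IsSchwartzOn K h → Dec0 K h := by
    intro h hh
    refine ⟨hh.1.continuousOn, fun k => ?_⟩
    obtain ⟨M0, h0⟩ := hh.2 0 0
    obtain ⟨M, hM⟩ := hh.2 k 0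
    refine ⟨2 ^ k * (M0 + M), fun z hz => ?_⟩
    have e0 := h0 z hz
    have e1 := hM z hz
    rw [norm_iteratedFDerivWithin_zero] at e0 e1
    rw [pow_zero, one_mul] at e0
    calc (1 + ‖z‖) ^ k * ‖h z‖ ≤ (2 ^ k * (1 + ‖z‖ ^ k)) * ‖h z‖ := by
          gcongr; exact one_add_pow_le (norm_nonneg z) k
      _ = 2 ^ k * (‖h z‖ + ‖z‖ ^ k * ‖h z‖) := by ring
      _ ≤ _ := by gcongr
  intro N
  induction N with
  | zero => exact base
  | succ N ih => exact fun hh => ⟨base hh, hh.1.differentiableOn (by simp), fun v => ih (hh.pd hK v)⟩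

theorem dec_of_hasCompactSupport : ∀ {N : ℕ} {h : E → ℂ}, ContDiff ℝ ∞ h → HasCompactSupport h →
    Dec N Set.univ h := by
  have base : ∀ {h : E → ℂ}, ContDiff ℝ ∞ h → HasCompactSupport h → Dec0 Set.univ h := by
    intro h hh hc
    refine ⟨hh.continuous.continuousOn, fun k => ?_⟩
    obtain ⟨M, hM⟩ := (hc.mul_left (f := fun z => (((1 + ‖z‖) ^ k : ℝ) : ℂ))).exists_bound_of_continuous
      ((Complex.continuous_ofReal.comp (by fun_prop)).mul hh.continuous)
    refine ⟨M, fun z _ => ?_⟩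
    have := hM z
    rwa [Pi.mul_apply, norm_mul, Complex.norm_real, Real.norm_eq_abs, abs_of_nonneg (by positivity)]
      at this
  intro N
  induction N with
  | zero => exact base
  | succ N ih =>
    intro h hh hc
    refine ⟨base hh hc, (hh.differentiable (by simp)).differentiableOn, fun v => ?_⟩
    have e : pd Set.univ v h = fun z => fderiv ℝ h z v := by
      funext z; simp [DbarNeumann.pd]
    rw [e]
    exact ih ((hh.fderiv_right (m := ∞) (by simp)).clm_apply contDiff_const) (hc.fderiv_apply ℝ v)

/-- Because `L` is bounded below, decay in `L z` is decay in `z`. This serves to restrict functions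
to the edge `y = 0`. -/
theorem Dec.comp_clm {F : Type*} [NormedAddCommGroup F] [NormedSpace ℝ F] {K' : Set F}
    (hK' : UniqueDiffOn ℝ K') {L : F →L[ℝ] E} (m : Set.MapsTo L K' K)
    {C : ℝ} (hL : ∀ z, ‖z‖ ≤ C * ‖L z‖) : ∀ {N : ℕ} {h : E → ℂ}, Dec N K h →
    Dec N K' (fun z => h (L z))
  | 0, h, hh => by
    refine ⟨hh.1.comp L.continuous.continuousOn m, fun k => ?_⟩
    obtain ⟨M, hM⟩ := hh.2 k
    refine ⟨(1 + |C|) ^ k * M, fun z hz => ?_⟩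
    have h1 : 1 + ‖z‖ ≤ (1 + |C|) * (1 + ‖L z‖) := by
      have := hL z
      have h2 : C * ‖L z‖ ≤ |C| * ‖L z‖ := by gcongr; exact le_abs_self C
      nlinarith [abs_nonneg C, norm_nonneg (L z)]
    calc (1 + ‖z‖) ^ k * ‖h (L z)‖ ≤ ((1 + |C|) * (1 + ‖L z‖)) ^ k * ‖h (L z)‖ := by gcongr
      _ = (1 + |C|) ^ k * ((1 + ‖L z‖) ^ k * ‖h (L z)‖) := by rw [mul_pow]; ring
      _ ≤ _ := by gcongr; exact hM _ (m hz)
  | N + 1, h, hh => by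
    refine Dec.of_hasFDerivWithinAt hK' (Dec.comp_clm (N := 0) hK' m hL hh.1)
      (fun z => (fderivWithin ℝ h K (L z)).comp L)
      (fun z hz => (hh.2.1 _ (m hz)).hasFDerivWithinAt.comp z L.hasFDerivWithinAt m) fun v => ?_
    exact Dec.comp_clm hK' m hL (hh.2.2 (L v))

theorem contDiff_top_of_dec [FiniteDimensional ℝ E] (hh : ∀ N, Dec N Set.univ h) : ContDiff ℝ ∞ h :=
  contDiff_infty.2 fun N => contDiffOn_univ.1 (hh N).contDiffOn

/-- The total derivative is a finite combination of the coordinate derivatives, which belong to the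
same class; so the estimate passes from order `n` to order `n + 1`. -/
theorem dec_norm_iteratedFDeriv {ι : Type*} [Fintype ι] (n : ℕ) :
    ∀ {h : EuclideanSpace ℝ ι → ℂ}, (∀ N, Dec N Set.univ h) → ∀ k : ℕ,
    ∃ M : ℝ, ∀ z, ‖z‖ ^ k * ‖iteratedFDeriv ℝ n h z‖ ≤ M := by
  classical
  induction n with
  | zero =>
    intro h hh k
    obtain ⟨M, hM⟩ := (hh 0).2 k
    refine ⟨M, fun z => ?_⟩
    rw [norm_iteratedFDeriv_zero]
    refine le_trans ?_ (hM z (Set.mem_univ z))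
    gcongr
    linarith
  | succ n ih =>
    intro h hh k
    have hd := fun i => ih (h := pd Set.univ (EuclideanSpace.single i 1) h)
      (fun N => (hh (N + 1)).pd _) k
    choose M hM using hd
    set Λ : ι → ℂ →L[ℝ] (EuclideanSpace ℝ ι →L[ℝ] ℂ) := fun i =>
      ContinuousLinearMap.smulRightL ℝ (EuclideanSpace ℝ ι) ℂ (EuclideanSpace.proj i) with hΛ
    have hsm : ∀ i, ContDiff ℝ ∞ (pd Set.univ (EuclideanSpace.single i 1) h) := fun i =>
      contDiff_top_of_dec fun N => (hh (N + 1)).pd _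
    have e : fderiv ℝ h = fun z => ∑ i, Λ i (pd Set.univ (EuclideanSpace.single i 1) h z) := by
      funext z
      ext v
      have hv : v = ∑ i, v i • EuclideanSpace.single i (1 : ℝ) := by
        have := ((EuclideanSpace.basisFun ι ℝ).sum_repr v).symm
        simpa using this
      conv_lhs => rw [hv, map_sum]
      simp [hΛ, pd]
    refine ⟨∑ i, ‖Λ i‖ * M i, fun z => ?_⟩
    rw [← norm_iteratedFDeriv_fderiv, e, iteratedFDeriv_fun_sum_apply
      (f := fun i z => Λ i (pd Set.univ (EuclideanSpace.single i 1) h z)) fun i _ =>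
      ((Λ i).contDiff.comp (contDiff_infty.1 (hsm i) n)).contDiffAt]
    calc ‖z‖ ^ k * ‖∑ i, iteratedFDeriv ℝ n
          (fun z => Λ i (pd Set.univ (EuclideanSpace.single i 1) h z)) z‖
        ≤ ‖z‖ ^ k * ∑ i, ‖Λ i‖ * ‖iteratedFDeriv ℝ n (pd Set.univ (EuclideanSpace.single i 1) h) z‖ := by
          gcongr
          refine (norm_sum_le _ _).trans (Finset.sum_le_sum fun i _ => ?_)
          exact (Λ i).norm_iteratedFDeriv_comp_left (contDiff_infty.1 (hsm i) n).contDiffAt le_rfl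
      _ = ∑ i, ‖Λ i‖ * (‖z‖ ^ k *
            ‖iteratedFDeriv ℝ n (pd Set.univ (EuclideanSpace.single i 1) h) z‖) := by
          rw [Finset.mul_sum]
          exact Finset.sum_congr rfl fun i _ => by ring
      _ ≤ _ := by
          gcongr with i
          exact hM i z

/-- A function all of whose derivatives are rapidly decaying is a Schwartz function. -/
noncomputable def toSchwartz {ι : Type*} [Fintype ι] (h : EuclideanSpace ℝ ι → ℂ)
    (hh : ∀ N, Dec N Set.univ h) : 𝓢(EuclideanSpace ℝ ι, ℂ) where
  toFun := h
  smooth' := contDiff_top_of_dec hh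
  decay' k n := dec_norm_iteratedFDeriv n hh k

theorem Flat.union {T : Set E} : ∀ {M : ℕ} {h : E → ℂ}, Flat K S M h → Flat K T M h →
    Flat K (S ∪ T) M h
  | 0, _, _, _ => trivial
  | _ + 1, _, h1, h2 => ⟨fun z hz => hz.elim (h1.1 z) (h2.1 z), fun v => (h1.2 v).union (h2.2 v)⟩

/-- At a frontier point the derivative within `K` is zero, and so is that of the zero function on
the complement; the two one-sided derivatives glue. -/
theorem hasFDerivAt_indicator (hK : IsClosed K) (hh : DifferentiableOn ℝ h K)
    (h0 : ∀ z ∈ frontier K, h z = 0) (h1 : ∀ z ∈ frontier K, fderivWithin ℝ h K z = 0) (z : E) :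
    HasFDerivAt (K.indicator h) (K.indicator (fderivWithin ℝ h K) z) z := by
  by_cases hz : z ∈ K
  · rw [Set.indicator_of_mem hz]
    have hin : HasFDerivWithinAt (K.indicator h) (fderivWithin ℝ h K z) K z :=
      (hh z hz).hasFDerivWithinAt.congr (fun w hw => Set.indicator_of_mem hw h)
        (Set.indicator_of_mem hz h)
    by_cases hi : z ∈ interior K
    · exact hin.hasFDerivAt (mem_interior_iff_mem_nhds.1 hi)
    · have hf : z ∈ frontier K := by rw [hK.frontier_eq]; exact ⟨hz, hi⟩
      rw [← hasFDerivWithinAt_univ, ← Set.union_compl_self K]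
      refine hin.union ?_
      rw [h1 z hf]
      refine (hasFDerivWithinAt_const (0 : ℂ) z Kᶜ).congr (fun w hw =>
        Set.indicator_of_notMem hw h) ?_
      rw [Set.indicator_of_mem hz, h0 z hf]
  · rw [Set.indicator_of_notMem hz]
    refine (hasFDerivAt_const (0 : ℂ) z).congr_of_eventuallyEq ?_
    filter_upwards [hK.isOpen_compl.mem_nhds hz] with w hw
    exact Set.indicator_of_notMem hw h

/-- The extension by zero of a function which is flat at the boundary. -/
theorem Dec.indicator (hK : IsClosed K) (hS : frontier K ⊆ S) : ∀ {N : ℕ} {h : E → ℂ}, Dec N K h →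
    Flat K S (N + 1) h → Dec N Set.univ (K.indicator h) := by
  have base : ∀ {h : E → ℂ}, Dec0 K h → (∀ z ∈ S, h z = 0) → Dec0 Set.univ (K.indicator h) := by
    intro h hh h0
    refine ⟨(continuous_indicator (fun z hz => h0 z (hS hz)) (by
      rw [hK.closure_eq]; exact hh.1)).continuousOn, fun k => ?_⟩
    obtain ⟨M, hM0, hM⟩ := hh.bound k
    refine ⟨M, fun z _ => ?_⟩
    by_cases hz : z ∈ K
    · rw [Set.indicator_of_mem hz]; exact hM z hz
    · rw [Set.indicator_of_notMem hz]; simpa using hM0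
  intro N
  induction N with
  -- Flatness of order `N + 1` means that the derivatives up to order `N` vanish. Already for `N =
  -- 0` the values must vanish, for the extension to be continuous.
  | zero => exact fun hh hf => base hh hf.1
  | succ N ih =>
    intro h hh hf
    have hfd := hasFDerivAt_indicator hK hh.2.1 (fun z hz => hf.1 z (hS hz)) fun z hz => by
      ext v
      exact (hf.2 v).1 z (hS hz)
    refine ⟨base hh.1 hf.1, fun z _ => (hfd z).differentiableAt.differentiableWithinAt, fun v => ?_⟩
    refine (ih (hh.2.2 v) (hf.2 v)).congr fun z _ => ?_
    simp only [DbarNeumann.pd, fderivWithin_univ, (hfd z).fderiv]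
    by_cases hz : z ∈ K
    · rw [Set.indicator_of_mem hz, Set.indicator_of_mem hz]; rfl
    · rw [Set.indicator_of_notMem hz, Set.indicator_of_notMem hz]; rfl

end Conversion


/-! ### Cut-off monomials -/

section Cutoff

/-- A cutoff of the line, equal to `1` on `[-1, 1]`. -/
noncomputable def cut (τ : ℝ) : ℝ := 1 - step (τ ^ 2)

theorem contDiff_cut : ContDiff ℝ ∞ cut :=
  contDiff_const.sub (contDiff_step.comp (contDiff_id.pow 2))

theorem cut_eq_one {τ : ℝ} (h : |τ| ≤ 1) : cut τ = 1 := by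
  rw [cut, step_eq_zero (by rw [← sq_abs]; exact pow_le_one₀ (abs_nonneg τ) h), sub_zero]

theorem hasCompactSupport_cut : HasCompactSupport cut := by
  refine HasCompactSupport.of_support_subset_isCompact (isCompact_Icc (a := (-2 : ℝ)) (b := 2)) ?_
  intro τ hτ
  by_contra h
  refine hτ ?_
  rw [cut, step_eq_one ?_, sub_self]
  rw [Set.mem_Icc, ← abs_le, not_le] at h
  rw [← sq_abs]
  nlinarith

/-- The negative of the normalized monomial of degree `k + 2`, cut off. -/
noncomputable def negMono (k : ℕ) (τ : ℝ) : ℂ :=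
  ((cut τ * -(τ ^ (k + 2) / (k + 2).factorial) : ℝ) : ℂ)

theorem contDiff_negMono (k : ℕ) : ContDiff ℝ ∞ (negMono k) :=
  Complex.ofRealCLM.contDiff.comp (contDiff_cut.mul ((contDiff_id.pow _).div_const _).neg)

theorem hasCompactSupport_negMono (k : ℕ) : HasCompactSupport (negMono k) := by
  have h : HasCompactSupport fun τ => cut τ * -(τ ^ (k + 2) / (k + 2).factorial) :=
    hasCompactSupport_cut.mul_right
  exact h.comp_left (g := fun x : ℝ => (x : ℂ)) Complex.ofReal_zero

theorem negMono_zero (k : ℕ) : negMono k 0 = 0 := by simp [negMono]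

/-- The cutoff is one near the origin, so the Taylor polynomial there is that of the monomial alone,
`-τ^(k+2)/(k+2)!`. -/
theorem iteratedDeriv_negMono_zero (k a : ℕ) (ha : a ≤ k + 2) :
    iteratedDeriv a (negMono k) 0 = if a = k + 2 then -1 else 0 := by
  have e : negMono k =ᶠ[𝓝 0] fun τ : ℝ => -((k + 2).factorial : ℂ)⁻¹ * (τ : ℂ) ^ (k + 2) := by
    filter_upwards [Icc_mem_nhds (show (-1 : ℝ) < 0 by norm_num) one_pos] with τ hτ
    rw [negMono, cut_eq_one (abs_le.2 hτ)]
    push_cast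
    ring
  have h : ∀ (m a : ℕ), a ≤ m → iteratedDeriv a (fun τ : ℝ => (τ : ℂ) ^ m) =
      fun τ : ℝ => (m.descFactorial a : ℂ) * (τ : ℂ) ^ (m - a) := by
    intro m a
    induction a with
    | zero => intro _; funext τ; simp
    | succ a ih =>
      intro h
      rw [iteratedDeriv_succ, ih (by omega)]
      funext τ
      have h1 : HasDerivAt (fun τ : ℝ => (τ : ℂ) ^ (m - a))
          (((m - a : ℕ) : ℂ) * (τ : ℂ) ^ (m - a - 1) * 1) τ :=
        (Complex.ofRealCLM.hasDerivAt (x := τ)).pow (m - a)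
      rw [(h1.const_mul _).deriv, Nat.descFactorial_succ, Nat.sub_sub]
      push_cast
      ring
  rw [e.iteratedDeriv_eq, iteratedDeriv_const_mul_field, h _ _ ha]
  rcases ha.eq_or_lt with rfl | hlt
  · simp only [Nat.sub_self, pow_zero, mul_one, if_true]
    rw [Nat.descFactorial_self, neg_mul, inv_mul_cancel₀]
    exact_mod_cast (Nat.factorial_pos _).ne'
  · rw [if_neg hlt.ne]
    simp [Nat.sub_ne_zero_of_lt hlt]

end Cutoff

/-! ### Flattening the residual at a face -/

section Flatten

/-- The closed domain. -/
abbrev KO : Set C2 := closure Omega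

/-- The face `y_j = 0`. -/
def face (j : Fin 2) : Set C2 := {z | z ∈ KO ∧ z (Sum.inr j) = 0}

/-- The coordinate `y_j`. -/
noncomputable def yc (j : Fin 2) : C2 →L[ℝ] ℝ := EuclideanSpace.proj (Sum.inr j)

/-- The projection onto the hyperplane `y_j = 0`. -/
noncomputable def py (j : Fin 2) : C2 →L[ℝ] C2 :=
  ContinuousLinearMap.id ℝ C2 - (yc j).smulRight (bv (Sum.inr j))

theorem yc_apply (j : Fin 2) (z : C2) : yc j z = z (Sum.inr j) := rfl

theorem py_apply (j : Fin 2) (z : C2) : py j z = z - z (Sum.inr j) • bv (Sum.inr j) := by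
  simp [py, yc_apply]

theorem py_coord (j : Fin 2) (z : C2) (i : Ix) :
    py j z i = if i = Sum.inr j then 0 else z i := by
  rw [py_apply]
  split_ifs with h
  · subst h; simp [bv]
  · simp [bv, h]

theorem py_mapsTo (j : Fin 2) : Set.MapsTo (py j) KO KO := by
  intro z hz
  rw [KO, closure_Omega] at hz ⊢
  intro k
  rw [py_coord]
  split_ifs
  · exact le_rfl
  · exact hz k

theorem py_mem_face (j : Fin 2) {z : C2} (hz : z ∈ KO) : py j z ∈ face j :=
  ⟨py_mapsTo j hz, by rw [py_coord, if_pos rfl]⟩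

theorem py_of_mem_face {j : Fin 2} {z : C2} (hz : z ∈ face j) : py j z = z := by
  rw [py_apply, hz.2, zero_smul, sub_zero]

theorem face_subset (j : Fin 2) : face j ⊆ KO := fun _ hz => hz.1

theorem norm_le_yc_py (j : Fin 2) (z : C2) : ‖z‖ ≤ ‖yc j z‖ + ‖py j z‖ := by
  have h : z = z (Sum.inr j) • bv (Sum.inr j) + py j z := by rw [py_apply]; abel
  calc ‖z‖ = ‖z (Sum.inr j) • bv (Sum.inr j) + py j z‖ := by rw [← h]
    _ ≤ _ := by
      refine (norm_add_le _ _).trans ?_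
      rw [norm_smul]
      simp [bv, yc_apply]

theorem yc_bv {j : Fin 2} {i : Ix} (hi : i ≠ Sum.inr j) : yc j (bv i) = 0 := by
  rw [yc_apply, bv]
  simp [hi.symm]

theorem yc_bv_self (j : Fin 2) : yc j (bv (Sum.inr j)) = 1 := by
  simp [yc_apply, bv]

theorem py_bv {j : Fin 2} {i : Ix} (hi : i ≠ Sum.inr j) : py j (bv i) = bv i := by
  have := yc_bv hi
  rw [yc_apply] at this
  rw [py_apply, this, zero_smul, sub_zero]

theorem py_bv_self (j : Fin 2) : py j (bv (Sum.inr j)) = 0 := by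
  have := yc_bv_self j
  rw [yc_apply] at this
  rw [py_apply, this, one_smul, sub_self]

variable {j : Fin 2} {θ : ℝ → ℂ} {h g R : C2 → ℂ}

theorem pd_normal_tensor (hθ : Differentiable ℝ θ) (hh : DifferentiableOn ℝ h KO) :
    Set.EqOn (pd KO (bv (Sum.inr j)) fun z => θ (yc j z) * h (py j z))
      (fun z => deriv θ (yc j z) * h (py j z)) KO := by
  intro z hz
  rw [pd_tensor uniqueDiffOn_closure_Omega (Set.mapsTo_univ _ _) (py_mapsTo j)
    hθ.differentiableOn hh _ hz, yc_bv_self, py_bv_self]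
  simp [pd]

theorem pd_tangential_tensor (hθ : Differentiable ℝ θ) (hh : DifferentiableOn ℝ h KO) {i : Ix}
    (hi : i ≠ Sum.inr j) :
    Set.EqOn (pd KO (bv i) fun z => θ (yc j z) * h (py j z))
      (fun z => θ (yc j z) * pd KO (bv i) h (py j z)) KO := by
  intro z hz
  rw [pd_tensor uniqueDiffOn_closure_Omega (Set.mapsTo_univ _ _) (py_mapsTo j)
    hθ.differentiableOn hh _ hz, yc_bv hi, py_bv hi]
  simp [pd]

/-- The Laplacian in the directions other than `y_j`. -/
noncomputable def tlap (j : Fin 2) (h : C2 → ℂ) : C2 → ℂ :=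
  fun z => ∑ i ∈ Finset.univ.erase (Sum.inr j), pd KO (bv i) (pd KO (bv i) h) z

theorem Dec.tlap {N : ℕ} (hh : Dec (N + 2) KO h) : Dec N KO (tlap j h) :=
  Dec.sum uniqueDiffOn_closure_Omega _ fun i _ => (hh.pd (bv i)).pd (bv i)

theorem contDiff_deriv_top {f : ℝ → ℂ} (hf : ContDiff ℝ ∞ f) : ContDiff ℝ ∞ (deriv f) :=
  (contDiff_infty_iff_deriv.1 hf).2

theorem lap_tensor_normal (hθ : ContDiff ℝ ∞ θ) (hh : Dec 2 KO h) :
    Set.EqOn (lap KO bv fun z => θ (yc j z) * h (py j z))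
      (fun z => deriv (deriv θ) (yc j z) * h (py j z) + θ (yc j z) * tlap j h (py j z)) KO := by
  intro z hz
  have d0 : Differentiable ℝ θ := hθ.differentiable (by simp)
  have d1 : Differentiable ℝ (deriv θ) := (contDiff_deriv_top hθ).differentiable (by simp)
  have dh : DifferentiableOn ℝ h KO := hh.differentiableOn
  simp only [lap, DbarNeumann.tlap]
  rw [← Finset.add_sum_erase _ _ (Finset.mem_univ (Sum.inr j : Ix)), Finset.mul_sum]
  congr 1
  · rw [pd_congr (pd_normal_tensor d0 dh) _ hz, pd_normal_tensor d1 dh hz]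
  · refine Finset.sum_congr rfl fun i hi => ?_
    have hi' := Finset.ne_of_mem_erase hi
    rw [pd_congr (pd_tangential_tensor d0 dh hi') _ hz,
      pd_tangential_tensor d0 (hh.pd (bv i)).differentiableOn hi' hz]

theorem iterate_pd_congr {v : C2} (e : Set.EqOn g h KO) (a : ℕ) :
    Set.EqOn ((pd KO v)^[a] g) ((pd KO v)^[a] h) KO := by
  induction a generalizing g h with
  | zero => exact e
  | succ a ih => exact ih (pd_congr e v)

theorem dec_iterate_pd {v : C2} {N a : ℕ} (hh : Dec (N + a) KO h) : Dec N KO ((pd KO v)^[a] h) := by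
  induction a generalizing h with
  | zero => exact hh
  | succ a ih => exact ih (hh.pd v)

theorem flat_iterate_pd {S : Set C2} {v : C2} {N a : ℕ} (hh : Flat KO S (N + a) h) :
    Flat KO S N ((pd KO v)^[a] h) := by
  induction a generalizing h with
  | zero => exact hh
  | succ a ih => exact ih (hh.2 v)

theorem iterate_pd_add {v : C2} {a : ℕ} (h1 : Dec a KO g) (h2 : Dec a KO h) :
    Set.EqOn ((pd KO v)^[a] fun z => g z + h z)
      (fun z => (pd KO v)^[a] g z + (pd KO v)^[a] h z) KO := by
  induction a generalizing g h with
  | zero => exact fun _ _ => rfl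
  | succ a ih =>
    intro z hz
    rw [Function.iterate_succ_apply, iterate_pd_congr (pd_add uniqueDiffOn_closure_Omega
      h1.differentiableOn h2.differentiableOn v) a hz, ih (h1.pd v) (h2.pd v) hz]
    rfl

theorem iterate_pd_tensor (hθ : ContDiff ℝ ∞ θ) (hh : Dec 1 KO h) (a : ℕ) :
    Set.EqOn ((pd KO (bv (Sum.inr j)))^[a] fun z => θ (yc j z) * h (py j z))
      (fun z => iteratedDeriv a θ (yc j z) * h (py j z)) KO := by
  induction a generalizing θ with
  | zero => intro z _; simp
  | succ a ih =>
    intro z hz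
    rw [Function.iterate_succ_apply, iterate_pd_congr (pd_normal_tensor
      (hθ.differentiable (by simp)) hh.differentiableOn) a hz, ih (contDiff_deriv_top hθ) hz,
      iteratedDeriv_succ']

theorem iterate_pd_comm {v w : C2} {a : ℕ} (hh : Dec (a + 1) KO h) :
    Set.EqOn ((pd KO w)^[a] (pd KO v h)) (pd KO v ((pd KO w)^[a] h)) KO := by
  induction a generalizing h with
  | zero => exact fun _ _ => rfl
  | succ a ih =>
    intro z hz
    rw [Function.iterate_succ_apply, Function.iterate_succ_apply, ← ih (hh.pd w) hz]
    exact iterate_pd_congr (Dec.pd_comm uniqueDiffOn_closure_Omega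
      closure_Omega_subset_closure_interior (N := a) hh w v) a hz

/-- The normal derivatives of order less than `m` vanish on the face `y_j = 0`. -/
def NormalFlat (j : Fin 2) (m : ℕ) (R : C2 → ℂ) : Prop :=
  ∀ a < m, ∀ z ∈ face j, (pd KO (bv (Sum.inr j)))^[a] R z = 0

/-- The composition of `h` with the projection vanishes identically on the closed domain, hence so
does its derivative; at points of the face this is the tangential part of the derivative of `h`. -/
theorem fderivWithin_tangential (hd : DifferentiableOn ℝ h KO) (h0 : ∀ z ∈ face j, h z = 0) {z : C2}
    (hz : z ∈ face j) (v : C2) : fderivWithin ℝ h KO z (py j v) = 0 := by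
  have h1 : HasFDerivWithinAt (fun w => h (py j w)) ((fderivWithin ℝ h KO (py j z)).comp (py j))
      KO z := (hd _ (py_mapsTo j hz.1)).hasFDerivWithinAt.comp z (py j).hasFDerivWithinAt (py_mapsTo j)
  have h2 : HasFDerivWithinAt (fun w => h (py j w)) (0 : C2 →L[ℝ] ℂ) KO z :=
    (hasFDerivWithinAt_const (0 : ℂ) z KO).congr (fun w hw => h0 _ (py_mem_face j hw))
      (h0 _ (py_mem_face j hz.1))
  have h3 := (uniqueDiffOn_closure_Omega z hz.1).eq h1 h2
  rw [py_of_mem_face hz] at h3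
  exact DFunLike.congr_fun h3 v

/-- Normal derivatives suffice: tangential derivatives commute with them and preserve vanishing on
the face, and any direction is a tangential vector plus a multiple of the normal. -/
theorem NormalFlat.flat {m : ℕ} (hd : Dec m KO R) (hn : NormalFlat j m R) :
    Flat KO (face j) m R := by
  induction m generalizing R with
  | zero => trivial
  | succ m ih =>
    refine ⟨hn 0 (by omega), fun v => ih (hd.pd v) fun a ha z hz => ?_⟩
    rw [iterate_pd_comm (hd.mono (by omega)) hz.1]
    have hda : Dec 1 KO ((pd KO (bv (Sum.inr j)))^[a] R) :=
      dec_iterate_pd (hd.mono (by omega))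
    have hv : v = py j v + v (Sum.inr j) • bv (Sum.inr j) := by rw [py_apply]; abel
    show fderivWithin ℝ _ KO z v = 0
    rw [hv, map_add, fderivWithin_tangential hda.differentiableOn (hn a (by omega)) hz v, zero_add,
      map_smul]
    have := hn (a + 1) (by omega) z hz
    rw [Function.iterate_succ_apply'] at this
    rw [show fderivWithin ℝ ((pd KO (bv (Sum.inr j)))^[a] R) KO z (bv (Sum.inr j)) = 0 from this,
      smul_zero]

/-- The corrector removing the normal derivative of order `k` of `R`. -/
noncomputable def corr (j : Fin 2) (R : C2 → ℂ) (k : ℕ) : C2 → ℂ :=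
  fun z => negMono k (yc j z) * (pd KO (bv (Sum.inr j)))^[k] R (py j z)

theorem dec_normal_tensor {N : ℕ} (hθ : ContDiff ℝ ∞ θ) (hc : HasCompactSupport θ)
    (hh : Dec N KO h) : Dec N KO fun z => θ (yc j z) * h (py j z) :=
  Dec.tensor uniqueDiffOn_closure_Omega (Set.mapsTo_univ _ _) (py_mapsTo j) (norm_le_yc_py j)
    (dec_of_hasCompactSupport hθ hc) hh

theorem dec_corr {N k : ℕ} (hR : Dec (N + k) KO R) : Dec N KO (corr j R k) :=
  dec_normal_tensor (contDiff_negMono k) (hasCompactSupport_negMono k) (dec_iterate_pd hR)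

theorem flat_corr {S : Set C2} (hS : S ⊆ KO) (hpS : Set.MapsTo (py j) S S) {N k : ℕ}
    (hR : Dec (N + k) KO R) (hf : Flat KO S (N + k) R) : Flat KO S N (corr j R k) :=
  Flat.tensor_right uniqueDiffOn_closure_Omega hS (Set.mapsTo_univ _ _) (py_mapsTo j)
    (norm_le_yc_py j) hpS
    (dec_of_hasCompactSupport (contDiff_negMono k) (hasCompactSupport_negMono k))
    (dec_iterate_pd hR) (flat_iterate_pd hf)

theorem corr_eq_zero {k : ℕ} {z : C2} (hz : z ∈ face j) : corr j R k z = 0 := by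
  rw [corr, yc_apply, hz.2, negMono_zero, zero_mul]

theorem corr_eq_zero_of_flat {S : Set C2} {k : ℕ} (hf : Flat KO S (1 + k) R) {z : C2}
    (hz : py j z ∈ S) : corr j R k z = 0 := by
  have := (flat_iterate_pd (v := bv (Sum.inr j)) hf).1 _ hz
  rw [corr, this, mul_zero]

/-- Near the face the second normal derivative of the corrector is `-τ^k / k!` times the `k`-th
normal derivative of `R` on the face; it cancels the normal derivative of order `k` and leaves the
lower ones alone. The tangential part of the Laplacian carries `τ^(k+2)` and does not interfere. -/
theorem NormalFlat.step {k : ℕ} (hR : Dec (2 * k + 3) KO R) (hn : NormalFlat j k R) :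
    NormalFlat j (k + 1) fun z => R z + lap KO bv (corr j R k) z := by
  intro a ha z hz
  have ha' : a ≤ k := by omega
  set g := (pd KO (bv (Sum.inr j)))^[k] R with hgdef
  have hg : Dec (a + 1 + 2) KO g := dec_iterate_pd (hR.mono (by omega))
  have hm : ContDiff ℝ ∞ (negMono k) := contDiff_negMono k
  have hm2 : ContDiff ℝ ∞ (deriv (deriv (negMono k))) := contDiff_deriv_top (contDiff_deriv_top hm)
  have d1 : Dec a KO fun z => deriv (deriv (negMono k)) (yc j z) * g (py j z) :=
    dec_normal_tensor hm2 (hasCompactSupport_negMono k).deriv.deriv (hg.mono (by omega))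
  have d2 : Dec a KO fun z => negMono k (yc j z) * tlap j g (py j z) :=
    dec_normal_tensor hm (hasCompactSupport_negMono k) hg.tlap.succ
  have e1 : Set.EqOn (fun z => R z + lap KO bv (corr j R k) z) (fun z => R z +
      (deriv (deriv (negMono k)) (yc j z) * g (py j z) + negMono k (yc j z) * tlap j g (py j z)))
      KO := fun w hw => by
    simp only []
    rw [show corr j R k = fun z => negMono k (yc j z) * g (py j z) from rfl,
      lap_tensor_normal hm (hg.mono (by omega)) hw]
  have e2 := iterate_pd_add (v := bv (Sum.inr j)) (hR.mono (by omega : a ≤ 2 * k + 3))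
    (d1.add uniqueDiffOn_closure_Omega d2) hz.1
  have e3 := iterate_pd_add (v := bv (Sum.inr j)) d1 d2 hz.1
  have e4 := iterate_pd_tensor (j := j) hm2 (hg.mono (by omega)) a hz.1
  have e5 : (pd KO (bv (Sum.inr j)))^[a] (fun z => negMono k (yc j z) * tlap j g (py j z)) z =
      iteratedDeriv a (negMono k) (yc j z) * tlap j g (py j z) :=
    iterate_pd_tensor hm (hg.tlap.mono (by omega)) a hz.1
  rw [iterate_pd_congr e1 a hz.1]
  simp only [] at e2 e3 e4
  rw [e2, e3, e4, e5, yc_apply, hz.2, py_of_mem_face hz, ← iteratedDeriv_succ', ← iteratedDeriv_succ',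
    iteratedDeriv_negMono_zero _ _ (by omega), iteratedDeriv_negMono_zero _ _ (by omega)]
  rcases ha'.eq_or_lt with rfl | hlt
  · simp [hgdef]
  · rw [hn a hlt z hz, if_neg (by omega), if_neg (by omega)]
    simp

/-- The residual after removing the normal derivatives of order less than `m`. -/
noncomputable def resid (j : Fin 2) (R : C2 → ℂ) : ℕ → C2 → ℂ
  | 0 => R
  | m + 1 => fun z => resid j R m z + lap KO bv (corr j (resid j R m) m) z

/-- The sum of the correctors removing the normal derivatives of order less than `m`. -/
noncomputable def corrSum (j : Fin 2) (R : C2 → ℂ) (m : ℕ) : C2 → ℂ :=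
  fun z => ∑ k ∈ Finset.range m, corr j (resid j R k) k z

/-- The number of derivatives used up by `resid`. -/
def bud : ℕ → ℕ
  | 0 => 0
  -- Step `m` differentiates `m` times in the normal direction to form the corrector, and twice for
  -- the Laplacian.
  | m + 1 => bud m + (m + 2)

theorem bud_le {k m : ℕ} (h : k < m) : bud k + (k + 2) ≤ bud m := by
  induction m, h using Nat.le_induction with
  | base => exact le_rfl
  | succ m _ ih => simp only [bud]; omega

theorem dec_resid {N : ℕ} : ∀ {m : ℕ}, Dec (N + bud m) KO R → Dec N KO (resid j R m) := by
  intro m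
  induction m generalizing N with
  | zero => exact fun h => h
  | succ m ih =>
    intro h
    have h1 : Dec (N + (m + 2)) KO (resid j R m) :=
      ih (by rw [show N + (m + 2) + bud m = N + bud (m + 1) by simp only [bud]; ring]; exact h)
    refine Dec.add uniqueDiffOn_closure_Omega (h1.mono (by omega))
      (Dec.lap uniqueDiffOn_closure_Omega _ (dec_corr ?_))
    rwa [show N + 2 + m = N + (m + 2) by ring]

/-- The correctors see the residual at projected points only, so flatness survives on any set that
is stable under the projection. This protects the corner or the other face while one face is
treated. -/
theorem flat_resid {S : Set C2} (hS : S ⊆ KO) (hpS : Set.MapsTo (py j) S S) {N : ℕ} :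
    ∀ {m : ℕ}, Dec (N + bud m) KO R → Flat KO S (N + bud m) R → Flat KO S N (resid j R m) := by
  intro m
  induction m generalizing N with
  | zero => exact fun _ h => h
  | succ m ih =>
    intro hd hf
    have e : N + (m + 2) + bud m = N + bud (m + 1) := by simp only [bud]; ring
    have e2 : N + 2 + m = N + (m + 2) := by ring
    have h1 : Dec (N + (m + 2)) KO (resid j R m) := dec_resid (by rwa [e])
    have h2 : Flat KO S (N + (m + 2)) (resid j R m) := ih (by rwa [e]) (by rwa [e])
    have h3 : Dec (N + 2) KO (corr j (resid j R m) m) := dec_corr (by rwa [e2])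
    exact Flat.add uniqueDiffOn_closure_Omega hS (h2.mono (by omega))
      (Flat.lap uniqueDiffOn_closure_Omega hS _ h3
        (flat_corr hS hpS (by rwa [e2]) (by rwa [e2])))
      (h1.mono (by omega)) (Dec.lap uniqueDiffOn_closure_Omega _ h3)

theorem dec_corrSum {N m : ℕ} (hR : Dec (N + bud m) KO R) : Dec N KO (corrSum j R m) :=
  Dec.sum uniqueDiffOn_closure_Omega _ fun k hk => by
    have := bud_le (Finset.mem_range.1 hk)
    exact dec_corr (dec_resid (hR.mono (by omega)))

theorem corrSum_eq_zero {m : ℕ} {z : C2} (hz : z ∈ face j) : corrSum j R m z = 0 :=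
  Finset.sum_eq_zero fun _ _ => corr_eq_zero hz

/-- The coefficient of each corrector is a normal derivative of a residual at the projected point,
where that residual is still flat. -/
theorem corrSum_eq_zero_of_flat {S : Set C2} (hS : S ⊆ KO) (hpS : Set.MapsTo (py j) S S) {m : ℕ}
    (hd : Dec (bud m) KO R) (hf : Flat KO S (bud m) R) {z : C2} (hz : py j z ∈ S) :
    corrSum j R m z = 0 :=
  Finset.sum_eq_zero fun k hk => by
    have := bud_le (Finset.mem_range.1 hk)
    exact corr_eq_zero_of_flat
      (flat_resid hS hpS (hd.mono (by omega)) (hf.mono (by omega))) hz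

theorem resid_eq {m : ℕ} (hR : Dec (2 + bud m) KO R) :
    Set.EqOn (resid j R m) (fun z => R z + lap KO bv (corrSum j R m) z) KO := by
  induction m with
  | zero =>
    intro z hz
    have h0 := lap_congr (K := KO) bv (h := fun _ => 0) (h' := fun z : C2 => corrSum j R 0 z)
      (fun w _ => by simp [corrSum]) hz
    have hp : ∀ v, pd KO v (fun _ : C2 => (0 : ℂ)) = fun _ => 0 := fun v => by
      funext z; simp [pd]
    have h1 : lap KO bv (fun _ : C2 => (0 : ℂ)) z = 0 := by simp [lap, hp]
    simp only [resid]
    rw [show lap KO bv (corrSum j R 0) z = 0 from h0.trans h1, add_zero]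
  | succ m ih =>
    intro z hz
    have hR' : Dec (2 + (m + 2) + bud m) KO R := hR.mono (by simp only [bud]; omega)
    have h1 : Dec 2 KO (corrSum j R m) := dec_corrSum (hR.mono (by simp only [bud]; omega))
    have h2 : Dec 2 KO (corr j (resid j R m) m) :=
      dec_corr ((dec_resid hR').mono (by omega))
    have h3 := lap_add uniqueDiffOn_closure_Omega bv h1.differentiableOn
      (fun v => (h1.pd v).differentiableOn) h2.differentiableOn
      (fun v => (h2.pd v).differentiableOn) hz
    have h4 : corrSum j R (m + 1) = fun z => corrSum j R m z + corr j (resid j R m) m z := by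
      funext z
      simp [corrSum, Finset.sum_range_succ]
    simp only [resid]
    rw [ih (hR.mono (by simp only [bud]; omega)) hz, h4, h3]
    ring

theorem normalFlat_resid {m : ℕ} : ∀ {k : ℕ}, k ≤ m → Dec (2 * m + bud m) KO R →
    NormalFlat j k (resid j R k) := by
  intro k
  induction k with
  | zero => intro _ _ a ha; omega
  | succ k ih =>
    intro hk hR
    have := bud_le (show k < m by omega)
    exact NormalFlat.step (dec_resid (hR.mono (by omega))) (ih (by omega) hR)

/-- The residual is flat at the face. -/
theorem flat_resid_face {m : ℕ} (hR : Dec (2 * m + bud m) KO R) :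
    Flat KO (face j) m (resid j R m) :=
  (normalFlat_resid le_rfl hR).flat (dec_resid (hR.mono (by omega)))

theorem py_mapsTo_face {j k : Fin 2} : Set.MapsTo (py j) (face k) (face k) := fun z hz =>
  ⟨py_mapsTo j hz.1, by rw [py_coord]; split_ifs; exacts [rfl, hz.2]⟩

theorem frontier_KO : frontier KO ⊆ face 0 ∪ face 1 := by
  intro z hz
  rw [isClosed_closure.frontier_eq, interior_closure_Omega] at hz
  obtain ⟨h1, h2⟩ := hz
  have h3 := h1
  rw [closure_Omega] at h3
  by_contra h
  refine h2 fun j => lt_of_le_of_ne (h3 j) fun e => h ?_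
  rcases (by fin_cases j <;> simp : j = 0 ∨ j = 1) with rfl | rfl
  · exact Or.inl ⟨h1, e.symm⟩
  · exact Or.inr ⟨h1, e.symm⟩

theorem lap_Omega_eq (h : C2 → ℂ) {z : C2} (hz : z ∈ Omega) : lap Omega bv h z = lap KO bv h z := by
  have h1 : z ∈ interior Omega := by rwa [isOpen_Omega.interior_eq]
  have h2 : z ∈ interior KO := by rwa [interior_closure_Omega]
  simp only [lap, pd_pd_eq_fderiv h1, pd_pd_eq_fderiv h2]

end Flatten


open scoped ComplexConjugate

/-! ### Powers and logarithms on the quarter-plane -/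

section Quadrant

/-- The closed quadrant of the plane. -/
def Kq : Set ℂ := {z | 0 ≤ z.re ∧ 0 ≤ z.im}

/-- The open quadrant of the plane. -/
def Uq : Set ℂ := {z | 0 < z.re ∧ 0 < z.im}

theorem isOpen_Uq : IsOpen Uq :=
  (isOpen_lt continuous_const Complex.continuous_re).inter
    (isOpen_lt continuous_const Complex.continuous_im)

theorem isClosed_Kq : IsClosed Kq :=
  (isClosed_le continuous_const Complex.continuous_re).inter
    (isClosed_le continuous_const Complex.continuous_im)

theorem Uq_subset : Uq ⊆ Kq := fun _ hz => ⟨hz.1.le, hz.2.le⟩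

theorem uniqueDiffOn_Kq : UniqueDiffOn ℝ Kq := by
  refine uniqueDiffOn_convex ?_ ⟨1 + Complex.I, mem_interior.2 ⟨Uq, Uq_subset, isOpen_Uq, ?_⟩⟩
  · have h1 : Convex ℝ {z : ℂ | 0 ≤ z.re} := convex_halfSpace_re_ge 0
    have h2 : Convex ℝ {z : ℂ | 0 ≤ z.im} := convex_halfSpace_im_ge 0
    exact h1.inter h2
  · simp [Uq]

theorem mem_slitPlane_of_mem_Kq {z : ℂ} (hz : z ∈ Kq) (h0 : z ≠ 0) : z ∈ Complex.slitPlane := by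
  rw [Complex.mem_slitPlane_iff]
  by_contra h
  push Not at h
  exact h0 (Complex.ext (le_antisymm h.1 hz.1) h.2)

theorem ne_zero_of_mem_Uq {z : ℂ} (hz : z ∈ Uq) : z ≠ 0 := by
  rintro rfl
  simp [Uq] at hz

/-- The function `z ^ a * conj z ^ b * (c₀ + c₁ log z + c₂ conj (log z))`. -/
noncomputable def ce (a b : ℤ) (c : ℂ × ℂ × ℂ) (z : ℂ) : ℂ :=
  z ^ a * conj z ^ b * (c.1 + c.2.1 * Complex.log z + c.2.2 * conj (Complex.log z))

/-- The action of `∂/∂z` on the coefficients of `ce`. -/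
noncomputable def ceA (a : ℤ) (c : ℂ × ℂ × ℂ) : ℂ × ℂ × ℂ :=
  (a * c.1 + c.2.1, a * c.2.1, a * c.2.2)

/-- The action of `∂/∂z̄` on the coefficients of `ce`. -/
noncomputable def ceB (b : ℤ) (c : ℂ × ℂ × ℂ) : ℂ × ℂ × ℂ :=
  (b * c.1 + c.2.2, b * c.2.1, b * c.2.2)

/-- The derivative of `ce`. -/
noncomputable def ceD (a b : ℤ) (c : ℂ × ℂ × ℂ) (z : ℂ) : ℂ →L[ℝ] ℂ :=
  ce (a - 1) b (ceA a c) z • ContinuousLinearMap.id ℝ ℂ +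
    ce a (b - 1) (ceB b c) z • (Complex.conjCLE : ℂ →L[ℝ] ℂ)

variable {a b : ℤ} {c : ℂ × ℂ × ℂ}

theorem ceD_apply (a b : ℤ) (c : ℂ × ℂ × ℂ) (z v : ℂ) : ceD a b c z v =
    v * ce (a - 1) b (ceA a c) z + conj v * ce a (b - 1) (ceB b c) z := by
  simp [ceD, mul_comm]

/-- Integer exponents keep the family closed under `∂/∂z` and `∂/∂z̄`: each lowers one exponent and
acts linearly on the three coefficients, even where an exponent becomes negative. -/
theorem hasFDerivAt_ce {z : ℂ} (hz : z ∈ Complex.slitPlane) :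
    HasFDerivAt (ce a b c) (ceD a b c z) z := by
  have h0 : z ≠ 0 := Complex.slitPlane_ne_zero hz
  have pw : ∀ n : ℤ, HasFDerivAt (fun z : ℂ => z ^ n)
      (((n : ℂ) * z ^ (n - 1)) • ContinuousLinearMap.id ℝ ℂ) z := fun n => by
    have := ((hasDerivAt_zpow n z (Or.inl h0)).hasFDerivAt).restrictScalars ℝ
    refine this.congr_fderiv ?_
    ext v
    simp [mul_comm]
  have lg : HasFDerivAt Complex.log (z⁻¹ • ContinuousLinearMap.id ℝ ℂ) z := by
    have := ((Complex.hasDerivAt_log hz).hasFDerivAt).restrictScalars ℝ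
    refine this.congr_fderiv ?_
    ext v
    simp [mul_comm]
  have cj : ∀ {f : ℂ → ℂ} {f' : ℂ →L[ℝ] ℂ}, HasFDerivAt f f' z →
      HasFDerivAt (fun z => conj (f z)) ((Complex.conjCLE : ℂ →L[ℝ] ℂ).comp f') z := fun hf =>
    (Complex.conjCLE : ℂ →L[ℝ] ℂ).hasFDerivAt.comp z hf
  have key := ((pw a).mul (cj (pw b))).mul
    (((hasFDerivAt_const c.1 z).add (lg.const_mul c.2.1)).add ((cj lg).const_mul c.2.2))
  refine (key.congr_of_eventuallyEq (Eventually.of_forall fun w => ?_)).congr_fderiv ?_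
  · simp [ce, map_zpow₀]
  · ext1 v
    have hc0 : conj z ≠ 0 := (map_ne_zero _).2 h0
    rw [ceD_apply]
    simp only [ce, ceA, ceB, zpow_sub_one₀ h0, zpow_sub_one₀ hc0]
    simp [map_zpow₀]
    ring

theorem ce_zero (h : 1 ≤ a + b) : ce a b c 0 = 0 := by
  have : a ≠ 0 ∨ b ≠ 0 := by omega
  rcases this with h | h <;> simp [ce, zero_zpow _ h]

/-- Total degree one already beats the logarithm: the powers contribute at most `‖z‖`, and the
logarithm at most `|log ‖z‖| + π`. -/
theorem norm_ce_le {z : ℂ} (h0 : z ≠ 0) (h1 : ‖z‖ ≤ 1) (h : 1 ≤ a + b) :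
    ‖ce a b c z‖ ≤ (‖c.1‖ + (‖c.2.1‖ + ‖c.2.2‖) * Real.pi) * ‖z‖ +
      (‖c.2.1‖ + ‖c.2.2‖) * |‖z‖ * Real.log ‖z‖| := by
  have hz : 0 < ‖z‖ := norm_pos_iff.2 h0
  have hl : ‖Complex.log z‖ ≤ |Real.log ‖z‖| + Real.pi := by
    refine (Complex.norm_le_abs_re_add_abs_im _).trans ?_
    rw [Complex.log_re, Complex.log_im]
    gcongr
    exact Complex.abs_arg_le_pi z
  have hp : ‖z‖ ^ (a + b) ≤ ‖z‖ := by
    calc ‖z‖ ^ (a + b) ≤ ‖z‖ ^ (1 : ℤ) := zpow_le_zpow_right_of_le_one₀ hz h1 h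
      _ = ‖z‖ := zpow_one _
  calc ‖ce a b c z‖ = ‖z‖ ^ (a + b) *
        ‖c.1 + c.2.1 * Complex.log z + c.2.2 * conj (Complex.log z)‖ := by
        rw [ce, norm_mul, norm_mul, norm_zpow, norm_zpow, RCLike.norm_conj, zpow_add₀ hz.ne']
    _ ≤ ‖z‖ * (‖c.1‖ + ‖c.2.1‖ * (|Real.log ‖z‖| + Real.pi) +
          ‖c.2.2‖ * (|Real.log ‖z‖| + Real.pi)) := by
        gcongr
        refine (norm_add_le _ _).trans (add_le_add ((norm_add_le _ _).trans (add_le_add le_rfl ?_)) ?_)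
        · rw [norm_mul]; gcongr
        · rw [norm_mul, RCLike.norm_conj]; gcongr
    _ = _ := by rw [abs_mul, abs_of_pos hz]; ring

theorem tendsto_ce_zero (h : 1 ≤ a + b) : Tendsto (ce a b c) (𝓝 0) (𝓝 0) := by
  set g : ℂ → ℝ := fun z => (‖c.1‖ + (‖c.2.1‖ + ‖c.2.2‖) * Real.pi) * ‖z‖ +
      (‖c.2.1‖ + ‖c.2.2‖) * |‖z‖ * Real.log ‖z‖| with hg
  have hgc : Continuous g := by
    have := Real.continuous_mul_log.comp (continuous_norm (E := ℂ))
    exact (continuous_const.mul continuous_norm).add (continuous_const.mul this.abs)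
  have hg0 : Tendsto g (𝓝 0) (𝓝 0) := by
    have := hgc.tendsto 0
    simpa [hg] using this
  refine squeeze_zero_norm' ?_ hg0
  filter_upwards [Metric.closedBall_mem_nhds (0 : ℂ) one_pos] with z hz
  by_cases h0 : z = 0
  · rw [h0, ce_zero h, norm_zero]
    simp [hg]
  · exact norm_ce_le h0 (by simpa using hz) h

/-- In total degree two a factor `z` splits off, and the remaining function of degree one tends to
zero; hence the function is `o(z)`, on all sides of the origin. -/
theorem hasFDerivAt_ce_zero (h : 2 ≤ a + b) : HasFDerivAt (ce a b c) (ceD a b c 0) 0 := by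
  have hD : ceD a b c 0 = 0 := by
    ext1 v
    rw [ceD_apply, ce_zero (by omega), ce_zero (by omega)]
    simp
  rw [hD, hasFDerivAt_iff_isLittleO_nhds_zero]
  have h1 : (fun z : ℂ => ce a b c (0 + z) - ce a b c 0 - (0 : ℂ →L[ℝ] ℂ) z) =
      fun z => ce (a - 1) b c z * z := by
    funext z
    rw [ce_zero (by omega), zero_add]
    simp only [zero_apply, sub_zero]
    by_cases h0 : z = 0
    · rw [h0, ce_zero (by omega), mul_zero]
    · simp only [ce, zpow_sub_one₀ h0]
      field_simp
  rw [h1]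
  have h2 : (fun z => ce (a - 1) b c z * z) =o[𝓝 0] fun z : ℂ => (1 : ℂ) * z :=
    ((Asymptotics.isLittleO_one_iff ℂ).2 (tendsto_ce_zero (by omega))).mul_isBigO
      (Asymptotics.isBigO_refl _ _)
  simpa using h2

theorem hasFDerivAt_ce' {z : ℂ} (hz : z ∈ Kq) (h : z ≠ 0 ∨ 2 ≤ a + b) :
    HasFDerivAt (ce a b c) (ceD a b c z) z := by
  by_cases h0 : z = 0
  · subst h0
    exact hasFDerivAt_ce_zero (h.resolve_left (by simp))
  · exact hasFDerivAt_ce (mem_slitPlane_of_mem_Kq hz h0)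

theorem continuousOn_ce (h : 1 ≤ a + b) : ContinuousOn (ce a b c) Kq := by
  intro z hz
  by_cases h0 : z = 0
  · subst h0
    refine ContinuousAt.continuousWithinAt ?_
    show Tendsto _ _ _
    rw [ce_zero h]
    exact tendsto_ce_zero h
  · exact (hasFDerivAt_ce (mem_slitPlane_of_mem_Kq hz h0)).continuousAt.continuousWithinAt

variable {χ : ℂ → ℂ}

theorem hasFDerivAt_cut_ce (hχ : ContDiff ℝ ∞ χ) {z : ℂ} (hz : z ∈ Kq)
    (h : z ≠ 0 ∨ 2 ≤ a + b) : HasFDerivAt (fun z => χ z * ce a b c z)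
      (χ z • ceD a b c z + ce a b c z • fderiv ℝ χ z) z :=
  ((hχ.differentiable (by simp)) z).hasFDerivAt.mul (hasFDerivAt_ce' hz h)

theorem pd_cut_ce {K : Set ℂ} (hK : UniqueDiffOn ℝ K) (hKq : K ⊆ Kq) (hχ : ContDiff ℝ ∞ χ)
    (h : ∀ z ∈ K, z ≠ 0 ∨ 2 ≤ a + b) (v : ℂ) :
    Set.EqOn (pd K v fun z => χ z * ce a b c z)
      (fun z => fderiv ℝ χ z v * ce a b c z + (v * (χ z * ce (a - 1) b (ceA a c) z) +
        conj v * (χ z * ce a (b - 1) (ceB b c) z))) K := by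
  intro z hz
  simp only [pd]
  rw [(hasFDerivAt_cut_ce hχ (hKq hz) (h z hz)).hasFDerivWithinAt.fderivWithin (hK z hz)]
  simp only [add_apply, smul_apply, ceD_apply, smul_eq_mul]
  ring

theorem contDiff_fderiv_apply (hχ : ContDiff ℝ ∞ χ) (v : ℂ) : ContDiff ℝ ∞ fun z => fderiv ℝ χ z v :=
  (hχ.fderiv_right (m := ∞) (by simp)).clm_apply contDiff_const

/-- A derivative either falls on the cutoff or lowers the total degree by one; after `N` of them
degree at least one is left, which ensures continuity at the origin. -/
theorem dec_cut_ce : ∀ {N : ℕ} {χ : ℂ → ℂ} {a b : ℤ} {c : ℂ × ℂ × ℂ}, ContDiff ℝ ∞ χ →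
    HasCompactSupport χ → (N : ℤ) + 1 ≤ a + b → Dec N Kq fun z => χ z * ce a b c z := by
  have base : ∀ {χ : ℂ → ℂ} {a b : ℤ} {c : ℂ × ℂ × ℂ}, ContDiff ℝ ∞ χ →
      HasCompactSupport χ → 1 ≤ a + b → Dec0 Kq fun z => χ z * ce a b c z := by
    intro χ a b c hχ hc h
    have hcont : ContinuousOn (fun z => χ z * ce a b c z) Kq :=
      hχ.continuous.continuousOn.mul (continuousOn_ce h)
    refine ⟨hcont, fun k => ?_⟩
    have hcomp : IsCompact (tsupport χ ∩ Kq) := IsCompact.inter_right hc isClosed_Kq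
    obtain ⟨M, hM⟩ := hcomp.exists_bound_of_continuousOn
      (f := fun z => ((1 + ‖z‖) ^ k : ℝ) • (χ z * ce a b c z))
      ((by fun_prop : Continuous fun z : ℂ => (1 + ‖z‖) ^ k).continuousOn.smul
        (hcont.mono Set.inter_subset_right))
    refine ⟨max M 0, fun z hz => ?_⟩
    by_cases hs : z ∈ tsupport χ
    · refine le_trans (le_of_eq ?_) ((hM z ⟨hs, hz⟩).trans (le_max_left _ _))
      rw [norm_smul, Real.norm_eq_abs, abs_of_nonneg (by positivity)]
    · simp [image_eq_zero_of_notMem_tsupport hs]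
  intro N
  induction N with
  | zero => intro χ a b c hχ hc h; exact base hχ hc (by simpa using h)
  | succ N ih =>
    intro χ a b c hχ hc h
    push_cast at h
    refine ⟨base hχ hc (by omega), fun z hz => (hasFDerivAt_cut_ce hχ hz
      (Or.inr (by omega))).differentiableAt.differentiableWithinAt, fun v => ?_⟩
    refine Dec.congr ?_ (pd_cut_ce uniqueDiffOn_Kq subset_rfl hχ (fun _ _ => Or.inr (by omega)) v)
    exact (ih (contDiff_fderiv_apply hχ v) (hc.fderiv_apply ℝ v) (by omega)).add uniqueDiffOn_Kq
      (((ih hχ hc (by omega)).const_mul uniqueDiffOn_Kq v).add uniqueDiffOn_Kq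
        ((ih hχ hc (by omega)).const_mul uniqueDiffOn_Kq _))

theorem zero_mem_Kq : ({0} : Set ℂ) ⊆ Kq := by
  rintro z rfl
  simp [Kq]

theorem flat_cut_ce : ∀ {M : ℕ} {χ : ℂ → ℂ} {a b : ℤ} {c : ℂ × ℂ × ℂ}, ContDiff ℝ ∞ χ →
    HasCompactSupport χ → (M : ℤ) + 1 ≤ a + b → Flat Kq {0} M fun z => χ z * ce a b c z := by
  intro M
  induction M with
  | zero => intro χ a b c _ _ _; trivial
  | succ M ih =>
    intro χ a b c hχ hc h
    push_cast at h
    refine ⟨fun z hz => ?_, fun v => ?_⟩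
    · rw [Set.mem_singleton_iff.1 hz]
      simp only []
      rw [ce_zero (by omega), mul_zero]
    refine Flat.congr zero_mem_Kq ?_
      (pd_cut_ce uniqueDiffOn_Kq subset_rfl hχ (fun _ _ => Or.inr (by omega)) v)
    have hχ' := contDiff_fderiv_apply hχ v
    have hc' := hc.fderiv_apply ℝ v
    have d1 : ∀ c, Dec M Kq fun z => v * (χ z * ce (a - 1) b c z) := fun c =>
      (dec_cut_ce hχ hc (by omega)).const_mul uniqueDiffOn_Kq v
    have d2 : ∀ c, Dec M Kq fun z => conj v * (χ z * ce a (b - 1) c z) := fun c =>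
      (dec_cut_ce hχ hc (by omega)).const_mul uniqueDiffOn_Kq _
    refine Flat.add uniqueDiffOn_Kq zero_mem_Kq (ih hχ' hc' (by omega)) (Flat.add uniqueDiffOn_Kq
      zero_mem_Kq ((ih hχ hc (by omega)).const_mul uniqueDiffOn_Kq zero_mem_Kq v
        (dec_cut_ce hχ hc (by omega)))
      ((ih hχ hc (by omega)).const_mul uniqueDiffOn_Kq zero_mem_Kq _ (dec_cut_ce hχ hc (by omega)))
      (d1 _) (d2 _)) (dec_cut_ce hχ' hc' (by omega)) ((d1 _).add uniqueDiffOn_Kq (d2 _))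

/-- Cutoffs vanishing near the origin are divisible by powers of `|z|²`. -/
theorem exists_cut_div (hχ : ContDiff ℝ ∞ χ) (hc : HasCompactSupport χ)
    (h0 : ∀ᶠ z in 𝓝 (0 : ℂ), χ z = 0) (J : ℕ) : ∃ ψ : ℂ → ℂ, ContDiff ℝ ∞ ψ ∧
      HasCompactSupport ψ ∧ ∀ a b c z, χ z * ce a b c z = ψ z * ce (a + J) (b + J) c z := by
  refine ⟨fun z => χ z * ((z * conj z) ^ J)⁻¹, ?_, hc.mul_right, fun a b c z => ?_⟩
  · rw [contDiff_iff_contDiffAt]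
    intro z
    by_cases hz : z = 0
    · subst hz
      refine (contDiffAt_const (c := (0 : ℂ))).congr_of_eventuallyEq ?_
      filter_upwards [h0] with w hw
      rw [hw, zero_mul]
    · have h1 : ContDiffAt ℝ ∞ (fun z : ℂ => (z * conj z) ^ J) z :=
        ((contDiff_id.mul Complex.conjCLE.contDiff).pow J).contDiffAt
      exact hχ.contDiffAt.mul (h1.inv (pow_ne_zero _ (mul_ne_zero hz ((map_ne_zero _).2 hz))))
  · by_cases hz : z = 0
    · subst hz
      simp [h0.self_of_nhds]
    · have hz' : conj z ≠ 0 := (map_ne_zero _).2 hz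
      simp only [ce, zpow_add₀ hz, zpow_add₀ hz', zpow_natCast, mul_pow]
      field_simp

/-- A cutoff that vanishes near the origin may be divided by any power of `|z|²`, which raises the
degree at will. The terms with `natAbs` make up for negative exponents. -/
theorem dec_cut_ce_of_eventually (hχ : ContDiff ℝ ∞ χ) (hc : HasCompactSupport χ)
    (h0 : ∀ᶠ z in 𝓝 (0 : ℂ), χ z = 0) (N : ℕ) :
    Dec N Kq (fun z => χ z * ce a b c z) ∧ Flat Kq {0} N fun z => χ z * ce a b c z := by
  obtain ⟨ψ, h1, h2, h3⟩ := exists_cut_div hχ hc h0 (N + 1 + a.natAbs + b.natAbs)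
  have e : (fun z => χ z * ce a b c z) = fun z => ψ z * ce _ _ c z := funext fun z => h3 a b c z
  rw [e]
  exact ⟨dec_cut_ce h1 h2 (by omega), flat_cut_ce h1 h2 (by omega)⟩

end Quadrant


open scoped ComplexConjugate

/-! ### The planar Laplacian on powers and logarithms -/

section PlaneLaplacian

/-- The coordinate directions of the plane. -/
noncomputable def ev : Fin 2 → ℂ := ![Complex.I, 1]

variable {a b : ℤ} {c : ℂ × ℂ × ℂ} {χ : ℂ → ℂ}

theorem differentiableOn_cut_ce (hχ : ContDiff ℝ ∞ χ) :
    DifferentiableOn ℝ (fun z => χ z * ce a b c z) Uq := fun _ hz =>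
  (hasFDerivAt_cut_ce hχ (Uq_subset hz)
    (Or.inl (ne_zero_of_mem_Uq hz))).differentiableAt.differentiableWithinAt

theorem pd_cut_ce_Uq (hχ : ContDiff ℝ ∞ χ) (v : ℂ) :
    Set.EqOn (pd Uq v fun z => χ z * ce a b c z)
      (fun z => fderiv ℝ χ z v * ce a b c z + (v * (χ z * ce (a - 1) b (ceA a c) z) +
        conj v * (χ z * ce a (b - 1) (ceB b c) z))) Uq :=
  pd_cut_ce isOpen_Uq.uniqueDiffOn Uq_subset hχ (fun _ hz => Or.inl (ne_zero_of_mem_Uq hz)) v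

/-- The commutator of the Laplacian with a cutoff. -/
noncomputable def cutErr (χ : ℂ → ℂ) (a b : ℤ) (c : ℂ × ℂ × ℂ) : ℂ → ℂ := fun z =>
  ∑ i, (fderiv ℝ (fun z => fderiv ℝ χ z (ev i)) z (ev i) * ce a b c z +
    ((2 * ev i) * (fderiv ℝ χ z (ev i) * ce (a - 1) b (ceA a c) z) +
      (2 * conj (ev i)) * (fderiv ℝ χ z (ev i) * ce a (b - 1) (ceB b c) z)))

theorem ceA_ceB (a b : ℤ) (c : ℂ × ℂ × ℂ) : ceA a (ceB b c) = ceB b (ceA a c) := by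
  simp only [ceA, ceB]
  ext <;> simp only [] <;> ring

/-- The Laplacian is `4 ∂²/∂z∂z̄`: over the directions `i` and `1` the terms in `v²` and `v̄²`
cancel because `i² + 1 = 0`, while the mixed terms add up. -/
theorem lap_cut_ce (hχ : ContDiff ℝ ∞ χ) :
    Set.EqOn (lap Uq ev fun z => χ z * ce a b c z)
      (fun z => χ z * (4 * ce (a - 1) (b - 1) (ceA a (ceB b c)) z) + cutErr χ a b c z) Uq := by
  intro z hz
  have hU := isOpen_Uq.uniqueDiffOn (𝕜 := ℝ)
  have key : ∀ v : ℂ, pd Uq v (pd Uq v fun z => χ z * ce a b c z) z =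
      fderiv ℝ (fun z => fderiv ℝ χ z v) z v * ce a b c z +
        ((2 * v) * (fderiv ℝ χ z v * ce (a - 1) b (ceA a c) z) +
          (2 * conj v) * (fderiv ℝ χ z v * ce a (b - 1) (ceB b c) z)) +
      χ z * (v * v * ce (a - 1 - 1) b (ceA (a - 1) (ceA a c)) z +
        2 * (v * conj v) * ce (a - 1) (b - 1) (ceA a (ceB b c)) z +
        conj v * conj v * ce a (b - 1 - 1) (ceB (b - 1) (ceB b c)) z) := by
    intro v
    have hχ' := contDiff_fderiv_apply hχ v
    have d1 : DifferentiableOn ℝ (fun z => fderiv ℝ χ z v * ce a b c z) Uq :=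
      differentiableOn_cut_ce hχ'
    have d2 : DifferentiableOn ℝ (fun z => χ z * ce (a - 1) b (ceA a c) z) Uq :=
      differentiableOn_cut_ce hχ
    have d3 : DifferentiableOn ℝ (fun z => χ z * ce a (b - 1) (ceB b c) z) Uq :=
      differentiableOn_cut_ce hχ
    have d4 : DifferentiableOn ℝ (fun z => v * (χ z * ce (a - 1) b (ceA a c) z) +
        conj v * (χ z * ce a (b - 1) (ceB b c) z)) Uq := (d2.const_mul v).fun_add (d3.const_mul _)
    rw [pd_congr (pd_cut_ce_Uq hχ v) v hz, pd_add hU d1 d4 v hz]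
    simp only []
    rw [pd_add hU (d2.const_mul v) (d3.const_mul _) v hz]
    simp only []
    rw [ pd_const_mul hU d2 v v hz,
      pd_const_mul hU d3 _ v hz]
    simp only []
    rw [pd_cut_ce_Uq hχ' v hz, pd_cut_ce_Uq hχ v hz, pd_cut_ce_Uq hχ v hz]
    simp only [ceA_ceB]
    ring
  simp only [lap, cutErr, Fin.sum_univ_two, key, ev, Matrix.cons_val_zero, Matrix.cons_val_one,
    Complex.conj_I, map_one]
  have hI : Complex.I * Complex.I = -1 := Complex.I_mul_I
  linear_combination (χ z * ce (a - 1 - 1) b (ceA (a - 1) (ceA a c)) z -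
    2 * χ z * ce (a - 1) (b - 1) (ceA a (ceB b c)) z +
    χ z * ce a (b - 1 - 1) (ceB (b - 1) (ceB b c)) z) * hI

theorem eventually_fderiv_eq_zero {f : ℂ → ℂ} {k : ℂ} (h : ∀ᶠ z in 𝓝 (0 : ℂ), f z = k) (v : ℂ) :
    ∀ᶠ z in 𝓝 (0 : ℂ), fderiv ℝ f z v = 0 := by
  filter_upwards [h.eventually_nhds] with z hz
  have : f =ᶠ[𝓝 z] fun _ => k := hz
  rw [this.fderiv_eq]
  simp

/-- Every term contains a derivative of the cutoff, which vanishes near the origin. -/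
theorem dec_cutErr (hχ : ContDiff ℝ ∞ χ) (hc : HasCompactSupport χ)
    (h1 : ∀ᶠ z in 𝓝 (0 : ℂ), χ z = 1) (N : ℕ) :
    Dec N Kq (cutErr χ a b c) ∧ Flat Kq {0} N (cutErr χ a b c) := by
  have A : ∀ v (a b : ℤ) c, Dec N Kq (fun z => fderiv ℝ χ z v * ce a b c z) ∧
      Flat Kq {0} N fun z => fderiv ℝ χ z v * ce a b c z := fun v a b c =>
    dec_cut_ce_of_eventually (contDiff_fderiv_apply hχ v) (hc.fderiv_apply ℝ v)
      (eventually_fderiv_eq_zero h1 v) N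
  have B : ∀ v, Dec N Kq (fun z => fderiv ℝ (fun z => fderiv ℝ χ z v) z v * ce a b c z) ∧
      Flat Kq {0} N fun z => fderiv ℝ (fun z => fderiv ℝ χ z v) z v * ce a b c z := fun v =>
    dec_cut_ce_of_eventually (contDiff_fderiv_apply (contDiff_fderiv_apply hχ v) v)
      ((hc.fderiv_apply ℝ v).fderiv_apply ℝ v)
      (eventually_fderiv_eq_zero (eventually_fderiv_eq_zero h1 v) v) N
  have d : ∀ (k : ℂ) v (a b : ℤ) c, Dec N Kq fun z => k * (fderiv ℝ χ z v * ce a b c z) :=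
    fun k v a b c => (A v a b c).1.const_mul uniqueDiffOn_Kq k
  have f : ∀ (k : ℂ) v (a b : ℤ) c, Flat Kq {0} N fun z => k * (fderiv ℝ χ z v * ce a b c z) :=
    fun k v a b c => (A v a b c).2.const_mul uniqueDiffOn_Kq zero_mem_Kq k (A v a b c).1
  have d2 := fun i : Fin 2 => (d (2 * ev i) (ev i) (a - 1) b (ceA a c)).add uniqueDiffOn_Kq
    (d (2 * conj (ev i)) (ev i) a (b - 1) (ceB b c))
  have f2 := fun i : Fin 2 => (f (2 * ev i) (ev i) (a - 1) b (ceA a c)).add uniqueDiffOn_Kq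
    zero_mem_Kq (f (2 * conj (ev i)) (ev i) a (b - 1) (ceB b c)) (d _ _ _ _ _) (d _ _ _ _ _)
  exact ⟨Dec.sum uniqueDiffOn_Kq _ fun i _ => (B (ev i)).1.add uniqueDiffOn_Kq (d2 i),
    Flat.sum uniqueDiffOn_Kq zero_mem_Kq _ (fun i _ => (B (ev i)).2.add uniqueDiffOn_Kq
      zero_mem_Kq (f2 i) (B (ev i)).1 (d2 i)) fun i _ => (B (ev i)).1.add uniqueDiffOn_Kq (d2 i)⟩

/-- `Q'` is the Laplacian of `Q`, up to harmless terms, also in the presence of a cutoff. -/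
def LapRel (Q Q' : ℂ → ℂ) : Prop :=
  ContDiffOn ℝ ∞ Q Uq ∧ ∀ χ : ℂ → ℂ, ContDiff ℝ ∞ χ → HasCompactSupport χ →
    (∀ᶠ z in 𝓝 (0 : ℂ), χ z = 1) → ∃ T : ℂ → ℂ, (∀ N, Dec N Kq T ∧ Flat Kq {0} N T) ∧
      Set.EqOn (lap Uq ev fun z => χ z * Q z) (fun z => χ z * Q' z + T z) Uq

theorem contDiffOn_ce : ContDiffOn ℝ ∞ (ce a b c) Uq := by
  have h : ∀ (n : ℕ) (a b : ℤ) c, ContDiffOn ℝ n (ce a b c) Uq := by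
    intro n
    induction n with
    | zero =>
      intro a b c
      refine contDiffOn_zero.2 fun z hz => ?_
      exact (hasFDerivAt_ce' (Uq_subset hz)
        (Or.inl (ne_zero_of_mem_Uq hz))).continuousAt.continuousWithinAt
    | succ n ih =>
      intro a b c
      have hd : ∀ z ∈ Uq, HasFDerivAt (ce a b c) (ceD a b c z) z := fun z hz =>
        hasFDerivAt_ce' (Uq_subset hz) (Or.inl (ne_zero_of_mem_Uq hz))
      have e : ((n + 1 : ℕ) : WithTop ℕ∞) = (n : WithTop ℕ∞) + 1 := by norm_cast
      rw [e]
      refine contDiffOn_succ_of_fderiv_apply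
        (fun z hz => (hd z hz).differentiableAt.differentiableWithinAt) (fun h => by simp at h)
        fun v => ?_
      refine ((contDiffOn_const (c := v)).mul (ih (a - 1) b (ceA a c)) |>.add
        ((contDiffOn_const (c := conj v)).mul (ih a (b - 1) (ceB b c)))).congr fun z hz => ?_
      rw [(hd z hz).hasFDerivWithinAt.fderivWithin (isOpen_Uq.uniqueDiffOn z hz), ceD_apply]
  exact contDiffOn_infty.2 fun n => h n a b c

theorem lapRel_ce (a b : ℤ) (c : ℂ × ℂ × ℂ) :
    LapRel (ce a b c) fun z => 4 * ce (a - 1) (b - 1) (ceA a (ceB b c)) z :=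
  ⟨contDiffOn_ce, fun χ hχ hc h1 => ⟨cutErr χ a b c, fun N => dec_cutErr hχ hc h1 N,
    lap_cut_ce hχ⟩⟩

theorem differentiableOn_pd {E : Type*} [NormedAddCommGroup E] [NormedSpace ℝ E] {U : Set E}
    (hU : IsOpen U) {h : E → ℂ} (hh : ContDiffOn ℝ ∞ h U) (v : E) :
    DifferentiableOn ℝ (pd U v h) U :=
  ((hh.fderivWithin hU.uniqueDiffOn (m := ∞) (by simp)).clm_apply
    contDiffOn_const).differentiableOn (by simp)

theorem LapRel.add {Q Q' P P' : ℂ → ℂ} (h : LapRel Q Q') (h' : LapRel P P') :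
    LapRel (Q + P) (Q' + P') := by
  refine ⟨h.1.add h'.1, fun χ hχ hc h1 => ?_⟩
  obtain ⟨T, hT, e⟩ := h.2 χ hχ hc h1
  obtain ⟨T', hT', e'⟩ := h'.2 χ hχ hc h1
  refine ⟨fun z => T z + T' z, fun N => ⟨(hT N).1.add uniqueDiffOn_Kq (hT' N).1,
    (hT N).2.add uniqueDiffOn_Kq zero_mem_Kq (hT' N).2 (hT N).1 (hT' N).1⟩, fun z hz => ?_⟩
  have s1 : ContDiffOn ℝ ∞ (fun z => χ z * Q z) Uq := hχ.contDiffOn.mul h.1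
  have s2 : ContDiffOn ℝ ∞ (fun z => χ z * P z) Uq := hχ.contDiffOn.mul h'.1
  have e1 : (fun z => χ z * (Q + P) z) = fun z => χ z * Q z + χ z * P z := by
    funext z; simp [mul_add]
  rw [e1, lap_add isOpen_Uq.uniqueDiffOn ev (s1.differentiableOn (by simp))
    (differentiableOn_pd isOpen_Uq s1) (s2.differentiableOn (by simp))
    (differentiableOn_pd isOpen_Uq s2) hz]
  simp only []
  rw [e hz, e' hz]
  simp only [Pi.add_apply]
  ring

theorem LapRel.smul {Q Q' : ℂ → ℂ} (h : LapRel Q Q') (k : ℂ) : LapRel (k • Q) (k • Q') := by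
  refine ⟨h.1.const_smul k, fun χ hχ hc h1 => ?_⟩
  obtain ⟨T, hT, e⟩ := h.2 χ hχ hc h1
  refine ⟨fun z => k * T z, fun N => ⟨(hT N).1.const_mul uniqueDiffOn_Kq k,
    (hT N).2.const_mul uniqueDiffOn_Kq zero_mem_Kq k (hT N).1⟩, fun z hz => ?_⟩
  have s1 : ContDiffOn ℝ ∞ (fun z => χ z * Q z) Uq := hχ.contDiffOn.mul h.1
  have e1 : (fun z => χ z * (k • Q) z) = fun z => k * (χ z * Q z) := by
    funext z; simp only [Pi.smul_apply, smul_eq_mul]; ring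
  rw [e1, lap_const_mul isOpen_Uq.uniqueDiffOn ev (s1.differentiableOn (by simp))
    (differentiableOn_pd isOpen_Uq s1) k hz]
  simp only []
  rw [e hz]
  simp only [Pi.smul_apply, smul_eq_mul]
  ring

theorem LapRel.zero : LapRel 0 0 := by
  have := (lapRel_ce 0 0 0).smul 0
  simpa using this

end PlaneLaplacian

/-! ### Formal solution of the Dirichlet problem at the corner -/

section Spaces

/-- The functions of degree `d` composed of powers and logarithms. -/
noncomputable def Vd (d : ℕ) : Submodule ℂ (ℂ → ℂ) :=
  Submodule.span ℂ {Q | ∃ (a b : ℕ) (c : ℂ × ℂ × ℂ), a + b = d ∧ Q = ce a b c}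

theorem dec_cut_of_mem_Vd {d N : ℕ} (h : N + 1 ≤ d) {χ : ℂ → ℂ} (hχ : ContDiff ℝ ∞ χ)
    (hc : HasCompactSupport χ) {Q : ℂ → ℂ} (hQ : Q ∈ Vd d) :
    Dec N Kq (fun z => χ z * Q z) ∧ Flat Kq {0} N fun z => χ z * Q z := by
  induction hQ using Submodule.span_induction with
  | mem Q hQ =>
    obtain ⟨a, b, c, hab, rfl⟩ := hQ
    exact ⟨dec_cut_ce hχ hc (by omega), flat_cut_ce hχ hc (by omega)⟩
  | zero =>
    simp only [Pi.zero_apply, mul_zero]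
    exact ⟨Dec.zero uniqueDiffOn_Kq, Flat.zero uniqueDiffOn_Kq zero_mem_Kq⟩
  | add P Q _ _ hP hQ =>
    simp only [Pi.add_apply, mul_add]
    exact ⟨hP.1.add uniqueDiffOn_Kq hQ.1, hP.2.add uniqueDiffOn_Kq zero_mem_Kq hQ.2 hP.1 hQ.1⟩
  | smul k Q _ hQ =>
    have e : (fun z => χ z * (k • Q) z) = fun z => k * (χ z * Q z) := by
      funext z; simp only [Pi.smul_apply, smul_eq_mul]; ring
    rw [e]
    exact ⟨hQ.1.const_mul uniqueDiffOn_Kq k, hQ.2.const_mul uniqueDiffOn_Kq zero_mem_Kq k hQ.1⟩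

/-- The homogeneous polynomials of degree `d`. -/
noncomputable def Pd (d : ℕ) : Submodule ℂ (ℂ → ℂ) :=
  Submodule.span ℂ {Q | ∃ a b : ℕ, a + b = d ∧ Q = fun z => z ^ a * conj z ^ b}

/-- From `log z = log |z| + i arg z`, the sum of the two logarithmic coefficients goes with `log
|z|²` and their difference with `arg z`. -/
theorem exists_log_decomposition {d : ℕ} {Q : ℂ → ℂ} (hQ : Q ∈ Vd d) :
    ∃ A ∈ Pd d, ∃ B ∈ Pd d, ∃ C ∈ Pd d, ∀ z, Q z =
      A z * (Real.log (Complex.normSq z) : ℂ) + B z + C z * (Complex.arg z : ℂ) := by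
  induction hQ using Submodule.span_induction with
  | mem Q hQ =>
    obtain ⟨a, b, c, hab, rfl⟩ := hQ
    set m : ℂ → ℂ := fun z => z ^ a * conj z ^ b with hm
    have hmem : m ∈ Pd d := Submodule.subset_span ⟨a, b, hab, rfl⟩
    refine ⟨((c.2.1 + c.2.2) / 2) • m, Submodule.smul_mem _ _ hmem, c.1 • m,
      Submodule.smul_mem _ _ hmem, (Complex.I * (c.2.1 - c.2.2)) • m, Submodule.smul_mem _ _ hmem,
      fun z => ?_⟩
    have hl : Complex.log z = (Real.log ‖z‖ : ℂ) + (Complex.arg z : ℂ) * Complex.I := rfl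
    have hn : Real.log (Complex.normSq z) = 2 * Real.log ‖z‖ := by
      rw [Complex.normSq_eq_norm_sq, Real.log_pow]
      norm_num
    rw [hn]
    simp only [ce, hl, hm, Pi.smul_apply, smul_eq_mul, zpow_natCast, map_add, map_mul,
      Complex.conj_ofReal, Complex.conj_I]
    push_cast
    ring
  | zero => exact ⟨0, zero_mem _, 0, zero_mem _, 0, zero_mem _, fun z => by simp⟩
  | add P Q _ _ hP hQ =>
    obtain ⟨A, hA, B, hB, C, hC, e⟩ := hP
    obtain ⟨A', hA', B', hB', C', hC', e'⟩ := hQ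
    refine ⟨A + A', add_mem hA hA', B + B', add_mem hB hB', C + C', add_mem hC hC', fun z => ?_⟩
    simp only [Pi.add_apply, e, e']
    ring
  | smul k Q _ hQ =>
    obtain ⟨A, hA, B, hB, C, hC, e⟩ := hQ
    refine ⟨k • A, Submodule.smul_mem _ _ hA, k • B, Submodule.smul_mem _ _ hB, k • C,
      Submodule.smul_mem _ _ hC, fun z => ?_⟩
    simp only [Pi.smul_apply, smul_eq_mul, e]
    ring

/-- The antisymmetrized monomial. -/
noncomputable def pgen (a b : ℕ) : ℂ → ℂ := ce a b (1, 0, 0) + (-1 : ℂ) • ce b a (1, 0, 0)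

/-- The antisymmetrized monomial times a logarithm. -/
noncomputable def lgen (a b : ℕ) : ℂ → ℂ := ce a b (0, 1, 0) + (-1 : ℂ) • ce b a (0, 0, 1)

/-- The functions of degree `d` composed of antisymmetric monomials, and of antisymmetric logarithmic
terms for even degree. -/
noncomputable def Wd (d : ℕ) : Submodule ℂ (ℂ → ℂ) :=
  Submodule.span ℂ {Q | ∃ a b : ℕ, a + b = d ∧ (Q = pgen a b ∨ (Even d ∧ Q = lgen a b))}

theorem pgen_mem {a b d : ℕ} (h : a + b = d) : pgen a b ∈ Wd d :=
  Submodule.subset_span ⟨a, b, h, Or.inl rfl⟩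

theorem lgen_mem {a b d : ℕ} (h : a + b = d) (hd : Even d) : lgen a b ∈ Wd d :=
  Submodule.subset_span ⟨a, b, h, Or.inr ⟨hd, rfl⟩⟩

theorem Wd_le_Vd (d : ℕ) : Wd d ≤ Vd d := by
  refine Submodule.span_le.2 ?_
  have h : ∀ (a b : ℕ) c, a + b = d → ce a b c ∈ Vd d := fun a b c hab =>
    Submodule.subset_span ⟨a, b, c, hab, rfl⟩
  rintro Q ⟨a, b, hab, rfl | ⟨_, rfl⟩⟩
  · exact add_mem (h a b _ hab) (Submodule.smul_mem _ _ (h b a _ (by omega)))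
  · exact add_mem (h a b _ hab) (Submodule.smul_mem _ _ (h b a _ (by omega)))

theorem pgen_ofReal (a b : ℕ) (τ : ℝ) : pgen a b τ = 0 := by
  simp only [pgen, ce, Pi.add_apply, Pi.smul_apply, Complex.conj_ofReal, smul_eq_mul]
  ring

theorem lgen_ofReal (a b : ℕ) {τ : ℝ} (hτ : 0 ≤ τ) : lgen a b τ = 0 := by
  simp only [lgen, ce, Pi.add_apply, Pi.smul_apply, Complex.conj_ofReal, smul_eq_mul,
    ← Complex.ofReal_log hτ]
  ring

theorem pgen_imag (a b : ℕ) (τ : ℝ) : pgen a b (τ * Complex.I) =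
    Complex.I ^ (a + b) * ((-1) ^ b - (-1) ^ a) * (τ : ℂ) ^ (a + b) := by
  simp only [pgen, ce, Pi.add_apply, Pi.smul_apply, smul_eq_mul, map_mul, Complex.conj_ofReal,
    Complex.conj_I, zpow_natCast, mul_pow, neg_pow Complex.I]
  ring

/-- In even degree `(-1)^a = (-1)^b`, so the terms `log τ` cancel and the two arguments `π / 2` add
up. In odd degree `τ^d log τ` would remain; this explains the parity condition in `Wd`. -/
theorem lgen_imag {a b : ℕ} (hab : 1 ≤ a + b) (he : Even (a + b)) {τ : ℝ} (hτ : 0 ≤ τ) :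
    lgen a b (τ * Complex.I) =
      Complex.I ^ (a + b) * (-1) ^ b * (Real.pi * Complex.I) * (τ : ℂ) ^ (a + b) := by
  rcases hτ.eq_or_lt with rfl | hτ
  · simp only [lgen, Pi.add_apply, Pi.smul_apply, Complex.ofReal_zero, zero_mul]
    rw [ce_zero (by omega), ce_zero (by omega), zero_pow (by omega)]
    simp
  · have hl : Complex.log (τ * Complex.I) = (Real.log τ : ℂ) + Real.pi / 2 * Complex.I := by
      rw [Complex.log_ofReal_mul hτ Complex.I_ne_zero, Complex.log_I]
    have hp : ((-1 : ℂ)) ^ a = (-1) ^ b := by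
      rcases Nat.even_or_odd b with hb | hb
      · rw [hb.neg_one_pow, ((Nat.even_add.1 he).2 hb).neg_one_pow]
      · rw [hb.neg_one_pow, Odd.neg_one_pow]
        rw [← Nat.not_even_iff_odd] at hb ⊢
        exact fun h => hb ((Nat.even_add.1 he).1 h)
    simp only [lgen, ce, Pi.add_apply, Pi.smul_apply, smul_eq_mul, map_mul, Complex.conj_ofReal,
      Complex.conj_I, zpow_natCast, mul_pow, neg_pow Complex.I, hl, hp, map_add, map_div₀,
      map_ofNat]
    ring

theorem boundary_of_mem_Wd {d : ℕ} (hd : 1 ≤ d) {Q : ℂ → ℂ} (hQ : Q ∈ Wd d) :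
    (∀ τ : ℝ, 0 ≤ τ → Q τ = 0) ∧ ∃ μ : ℂ, ∀ τ : ℝ, 0 ≤ τ → Q (τ * Complex.I) = μ * (τ : ℂ) ^ d := by
  induction hQ using Submodule.span_induction with
  | mem Q hQ =>
    obtain ⟨a, b, rfl, rfl | ⟨he, rfl⟩⟩ := hQ
    · exact ⟨fun τ _ => pgen_ofReal a b τ, _, fun τ _ => pgen_imag a b τ⟩
    · exact ⟨fun τ hτ => lgen_ofReal a b hτ, _, fun τ hτ => lgen_imag hd he hτ⟩
  | zero => exact ⟨fun _ _ => rfl, 0, fun τ _ => by simp⟩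
  | add P Q _ _ hP hQ =>
    obtain ⟨h1, μ, h2⟩ := hP
    obtain ⟨h3, ν, h4⟩ := hQ
    refine ⟨fun τ hτ => by simp [h1 τ hτ, h3 τ hτ], μ + ν, fun τ hτ => ?_⟩
    simp only [Pi.add_apply, h2 τ hτ, h4 τ hτ]
    ring
  | smul k Q _ hQ =>
    obtain ⟨h1, μ, h2⟩ := hQ
    refine ⟨fun τ hτ => by simp [h1 τ hτ], k * μ, fun τ hτ => ?_⟩
    simp only [Pi.smul_apply, smul_eq_mul, h2 τ hτ]
    ring

theorem lapRel_pgen (a b : ℕ) : LapRel (pgen (a + 1) (b + 1))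
    ((4 * (a + 1) * (b + 1) : ℂ) • pgen a b) := by
  have h := (lapRel_ce (a + 1 : ℕ) (b + 1 : ℕ) (1, 0, 0)).add
    ((lapRel_ce (b + 1 : ℕ) (a + 1 : ℕ) (1, 0, 0)).smul (-1))
  refine (congrArg₂ LapRel (?_ : _ = _) (?_ : _ = _)).mp h
  · rfl
  funext z
  simp only [pgen, ce, ceA, ceB, Pi.add_apply, Pi.smul_apply, smul_eq_mul, Nat.cast_add,
    Nat.cast_one, add_sub_cancel_right]
  push_cast
  ring

theorem lapRel_lgen (a b : ℕ) : LapRel (lgen (a + 1) (b + 1))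
    ((4 * (a + 1) * (b + 1) : ℂ) • lgen a b + (4 * (b + 1) : ℂ) • pgen a b) := by
  have h := (lapRel_ce (a + 1 : ℕ) (b + 1 : ℕ) (0, 1, 0)).add
    ((lapRel_ce (b + 1 : ℕ) (a + 1 : ℕ) (0, 0, 1)).smul (-1))
  refine (congrArg₂ LapRel (?_ : _ = _) (?_ : _ = _)).mp h
  · rfl
  funext z
  simp only [pgen, lgen, ce, ceA, ceB, Pi.add_apply, Pi.smul_apply, smul_eq_mul, Nat.cast_add,
    Nat.cast_one, add_sub_cancel_right]
  push_cast
  ring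

theorem lapRel_pgen_zero (d : ℕ) : LapRel (pgen d 0) 0 := by
  have h := (lapRel_ce (d : ℕ) (0 : ℕ) (1, 0, 0)).add
    ((lapRel_ce (0 : ℕ) (d : ℕ) (1, 0, 0)).smul (-1))
  refine (congrArg₂ LapRel (?_ : _ = _) (?_ : _ = _)).mp h
  · rfl
  funext z
  simp [ce, ceA, ceB]

theorem lapRel_lgen_zero (d : ℕ) : LapRel (lgen d 0) 0 := by
  have h := (lapRel_ce (d : ℕ) (0 : ℕ) (0, 1, 0)).add
    ((lapRel_ce (0 : ℕ) (d : ℕ) (0, 0, 1)).smul (-1))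
  refine (congrArg₂ LapRel (?_ : _ = _) (?_ : _ = _)).mp h
  · rfl
  funext z
  simp [ce, ceA, ceB]

/-- In odd degree `z^d - z̄^d` is nonzero on the imaginary axis. In even degree it vanishes on both
axes, and the resonance is resolved by `z^d log z` minus its conjugate. Here the logarithms
originate. -/
theorem exists_harmonic {d : ℕ} (hd : 1 ≤ d) : ∃ h ∈ Wd d, LapRel h 0 ∧
    ∃ μ : ℂ, μ ≠ 0 ∧ ∀ τ : ℝ, 0 ≤ τ → h (τ * Complex.I) = μ * (τ : ℂ) ^ d := by
  have hI : Complex.I ^ d ≠ 0 := pow_ne_zero _ Complex.I_ne_zero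
  rcases Nat.even_or_odd d with he | ho
  · refine ⟨lgen d 0, lgen_mem (add_zero d) he, lapRel_lgen_zero d,
      Complex.I ^ d * (Real.pi * Complex.I), ?_, fun τ hτ => ?_⟩
    · exact mul_ne_zero hI (mul_ne_zero (by exact_mod_cast Real.pi_ne_zero) Complex.I_ne_zero)
    · rw [lgen_imag (by omega) (by simpa using he) hτ]
      simp
  · refine ⟨pgen d 0, pgen_mem (add_zero d), lapRel_pgen_zero d, Complex.I ^ d * 2, ?_,
      fun τ hτ => ?_⟩
    · exact mul_ne_zero hI two_ne_zero
    · rw [pgen_imag, ho.neg_one_pow]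
      norm_num

/-- Raising both exponents by one inverts `4 ∂²/∂z∂z̄` up to a nonzero factor. A logarithm also
produces an antisymmetrized monomial, for which a preimage is subtracted. -/
theorem exists_lapRel {d : ℕ} {Q : ℂ → ℂ} (hQ : Q ∈ Wd d) : ∃ P ∈ Wd (d + 2), LapRel P Q := by
  have hp : ∀ a b : ℕ, a + b = d → ∃ P ∈ Wd (d + 2), LapRel P (pgen a b) := fun a b hab => by
    have hk : (4 * (a + 1) * (b + 1) : ℂ) ≠ 0 := by norm_cast
    refine ⟨(4 * (a + 1) * (b + 1) : ℂ)⁻¹ • pgen (a + 1) (b + 1),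
      Submodule.smul_mem _ _ (pgen_mem (by omega)), ?_⟩
    have := (lapRel_pgen a b).smul (4 * (a + 1) * (b + 1) : ℂ)⁻¹
    rwa [smul_smul, inv_mul_cancel₀ hk, one_smul] at this
  induction hQ using Submodule.span_induction with
  | mem Q hQ =>
    obtain ⟨a, b, hab, rfl | ⟨he, rfl⟩⟩ := hQ
    · exact hp a b hab
    · obtain ⟨P, hP, hL⟩ := hp a b hab
      have hk : (4 * (a + 1) * (b + 1) : ℂ) ≠ 0 := by norm_cast
      refine ⟨(4 * (a + 1) * (b + 1) : ℂ)⁻¹ • (lgen (a + 1) (b + 1) + (-(4 * (b + 1) : ℂ)) • P),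
        Submodule.smul_mem _ _ (add_mem (lgen_mem (by omega) (he.add even_two))
          (Submodule.smul_mem _ _ hP)), ?_⟩
      have := ((lapRel_lgen a b).add (hL.smul (-(4 * (b + 1) : ℂ)))).smul
        (4 * (a + 1) * (b + 1) : ℂ)⁻¹
      rwa [neg_smul _ (pgen a b), add_neg_cancel_right, smul_smul, inv_mul_cancel₀ hk,
        one_smul] at this
  | zero => exact ⟨0, zero_mem _, LapRel.zero⟩
  | add P Q _ _ hP hQ =>
    obtain ⟨P', hP', h1⟩ := hP
    obtain ⟨Q', hQ', h2⟩ := hQ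
    exact ⟨P' + Q', add_mem hP' hQ', h1.add h2⟩
  | smul k Q _ hQ =>
    obtain ⟨Q', hQ', h2⟩ := hQ
    exact ⟨k • Q', Submodule.smul_mem _ _ hQ', h2.smul k⟩

/-- The boundary value of any preimage is a multiple of `τ^(d+2)`, and is removed by the harmonic
function of the same degree without changing the Laplacian. -/
theorem exists_lapRel_zero_boundary {d : ℕ} {Q : ℂ → ℂ} (hQ : Q ∈ Wd d) :
    ∃ P ∈ Wd (d + 2), LapRel P Q ∧ ∀ τ : ℝ, 0 ≤ τ → P (τ * Complex.I) = 0 := by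
  obtain ⟨P, hP, hL⟩ := exists_lapRel hQ
  obtain ⟨-, ν, hν⟩ := boundary_of_mem_Wd (by omega) hP
  obtain ⟨h, hh, hLh, μ, hμ0, hμ⟩ := exists_harmonic (d := d + 2) (by omega)
  refine ⟨P + (-(ν / μ)) • h, add_mem hP (Submodule.smul_mem _ _ hh), ?_, fun τ hτ => ?_⟩
  · simpa using hL.add (hLh.smul (-(ν / μ)))
  · simp only [Pi.add_apply, Pi.smul_apply, smul_eq_mul, hν τ hτ, hμ τ hτ]
    field_simp
    ring

/-- A formal solution of the corner problem with the boundary value `τ ^ k`. -/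
theorem exists_corner_sequence {k : ℕ} (hk : 1 ≤ k) : ∃ Q : ℕ → ℂ → ℂ,
    (∀ j, Q j ∈ Wd (k + 2 * j)) ∧ LapRel (Q 0) 0 ∧ (∀ j, LapRel (Q (j + 1)) (Q j)) ∧
    (∀ j, ∀ τ : ℝ, 0 ≤ τ → Q j τ = 0) ∧
    (∀ τ : ℝ, 0 ≤ τ → Q 0 (τ * Complex.I) = (τ : ℂ) ^ k) ∧
    ∀ j, ∀ τ : ℝ, 0 ≤ τ → Q (j + 1) (τ * Complex.I) = 0 := by
  obtain ⟨h, hh, hLh, μ, hμ0, hμ⟩ := exists_harmonic hk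
  choose! S hS1 hS2 hS3 using fun (d : ℕ) (Q : ℂ → ℂ) (hQ : Q ∈ Wd d) =>
    exists_lapRel_zero_boundary hQ
  set Q : ℕ → ℂ → ℂ := fun j => Nat.rec (μ⁻¹ • h) (fun j q => S (k + 2 * j) q) j with hQdef
  have hQs : ∀ j, Q (j + 1) = S (k + 2 * j) (Q j) := fun _ => rfl
  have hQ : ∀ j, Q j ∈ Wd (k + 2 * j) := by
    intro j
    induction j with
    | zero => exact Submodule.smul_mem _ _ hh
    | succ j ih =>
      rw [hQs]
      exact hS1 _ _ ih
  refine ⟨Q, hQ, ?_, fun j => ?_, fun j => (boundary_of_mem_Wd (by omega) (hQ j)).1,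
    fun τ hτ => ?_, fun j => ?_⟩
  · have := hLh.smul μ⁻¹
    rwa [smul_zero] at this
  · rw [hQs]
    exact hS2 _ _ (hQ j)
  · change (μ⁻¹ • h) (τ * Complex.I) = _
    rw [Pi.smul_apply, hμ τ hτ, smul_eq_mul, inv_mul_cancel_left₀ hμ0]
  · rw [hQs]
    exact hS3 _ _ (hQ j)

end Spaces


open scoped ComplexConjugate

/-! ### Corner functions with coefficients depending on `x` -/

section CornerCoordinates

/-- The projection to the real parts. -/
noncomputable def xc : C2 →L[ℝ] R2 :=
  LinearMap.toContinuousLinearMap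
    { toFun := fun z => WithLp.toLp 2 fun j => z (Sum.inl j)
      map_add' := fun _ _ => rfl
      map_smul' := fun _ _ => rfl }

/-- The imaginary parts, combined to the number `y₂ + i y₁`. -/
noncomputable def zc : C2 →L[ℝ] ℂ :=
  LinearMap.toContinuousLinearMap
    { toFun := fun z => ⟨z (Sum.inr 1), z (Sum.inr 0)⟩
      map_add' := fun _ _ => rfl
      map_smul' := fun r z => by
        apply Complex.ext <;> simp }

theorem xc_apply (z : C2) (j : Fin 2) : xc z j = z (Sum.inl j) := rfl

theorem zc_apply (z : C2) : zc z = ⟨z (Sum.inr 1), z (Sum.inr 0)⟩ := rfl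

theorem zc_re (z : C2) : (zc z).re = z (Sum.inr 1) := rfl

theorem zc_im (z : C2) : (zc z).im = z (Sum.inr 0) := rfl

theorem norm_le_xc_zc (z : C2) : ‖z‖ ≤ ‖xc z‖ + ‖zc z‖ := by
  have h1 : ‖z‖ ^ 2 = ‖xc z‖ ^ 2 + ‖zc z‖ ^ 2 := by
    rw [EuclideanSpace.real_norm_sq_eq, EuclideanSpace.real_norm_sq_eq, Complex.sq_norm,
      Complex.normSq_apply, Fintype.sum_sum_type]
    simp only [Fin.sum_univ_two, xc_apply, zc_re, zc_im]
    ring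
  refine abs_le_of_sq_le_sq' ?_ (by positivity) |>.2
  nlinarith [norm_nonneg (xc z), norm_nonneg (zc z), mul_nonneg (norm_nonneg (xc z)) (norm_nonneg (zc z))]

theorem zc_mapsTo : Set.MapsTo zc KO Kq := fun z hz => by
  rw [KO, closure_Omega] at hz
  exact ⟨hz 1, hz 0⟩

theorem zc_mapsTo_Omega : Set.MapsTo zc Omega Uq := fun _ hz => ⟨hz 1, hz 0⟩

/-- The coordinate vectors of `R2`. -/
noncomputable def e2 (j : Fin 2) : R2 := EuclideanSpace.single j 1

theorem xc_bv_inl (j : Fin 2) : xc (bv (Sum.inl j)) = e2 j := by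
  ext i
  simp [xc_apply, bv, e2]

theorem xc_bv_inr (j : Fin 2) : xc (bv (Sum.inr j)) = 0 := by
  ext i
  simp [xc_apply, bv]

theorem zc_bv_inl (j : Fin 2) : zc (bv (Sum.inl j)) = 0 := by
  apply Complex.ext <;> simp [zc_re, zc_im, bv]

theorem zc_bv_inr (j : Fin 2) : zc (bv (Sum.inr j)) = ev j := by
  rcases (by fin_cases j <;> simp : j = 0 ∨ j = 1) with rfl | rfl <;>
    apply Complex.ext <;> simp [zc_re, zc_im, bv, ev]

/-- The corner of the domain. -/
def corner : Set C2 := face 0 ∩ face 1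

theorem corner_subset : corner ⊆ KO := fun _ hz => hz.1.1

theorem zc_mapsTo_corner : Set.MapsTo zc corner {0} := fun z hz => by
  apply Complex.ext
  · exact hz.2.2
  · exact hz.1.2

variable {c : R2 → ℂ} {G : ℂ → ℂ}

theorem contDiffOn_corner_tensor (hc : ContDiff ℝ ∞ c) (hG : ContDiffOn ℝ ∞ G Uq) :
    ContDiffOn ℝ ∞ (fun z => c (xc z) * G (zc z)) Omega :=
  (hc.comp xc.contDiff).contDiffOn.mul (hG.comp zc.contDiff.contDiffOn zc_mapsTo_Omega)

theorem pd_zero {E : Type*} [NormedAddCommGroup E] [NormedSpace ℝ E] (K : Set E) (h : E → ℂ) (z : E) :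
    pd K 0 h z = 0 := by simp [pd]

theorem lap_corner_tensor (hc : ContDiff ℝ ∞ c) (hG : ContDiffOn ℝ ∞ G Uq) :
    Set.EqOn (lap Omega bv fun z => c (xc z) * G (zc z))
      (fun z => lap Set.univ e2 c (xc z) * G (zc z) + c (xc z) * lap Uq ev G (zc z)) Omega := by
  intro z hz
  have hU := isOpen_Omega.uniqueDiffOn (𝕜 := ℝ)
  have m1 : Set.MapsTo xc Omega Set.univ := Set.mapsTo_univ _ _
  have dc : DifferentiableOn ℝ c Set.univ := hc.contDiffOn.differentiableOn (by simp)
  have dc' : ∀ v, DifferentiableOn ℝ (pd Set.univ v c) Set.univ := fun v =>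
    differentiableOn_pd isOpen_univ hc.contDiffOn v
  have dG : DifferentiableOn ℝ G Uq := hG.differentiableOn (by simp)
  have dG' : ∀ v, DifferentiableOn ℝ (pd Uq v G) Uq := differentiableOn_pd isOpen_Uq hG
  have h1 : ∀ j, Set.EqOn (pd Omega (bv (Sum.inl j)) fun z => c (xc z) * G (zc z))
      (fun z => pd Set.univ (e2 j) c (xc z) * G (zc z)) Omega := fun j w hw => by
    rw [pd_tensor hU m1 zc_mapsTo_Omega dc dG _ hw, xc_bv_inl, zc_bv_inl]
    simp only [pd_zero, mul_zero, add_zero]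
  have h2 : ∀ j, Set.EqOn (pd Omega (bv (Sum.inr j)) fun z => c (xc z) * G (zc z))
      (fun z => c (xc z) * pd Uq (ev j) G (zc z)) Omega := fun j w hw => by
    rw [pd_tensor hU m1 zc_mapsTo_Omega dc dG _ hw, xc_bv_inr, zc_bv_inr]
    simp only [pd_zero, zero_mul, zero_add]
  simp only [lap, Fintype.sum_sum_type, Finset.sum_mul, Finset.mul_sum]
  congr 1
  · refine Finset.sum_congr rfl fun j _ => ?_
    rw [pd_congr (h1 j) _ hz, pd_tensor hU m1 zc_mapsTo_Omega (dc' _) dG _ hz, xc_bv_inl, zc_bv_inl]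
    simp only [pd_zero, mul_zero, add_zero]
  · refine Finset.sum_congr rfl fun j _ => ?_
    rw [pd_congr (h2 j) _ hz, pd_tensor hU m1 zc_mapsTo_Omega dc (dG' _) _ hz, xc_bv_inr, zc_bv_inr]
    simp only [pd_zero, zero_mul, zero_add]

theorem dec_corner_tensor {N : ℕ} (hc : Dec N Set.univ c) (hG : Dec N Kq G) :
    Dec N KO (fun z => c (xc z) * G (zc z)) :=
  Dec.tensor uniqueDiffOn_closure_Omega (Set.mapsTo_univ _ _) zc_mapsTo norm_le_xc_zc hc hG

theorem flat_corner_tensor {N : ℕ} (hc : Dec N Set.univ c) (hG : Dec N Kq G)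
    (hf : Flat Kq {0} N G) : Flat KO corner N (fun z => c (xc z) * G (zc z)) :=
  Flat.tensor_right uniqueDiffOn_closure_Omega corner_subset (Set.mapsTo_univ _ _) zc_mapsTo
    norm_le_xc_zc zc_mapsTo_corner hc hG hf

/-- The radial cutoff in the plane. -/
noncomputable def cutC (z : ℂ) : ℂ := ((1 - step (Complex.normSq z) : ℝ) : ℂ)

theorem contDiff_cutC : ContDiff ℝ ∞ cutC := by
  have h : ContDiff ℝ ∞ fun z : ℂ => Complex.normSq z := by
    have e : (fun z : ℂ => Complex.normSq z) = fun z => Complex.reCLM z * Complex.reCLM z +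
        Complex.imCLM z * Complex.imCLM z := by
      funext z; simp [Complex.normSq_apply]
    rw [e]
    exact (Complex.reCLM.contDiff.mul Complex.reCLM.contDiff).add
      (Complex.imCLM.contDiff.mul Complex.imCLM.contDiff)
  exact Complex.ofRealCLM.contDiff.comp (contDiff_const.sub (contDiff_step.comp h))

theorem hasCompactSupport_cutC : HasCompactSupport cutC := by
  refine HasCompactSupport.of_support_subset_isCompact (isCompact_closedBall (0 : ℂ) 2) ?_
  intro z hz
  by_contra h
  refine hz ?_
  rw [mem_closedBall_zero_iff, not_le] at h
  rw [cutC, step_eq_one, sub_self, Complex.ofReal_zero]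
  rw [Complex.normSq_eq_norm_sq]
  nlinarith

theorem cutC_eq_one {z : ℂ} (h : Complex.normSq z ≤ 1) : cutC z = 1 := by
  rw [cutC, step_eq_zero h]; simp

theorem eventually_cutC : ∀ᶠ z in 𝓝 (0 : ℂ), cutC z = 1 := by
  filter_upwards [Metric.ball_mem_nhds (0 : ℂ) one_pos] with z hz
  rw [mem_ball_zero_iff] at hz
  refine cutC_eq_one ?_
  rw [Complex.normSq_eq_norm_sq]
  nlinarith [norm_nonneg z]

theorem cutC_imag (τ : ℝ) : cutC (τ * Complex.I) = (cut τ : ℂ) := by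
  simp [cutC, cut, Complex.normSq_apply, sq]

/-- The iterates of the negative Laplacian. -/
noncomputable def negLap (c : R2 → ℂ) : ℕ → R2 → ℂ
  | 0 => c
  | j + 1 => fun x => (-1 : ℂ) * lap Set.univ e2 (negLap c j) x

theorem dec_negLap (hc : ∀ N, Dec N Set.univ c) (j : ℕ) : ∀ N, Dec N Set.univ (negLap c j) := by
  induction j with
  | zero => exact hc
  | succ j ih => exact fun N => (Dec.lap uniqueDiffOn_univ e2 (ih (N + 2))).const_mul uniqueDiffOn_univ _

/-- The approximate solution of the corner problem. -/
noncomputable def cornerSum (c : R2 → ℂ) (Q : ℕ → ℂ → ℂ) (J : ℕ) : C2 → ℂ := fun z =>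
  ∑ j ∈ Finset.range (J + 1), negLap c j (xc z) * (cutC (zc z) * Q j (zc z))

theorem contDiffOn_cornerSum (hc : ∀ N, Dec N Set.univ c) {Q : ℕ → ℂ → ℂ}
    (hQ : ∀ j, ContDiffOn ℝ ∞ (Q j) Uq) (J : ℕ) : ContDiffOn ℝ ∞ (cornerSum c Q J) Omega :=
  ContDiffOn.sum fun j _ => contDiffOn_corner_tensor (contDiff_top_of_dec (dec_negLap hc j))
    (contDiff_cutC.contDiffOn.mul (hQ j))

/-- The sum telescopes: `Δ_x` of a coefficient is minus the next coefficient, which meets `ΔQ_{j+1}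
= Q_j`. There remain the last term, of high degree at the corner, and the cutoff errors collected in
`T`. -/
theorem lap_cornerSum (hc : ∀ N, Dec N Set.univ c) {Q : ℕ → ℂ → ℂ} (h0 : LapRel (Q 0) 0)
    (h1 : ∀ j, LapRel (Q (j + 1)) (Q j)) (J : ℕ) : ∃ T : C2 → ℂ,
    (∀ N, Dec N KO T ∧ Flat KO corner N T) ∧ Set.EqOn (lap Omega bv (cornerSum c Q J))
      (fun z => (-1 : ℂ) * (negLap c (J + 1) (xc z) * (cutC (zc z) * Q J (zc z))) + T z) Omega := by
  have hs : ∀ j, ContDiff ℝ ∞ (negLap c j) := fun j => contDiff_top_of_dec (dec_negLap hc j)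
  have hQ : ∀ j, ContDiffOn ℝ ∞ (Q j) Uq := fun j => by
    cases j with
    | zero => exact h0.1
    | succ j => exact (h1 j).1
  have ht : ∀ (j : ℕ) (S : ℂ → ℂ), (∀ N, Dec N Kq S ∧ Flat Kq {0} N S) → ∀ N,
      Dec N KO (fun z => negLap c j (xc z) * S (zc z)) ∧
      Flat KO corner N fun z => negLap c j (xc z) * S (zc z) := fun j S hS N =>
    ⟨dec_corner_tensor (dec_negLap hc j N) (hS N).1,
      flat_corner_tensor (dec_negLap hc j N) (hS N).1 (hS N).2⟩
  have hl : ∀ j, Set.EqOn (lap Omega bv fun z => negLap c j (xc z) * (cutC (zc z) * Q j (zc z)))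
      (fun z => (-1 : ℂ) * (negLap c (j + 1) (xc z) * (cutC (zc z) * Q j (zc z))) +
        negLap c j (xc z) * lap Uq ev (fun w => cutC w * Q j w) (zc z)) Omega := fun j z hz => by
    rw [lap_corner_tensor (hs j) (contDiff_cutC.contDiffOn.mul (hQ j)) hz]
    simp only [negLap]
    ring
  induction J with
  | zero =>
    obtain ⟨S, hS, e⟩ := h0.2 cutC contDiff_cutC hasCompactSupport_cutC eventually_cutC
    refine ⟨_, ht 0 S hS, fun z hz => ?_⟩
    have e0 : cornerSum c Q 0 = fun z => negLap c 0 (xc z) * (cutC (zc z) * Q 0 (zc z)) := by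
      funext z; simp [cornerSum]
    rw [e0, hl 0 hz]
    simp only []
    rw [e (zc_mapsTo_Omega hz)]
    simp
  | succ J ih =>
    obtain ⟨T, hT, eT⟩ := ih
    obtain ⟨S, hS, e⟩ := (h1 J).2 cutC contDiff_cutC hasCompactSupport_cutC eventually_cutC
    have a1 := ht (J + 1) S hS
    refine ⟨fun z => T z + negLap c (J + 1) (xc z) * S (zc z), fun N =>
      ⟨(hT N).1.add uniqueDiffOn_closure_Omega (a1 N).1, (hT N).2.add uniqueDiffOn_closure_Omega
        corner_subset (a1 N).2 (hT N).1 (a1 N).1⟩, fun z hz => ?_⟩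
    have e0 : cornerSum c Q (J + 1) = fun z => cornerSum c Q J z +
        negLap c (J + 1) (xc z) * (cutC (zc z) * Q (J + 1) (zc z)) := by
      funext z; simp [cornerSum, Finset.sum_range_succ]
    have s1 := contDiffOn_cornerSum hc hQ J
    have s2 : ContDiffOn ℝ ∞
        (fun z => negLap c (J + 1) (xc z) * (cutC (zc z) * Q (J + 1) (zc z))) Omega :=
      contDiffOn_corner_tensor (hs (J + 1)) (contDiff_cutC.contDiffOn.mul (hQ (J + 1)))
    rw [e0, lap_add isOpen_Omega.uniqueDiffOn bv (s1.differentiableOn (by simp))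
      (differentiableOn_pd isOpen_Omega s1) (s2.differentiableOn (by simp))
      (differentiableOn_pd isOpen_Omega s2) hz]
    simp only []
    rw [eT hz, hl (J + 1) hz]
    simp only []
    rw [e (zc_mapsTo_Omega hz)]
    ring

end CornerCoordinates

/-! ### Polynomials in `y` with Schwartz coefficients -/

section SchwartzPolynomials

/-- Polynomials of degree at most `n` in the imaginary parts, with Schwartz functions of the real
parts as coefficients. -/
def IsSP (n : ℕ) (F : C2 → ℂ) : Prop :=
  ∃ c : ℕ → ℕ → 𝓢(R2, ℂ), ∀ z, F z = schwartzPoly n c (xc z) (z (Sum.inr 0)) (z (Sum.inr 1))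

theorem IsSP.zero (n : ℕ) : IsSP n 0 := ⟨0, fun z => by simp [schwartzPoly]⟩

theorem IsSP.add {n : ℕ} {F G : C2 → ℂ} (hF : IsSP n F) (hG : IsSP n G) :
    IsSP n fun z => F z + G z := by
  obtain ⟨c, hc⟩ := hF
  obtain ⟨c', hc'⟩ := hG
  refine ⟨fun a b => c a b + c' a b, fun z => ?_⟩
  simp only [hc, hc']
  simp only [schwartzPoly, ← Finset.sum_add_distrib]
  refine Finset.sum_congr rfl fun d _ => Finset.sum_congr rfl fun ab _ => ?_
  rw [add_apply]
  ring

theorem IsSP.sum {n : ℕ} {ι : Type*} (s : Finset ι) {F : ι → C2 → ℂ} (hF : ∀ i ∈ s, IsSP n (F i)) :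
    IsSP n fun z => ∑ i ∈ s, F i z := by
  classical
  induction s using Finset.induction_on with
  | empty => exact IsSP.zero n
  | insert a s ha ih =>
    simp only [Finset.sum_insert ha]
    exact IsSP.add (hF a (by simp)) (ih fun i hi => hF i (by simp [hi]))

/-- Homogeneous polynomials of degree `d` in two variables. -/
def IsHom (d : ℕ) (P : ℂ → ℂ → ℂ) : Prop :=
  ∃ p : ℕ → ℕ → ℂ, ∀ s t, P s t = ∑ ab ∈ Finset.HasAntidiagonal.antidiagonal d,
    p ab.1 ab.2 * s ^ ab.1 * t ^ ab.2

theorem IsHom.add {d : ℕ} {P P' : ℂ → ℂ → ℂ} (h : IsHom d P) (h' : IsHom d P') :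
    IsHom d fun s t => P s t + P' s t := by
  obtain ⟨p, hp⟩ := h
  obtain ⟨p', hp'⟩ := h'
  refine ⟨fun a b => p a b + p' a b, fun s t => ?_⟩
  simp only [hp, hp', ← Finset.sum_add_distrib]
  exact Finset.sum_congr rfl fun _ _ => by ring

theorem IsHom.const_mul {d : ℕ} {P : ℂ → ℂ → ℂ} (h : IsHom d P) (k : ℂ) :
    IsHom d fun s t => k * P s t := by
  obtain ⟨p, hp⟩ := h
  refine ⟨fun a b => k * p a b, fun s t => ?_⟩
  simp only [hp, Finset.mul_sum]
  exact Finset.sum_congr rfl fun _ _ => by ring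

theorem IsHom.mul_fst {d : ℕ} {P : ℂ → ℂ → ℂ} (h : IsHom d P) : IsHom (d + 1) fun s t => s * P s t := by
  obtain ⟨p, hp⟩ := h
  refine ⟨fun a b => if a = 0 then 0 else p (a - 1) b, fun s t => ?_⟩
  simp only [hp, Finset.Nat.sum_antidiagonal_succ, Finset.mul_sum]
  simp only [if_true, zero_mul, zero_add, Nat.add_eq_zero_iff, one_ne_zero, and_false, if_false,
    Nat.add_sub_cancel]
  exact Finset.sum_congr rfl fun _ _ => by ring

theorem IsHom.mul_snd {d : ℕ} {P : ℂ → ℂ → ℂ} (h : IsHom d P) : IsHom (d + 1) fun s t => t * P s t := by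
  obtain ⟨p, hp⟩ := h
  refine ⟨fun a b => if b = 0 then 0 else p a (b - 1), fun s t => ?_⟩
  simp only [hp, Finset.Nat.sum_antidiagonal_succ', Finset.mul_sum]
  simp only [if_true, zero_mul, zero_add, Nat.add_eq_zero_iff, one_ne_zero, and_false, if_false,
    Nat.add_sub_cancel]
  exact Finset.sum_congr rfl fun _ _ => by ring

theorem isHom_monomial (a b : ℕ) :
    IsHom (a + b) fun s t => (t + s * Complex.I) ^ a * (t - s * Complex.I) ^ b := by
  have step : ∀ {d : ℕ} {P : ℂ → ℂ → ℂ} (k : ℂ), IsHom d P →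
      IsHom (d + 1) fun s t => (t + s * k) * P s t := fun k h => by
    have := h.mul_snd.add (h.mul_fst.const_mul k)
    refine (congrArg (IsHom _) ?_).mp this
    funext s t
    ring
  induction a with
  | zero =>
    induction b with
    | zero => exact ⟨fun _ _ => 1, fun s t => by simp⟩
    | succ b ih =>
      refine (congrArg₂ IsHom ?_ ?_).mp (step (-Complex.I) ih)
      · ring
      · funext s t; ring
  | succ a ih =>
    refine (congrArg₂ IsHom ?_ ?_).mp (step Complex.I ih)
    · ring
    · funext s t; ring

theorem isHom_of_mem_Pd {d : ℕ} {A : ℂ → ℂ} (hA : A ∈ Pd d) :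
    ∃ P, IsHom d P ∧ ∀ s t : ℝ, A ⟨t, s⟩ = P s t := by
  induction hA using Submodule.span_induction with
  | mem Q hQ =>
    obtain ⟨a, b, rfl, rfl⟩ := hQ
    refine ⟨_, isHom_monomial a b, fun s t => ?_⟩
    have e1 : (⟨t, s⟩ : ℂ) = t + s * Complex.I := by apply Complex.ext <;> simp
    have e2 : conj (⟨t, s⟩ : ℂ) = t - s * Complex.I := by apply Complex.ext <;> simp
    simp only [e1]
    rw [← e1, e2]
  | zero => exact ⟨fun _ _ => 0, ⟨fun _ _ => 0, fun s t => by simp⟩, fun _ _ => rfl⟩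
  | add P Q _ _ hP hQ =>
    obtain ⟨P', h1, h2⟩ := hP
    obtain ⟨Q', h3, h4⟩ := hQ
    exact ⟨_, h1.add h3, fun s t => by rw [Pi.add_apply, h2, h4]⟩
  | smul k Q _ hQ =>
    obtain ⟨Q', h3, h4⟩ := hQ
    exact ⟨_, h3.const_mul k, fun s t => by rw [Pi.smul_apply, h4, smul_eq_mul]⟩

theorem isSP_tensor {d n : ℕ} (hdn : d ≤ n) {c : R2 → ℂ} (hc : ∀ N, Dec N Set.univ c) {A : ℂ → ℂ}
    (hA : A ∈ Pd d) : IsSP n fun z => c (xc z) * A (zc z) := by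
  obtain ⟨P, ⟨p, hp⟩, hP⟩ := isHom_of_mem_Pd hA
  refine ⟨fun a b => if a + b = d then p a b • toSchwartz c hc else 0, fun z => ?_⟩
  simp only []
  rw [zc_apply, hP, hp, schwartzPoly, Finset.sum_eq_single d]
  · rw [Finset.mul_sum]
    refine Finset.sum_congr rfl fun ab hab => ?_
    rw [if_pos (Finset.HasAntidiagonal.mem_antidiagonal.1 hab), smul_apply, smul_eq_mul]
    change _ = p ab.1 ab.2 * c (xc z) * _ * _
    ring
  · intro e _ he
    refine Finset.sum_eq_zero fun ab hab => ?_
    rw [if_neg (by rw [Finset.HasAntidiagonal.mem_antidiagonal.1 hab]; exact he)]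
    simp
  · intro h
    exact absurd (Finset.mem_range.2 (by omega)) h

end SchwartzPolynomials

/-! ### Corner correctors with prescribed boundary values -/

section Corner

/-- `h` has the boundary values `0` and `b` and a Laplacian flat to order `N` at the corner, and it is
the sum of a function of class `n` and logarithmic terms. -/
structure IsCorner (N n : ℕ) (b h : C2 → ℂ) : Prop where
  dec : Dec 1 KO h
  smooth : ContDiffOn ℝ ∞ h Omega
  face_zero : ∀ z ∈ face 0, h z = 0
  face_one : ∀ z ∈ face 1, h z = b z
  laplacian : ∃ E : C2 → ℂ, Dec N KO E ∧ Flat KO corner N E ∧ Set.EqOn (lap Omega bv h) E Omega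
  expansion : ∃ r : C2 → ℂ, Dec n KO r ∧ ∃ α β γ : C2 → ℂ, IsSP n α ∧ IsSP n β ∧ IsSP n γ ∧
    ∀ z, h z = r z + cutC (zc z) * (α z * (Real.log (Complex.normSq (zc z)) : ℂ) + β z +
      γ z * (Complex.arg (zc z) : ℂ))

theorem IsCorner.zero (N n : ℕ) : IsCorner N n (fun _ => 0) fun _ => 0 where
  dec := Dec.zero uniqueDiffOn_closure_Omega
  smooth := contDiffOn_const
  face_zero _ _ := rfl
  face_one _ _ := rfl
  laplacian := ⟨fun _ => 0, Dec.zero uniqueDiffOn_closure_Omega,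
    Flat.zero uniqueDiffOn_closure_Omega corner_subset, fun z _ => by
      have hp : ∀ v, pd Omega v (fun _ : C2 => (0 : ℂ)) = fun _ => 0 := fun v => by
        funext z; simp [pd]
      simp [lap, hp]⟩
  expansion := ⟨fun _ => 0, Dec.zero uniqueDiffOn_closure_Omega, 0, 0, 0, IsSP.zero n, IsSP.zero n,
    IsSP.zero n, fun z => by simp⟩

theorem IsCorner.add {N n : ℕ} {b h b' h' : C2 → ℂ} (H : IsCorner N n b h) (H' : IsCorner N n b' h') :
    IsCorner N n (fun z => b z + b' z) fun z => h z + h' z where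
  dec := H.dec.add uniqueDiffOn_closure_Omega H'.dec
  smooth := H.smooth.add H'.smooth
  face_zero z hz := by simp [H.face_zero z hz, H'.face_zero z hz]
  face_one z hz := by simp [H.face_one z hz, H'.face_one z hz]
  laplacian := by
    obtain ⟨E, h1, h2, h3⟩ := H.laplacian
    obtain ⟨E', h1', h2', h3'⟩ := H'.laplacian
    refine ⟨fun z => E z + E' z, h1.add uniqueDiffOn_closure_Omega h1',
      h2.add uniqueDiffOn_closure_Omega corner_subset h2' h1 h1', fun z hz => ?_⟩
    rw [lap_add isOpen_Omega.uniqueDiffOn bv (H.smooth.differentiableOn (by simp))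
      (differentiableOn_pd isOpen_Omega H.smooth) (H'.smooth.differentiableOn (by simp))
      (differentiableOn_pd isOpen_Omega H'.smooth) hz]
    simp only []
    rw [h3 hz, h3' hz]
  expansion := by
    obtain ⟨r, hr, α, β, γ, h1, h2, h3, e⟩ := H.expansion
    obtain ⟨r', hr', α', β', γ', h1', h2', h3', e'⟩ := H'.expansion
    refine ⟨_, hr.add uniqueDiffOn_closure_Omega hr', _, _, _, h1.add h1', h2.add h2', h3.add h3',
      fun z => ?_⟩
    rw [e, e']
    ring

theorem IsCorner.sum {N n : ℕ} {ι : Type*} (s : Finset ι) {b h : ι → C2 → ℂ}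
    (H : ∀ i ∈ s, IsCorner N n (b i) (h i)) :
    IsCorner N n (fun z => ∑ i ∈ s, b i z) fun z => ∑ i ∈ s, h i z := by
  classical
  induction s using Finset.induction_on with
  | empty => simpa using IsCorner.zero N n
  | insert a s ha ih =>
    simp only [Finset.sum_insert ha]
    exact (H a (by simp)).add (ih fun i hi => H i (by simp [hi]))

/-- The sum stops at `j = N`: the Laplacian is then governed by `Q_N`, of degree `k + 2 N ≥ N + 1`,
hence flat to order `N`. The condition `k ≥ 2` gives every term degree at least two, so the sum is
`C¹` up to the boundary. In the expansion the terms of degree greater than `n` are of class `n` and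
form the remainder `r`; the others supply polynomials of degree at most `n`. -/
theorem exists_isCorner (N n : ℕ) {c : R2 → ℂ} (hc : ∀ N, Dec N Set.univ c) {k : ℕ} (hk : 2 ≤ k) :
    ∃ h, IsCorner N n (fun z => c (xc z) * ((cut (z (Sum.inr 0)) : ℂ) * (z (Sum.inr 0) : ℂ) ^ k)) h := by
  obtain ⟨Q, hQ, L0, L1, b0, b1, b2⟩ := exists_corner_sequence (k := k) (by omega)
  have hV : ∀ j, Q j ∈ Vd (k + 2 * j) := fun j => Wd_le_Vd _ (hQ j)
  have hsm : ∀ j, ContDiffOn ℝ ∞ (Q j) Uq := fun j => by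
    cases j with
    | zero => exact L0.1
    | succ j => exact (L1 j).1
  have hterm : ∀ (j m M : ℕ), M + 1 ≤ k + 2 * j →
      Dec M KO (fun z => negLap c m (xc z) * (cutC (zc z) * Q j (zc z))) ∧
      Flat KO corner M fun z => negLap c m (xc z) * (cutC (zc z) * Q j (zc z)) := fun j m M hM => by
    have := dec_cut_of_mem_Vd hM contDiff_cutC hasCompactSupport_cutC (hV j)
    exact ⟨dec_corner_tensor (dec_negLap hc m M) this.1,
      flat_corner_tensor (dec_negLap hc m M) this.1 this.2⟩
  refine ⟨cornerSum c Q N, ⟨?_, contDiffOn_cornerSum hc hsm N, fun z hz => ?_, fun z hz => ?_, ?_, ?_⟩⟩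
  · exact Dec.sum uniqueDiffOn_closure_Omega _ fun j _ => (hterm j j 1 (by omega)).1
  -- In the coordinate `y₂ + i y₁` the face `y₁ = 0` is the positive real axis and the face `y₂ = 0`
  -- the positive imaginary axis.
  · have hz1 : 0 ≤ z (Sum.inr 1) := (zc_mapsTo hz.1).1
    have e : zc z = ((z (Sum.inr 1) : ℝ) : ℂ) := Complex.ext rfl hz.2
    refine Finset.sum_eq_zero fun j _ => ?_
    rw [e, b0 j _ hz1, mul_zero, mul_zero]
  · have hz0 : 0 ≤ z (Sum.inr 0) := (zc_mapsTo hz.1).2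
    have e : zc z = ((z (Sum.inr 0) : ℝ) : ℂ) * Complex.I := by
      apply Complex.ext
      · simp [zc_re, hz.2]
      · simp [zc_im]
    rw [cornerSum, Finset.sum_range_succ', Finset.sum_eq_zero fun j _ => by
      rw [e, b2 j _ hz0, mul_zero, mul_zero], zero_add, e, b1 _ hz0, cutC_imag]
    rfl
  · obtain ⟨T, hT, e⟩ := lap_cornerSum hc L0 L1 N
    have := hterm N (N + 1) N (by omega)
    exact ⟨_, (this.1.const_mul uniqueDiffOn_closure_Omega (-1)).add uniqueDiffOn_closure_Omega
      (hT N).1, (this.2.const_mul uniqueDiffOn_closure_Omega corner_subset (-1) this.1).add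
      uniqueDiffOn_closure_Omega corner_subset (hT N).2
      (this.1.const_mul uniqueDiffOn_closure_Omega (-1)) (hT N).1, e⟩
  · choose A hA B hB C hC hd using fun j => exists_log_decomposition (hV j)
    set s := (Finset.range (N + 1)).filter fun j => k + 2 * j ≤ n
    set s' := (Finset.range (N + 1)).filter fun j => ¬ k + 2 * j ≤ n
    have sp : ∀ {A : ℕ → ℂ → ℂ}, (∀ j, A j ∈ Pd (k + 2 * j)) →
        IsSP n fun z => ∑ j ∈ s, negLap c j (xc z) * A j (zc z) := fun hA =>
      IsSP.sum s fun j hj => isSP_tensor (Finset.mem_filter.1 hj).2 (dec_negLap hc j) (hA j)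
    refine ⟨fun z => ∑ j ∈ s', negLap c j (xc z) * (cutC (zc z) * Q j (zc z)),
      Dec.sum uniqueDiffOn_closure_Omega _ fun j hj => (hterm j j n ?_).1, _, _, _, sp hA, sp hB, sp hC,
      fun z => ?_⟩
    · have := (Finset.mem_filter.1 hj).2
      omega
    · rw [cornerSum, ← Finset.sum_filter_not_add_sum_filter _ (fun j => k + 2 * j ≤ n)]
      congr 1
      simp only [Finset.mul_sum, Finset.sum_mul, ← Finset.sum_add_distrib]
      refine Finset.sum_congr rfl fun j _ => ?_
      rw [hd]
      ring

end Corner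


/-! ### The corrector `v` for the full Dirichlet problem -/

section Corrector

/-- The embedding of the real parts. -/
noncomputable def xe : R2 →L[ℝ] C2 :=
  LinearMap.toContinuousLinearMap
    { toFun := fun x => WithLp.toLp 2 (Sum.elim (fun j => x j) fun _ => 0)
      map_add' := fun _ _ => by ext i; cases i <;> simp
      map_smul' := fun _ _ => by ext i; cases i <;> simp }

theorem xe_inl (x : R2) (j : Fin 2) : xe x (Sum.inl j) = x j := rfl

theorem xe_inr (x : R2) (j : Fin 2) : xe x (Sum.inr j) = 0 := rfl

theorem xe_mem (x : R2) : xe x ∈ KO := by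
  rw [KO, closure_Omega]
  exact fun j => (xe_inr x j).ge

theorem norm_le_xe (x : R2) : ‖x‖ ≤ 1 * ‖xe x‖ := by
  rw [one_mul, EuclideanSpace.norm_eq, EuclideanSpace.norm_eq]
  refine Real.sqrt_le_sqrt ?_
  rw [Fintype.sum_sum_type]
  simp only [xe_inl, xe_inr]
  simp

theorem py_eq_xe {z : C2} (hz : z ∈ face 1) : py 0 z = xe (xc z) := by
  ext i
  rw [py_coord]
  rcases i with j | j
  · simp [xe_inl, xc_apply]
  · rw [xe_inr]
    rcases (by fin_cases j <;> simp : j = 0 ∨ j = 1) with rfl | rfl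
    · simp
    · simpa using hz.2

theorem py_mem_corner {z : C2} (hz : z ∈ face 1) : py 0 z ∈ corner :=
  ⟨py_mem_face 0 hz.1, py_mapsTo_face hz⟩

theorem py_mapsTo_corner : Set.MapsTo (py 0) corner corner := fun _ hz => py_mem_corner hz.2

theorem lap_add_Omega {h h' : C2 → ℂ} (h1 : ContDiffOn ℝ 2 h Omega) (h2 : ContDiffOn ℝ 2 h' Omega) :
    Set.EqOn (lap Omega bv fun z => h z + h' z) (fun z => lap Omega bv h z + lap Omega bv h' z) Omega :=
  lap_add isOpen_Omega.uniqueDiffOn bv (h1.differentiableOn (by simp))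
    (fun v => (contDiffOn_pd isOpen_Omega h1 (m := 1) (by norm_num) v).differentiableOn (by simp))
    (h2.differentiableOn (by simp))
    (fun v => (contDiffOn_pd isOpen_Omega h2 (m := 1) (by norm_num) v).differentiableOn (by simp))

/-- An approximate solution of the Dirichlet problem with a residual that is flat at the boundary. -/
theorem exists_corrector {R : C2 → ℂ} (hR : ∀ N, Dec N KO R) (n : ℕ) : ∃ v S : C2 → ℂ,
    Dec 1 KO v ∧ ContDiffOn ℝ 2 v Omega ∧ (∀ j, ∀ z ∈ face j, v z = 0) ∧ Dec n KO S ∧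
    Flat KO (face 0 ∪ face 1) (n + 1) S ∧ Set.EqOn (lap Omega bv v) (fun z => S z - R z) Omega ∧
    ∃ r : C2 → ℂ, Dec n KO r ∧ ∃ α β γ : C2 → ℂ, IsSP n α ∧ IsSP n β ∧ IsSP n γ ∧
      ∀ z, v z = r z + cutC (zc z) * (α z * (Real.log (Complex.normSq (zc z)) : ℂ) + β z +
        γ z * (Complex.arg (zc z) : ℂ)) := by
  have hU := uniqueDiffOn_closure_Omega
  -- The orders are chosen backwards: flattening `y₂ = 0` to order `n + 1` needs `m₃` derivatives,
  -- and flattening `y₁ = 0` to order `m₃` needs `m₂`.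
  set m₃ := 2 * (n + 1) + bud (n + 1) with hm₃
  set m₂ := 2 * m₃ + bud m₃ with hm₂
  have dr : ∀ m N, Dec N KO (resid 0 R m) := fun m N => dec_resid (hR _)
  set v₁ := corrSum 0 R m₂
  have d₁ : ∀ N, Dec N KO v₁ := fun N => dec_corrSum (hR _)
  set g : ℕ → R2 → ℂ := fun k x => (pd KO (bv (Sum.inr 0)))^[k] (resid 0 R k) (xe x) with hg
  have dg : ∀ k N, Dec N Set.univ (g k) := fun k N =>
    Dec.comp_clm uniqueDiffOn_univ (fun x _ => xe_mem x) norm_le_xe (dec_iterate_pd (dr k _))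
  -- On `y₂ = 0` the corrector of order `k` equals `-cut y₁ · y₁^(k+2)/(k+2)!` times `g k`; the
  -- corner function takes the opposite values there, and keeps the value zero on `y₁ = 0`.
  choose h hh using fun k => exists_isCorner m₂ n (c := fun x => (1 / (k + 2).factorial : ℂ) * g k x)
    (fun N => (dg k N).const_mul uniqueDiffOn_univ _) (k := k + 2) (by omega)
  have hc := IsCorner.sum (Finset.range m₂) fun k _ => hh k
  set h₁ : C2 → ℂ := fun z => ∑ k ∈ Finset.range m₂, h k z
  have hsum : ∀ z ∈ face 1, v₁ z + h₁ z = 0 := fun z hz => by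
    rw [hc.face_one z hz]
    simp only [v₁, corrSum, ← Finset.sum_add_distrib]
    refine Finset.sum_eq_zero fun k _ => ?_
    simp only [corr, py_eq_xe hz, negMono, yc_apply, hg]
    push_cast
    ring
  obtain ⟨E, hE1, hE2, hE3⟩ := hc.laplacian
  set R₁ := resid 0 R m₂
  have f₁ : Flat KO corner m₂ R₁ := (flat_resid_face (hR _)).subset Set.inter_subset_left
  -- The corner error `E` is flat at the corner, but may spoil the flatness on `y₁ = 0`, so this
  -- face is treated again. Flatness at the corner now makes the new corrector `v₂` vanish on `y₂ =
  -- 0`, and no new boundary values arise.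
  set R₂ : C2 → ℂ := fun z => R₁ z + E z
  have dR₂ : Dec m₂ KO R₂ := (dr m₂ m₂).add hU hE1
  have f₂ : Flat KO corner m₂ R₂ := f₁.add hU corner_subset hE2 (dr m₂ m₂) hE1
  set v₂ := corrSum 0 R₂ m₃
  set R₃ := resid 0 R₂ m₃
  have dR₃ : Dec m₃ KO R₃ := dec_resid (dR₂.mono (by omega))
  have f₃ : Flat KO (face 0) m₃ R₃ := flat_resid_face dR₂
  -- Treating `y₂ = 0` does no harm to `y₁ = 0`: the projection `py 1` preserves that face, where
  -- `R₃` is flat.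
  set v₃ := corrSum 1 R₃ (n + 1)
  set R₄ := resid 1 R₃ (n + 1)
  have d₂ : Dec (n + 2) KO v₂ := dec_corrSum (dR₂.mono (by omega))
  have d₃ : Dec (n + 2) KO v₃ := dec_corrSum (dR₃.mono (by omega))
  have cd : ∀ {h : C2 → ℂ}, Dec 2 KO h → ContDiffOn ℝ 2 h Omega := fun hh =>
    (show ContDiffOn ℝ (2 : ℕ) _ KO from hh.contDiffOn).mono Omega_subset
  have c₁ := cd (d₁ 2)
  have c₂ := cd (d₂.mono (by omega))
  have c₃ := cd (d₃.mono (by omega))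
  have ch : ContDiffOn ℝ 2 h₁ Omega := contDiffOn_infty.1 hc.smooth 2
  refine ⟨fun z => ((v₁ z + h₁ z) + v₂ z) + v₃ z, R₄, ?_, ((c₁.add ch).add c₂).add c₃, ?_,
    dec_resid (dR₃.mono (by omega)), Flat.union ?_ (flat_resid_face dR₃), fun z hz => ?_, ?_⟩
  · exact (((d₁ 1).add hU hc.dec).add hU (d₂.mono (by omega))).add hU (d₃.mono (by omega))
  · intro j z hz
    rcases (by fin_cases j <;> simp : j = 0 ∨ j = 1) with rfl | rfl
    · have e₁ : v₁ z = 0 := corrSum_eq_zero hz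
      have e₂ : v₂ z = 0 := corrSum_eq_zero hz
      have e₃ : v₃ z = 0 := corrSum_eq_zero_of_flat (face_subset 0) py_mapsTo_face
        (dR₃.mono (by omega)) (f₃.mono (by omega)) (py_mapsTo_face hz)
      simp only [e₁, e₂, e₃, hc.face_zero z hz, add_zero]
    · have e₂ : v₂ z = 0 := corrSum_eq_zero_of_flat corner_subset py_mapsTo_corner
        (dR₂.mono (by omega)) (f₂.mono (by omega)) (py_mem_corner hz)
      have e₃ : v₃ z = 0 := corrSum_eq_zero hz
      simp only [hsum z hz, e₂, e₃, add_zero]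
  · exact flat_resid (face_subset 0) py_mapsTo_face (dR₃.mono (by omega)) (f₃.mono (by omega))
  · have hz' := Omega_subset hz
    have r₁ : R₁ z = R z + lap KO bv v₁ z := resid_eq (hR _) hz'
    have r₃ : R₃ z = R₂ z + lap KO bv v₂ z := resid_eq (dR₂.mono (by omega)) hz'
    have r₄ : R₄ z = R₃ z + lap KO bv v₃ z := resid_eq (dR₃.mono (by omega)) hz'
    rw [lap_add_Omega ((c₁.add ch).add c₂) c₃ hz]
    simp only []
    rw [lap_add_Omega (c₁.add ch) c₂ hz]
    simp only []
    rw [lap_add_Omega c₁ ch hz]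
    simp only []
    rw [hE3 hz, r₄, r₃, lap_Omega_eq _ hz, lap_Omega_eq _ hz, lap_Omega_eq _ hz]
    simp only [R₂, r₁]
    ring
  · obtain ⟨r, hr, α, β, γ, h1, h2, h3, e⟩ := hc.expansion
    refine ⟨_, (((d₁ n).add hU hr).add hU (d₂.mono (by omega))).add hU (d₃.mono (by omega)),
      α, β, γ, h1, h2, h3, fun z => ?_⟩
    simp only [e]
    ring

theorem convex_KO : Convex ℝ KO := convex_Omega.closure

/-- A function vanishing on a face is bounded by the distance to this face. -/
theorem exists_bound_of_face {v : C2 → ℂ} (hv : Dec 1 KO v) {j : Fin 2}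
    (h0 : ∀ z ∈ face j, v z = 0) : ∃ C : ℝ, ∀ z ∈ Omega, ‖v z‖ ≤ C * z (Sum.inr j) := by
  choose M hM using fun i => (hv.pd (bv i)).dec0.2 0
  refine ⟨∑ i, M i, fun z hz => ?_⟩
  have hz' := Omega_subset hz
  have h1 := convex_KO.norm_image_sub_le_of_norm_fderivWithin_le (𝕜 := ℝ) hv.differentiableOn
    (C := ∑ i, M i) (fun w hw => (norm_clm_le _).trans (Finset.sum_le_sum fun i _ => by
      simpa [pd] using hM i w hw)) (py_mapsTo j hz') hz'
  rw [h0 _ (py_mem_face j hz'), sub_zero, py_apply, sub_sub_cancel, norm_smul] at h1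
  simpa [bv, abs_of_pos (hz j)] using h1

end Corrector


/-! ### The weak equation for `∂u₁/∂z̄₂` -/

section WeakEquation

theorem IsTest.lap {U : Set C2} {φ : C2 → ℂ} (hφ : IsTest U φ) : IsTest U (lap Set.univ bv φ) := by
  have h : tsupport (DbarNeumann.lap Set.univ bv φ) ⊆ tsupport φ := by
    refine closure_minimal (fun z hz => ?_) (isClosed_tsupport φ)
    obtain ⟨i, -, hi⟩ := Finset.exists_ne_zero_of_sum_ne_zero hz
    exact tsupport_pd_subset φ (bv i) (tsupport_pd_subset _ (bv i) (subset_tsupport _ hi))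
  exact ⟨ContDiff.sum fun i _ => contDiff_pd (contDiff_pd hφ.smooth _) _,
    hφ.compact.of_isClosed_subset (isClosed_tsupport _) h, h.trans hφ.support⟩

theorem pd_univ_comm {φ : C2 → ℂ} (hφ : ContDiff ℝ ∞ φ) (v w : C2) :
    pd Set.univ v (pd Set.univ w φ) = pd Set.univ w (pd Set.univ v φ) :=
  funext fun z => pd_comm uniqueDiffOn_univ (by simp) (contDiff_infty.1 hφ 2).contDiffOn v w
    (Set.mem_univ z)

theorem pd_lap {φ : C2 → ℂ} (hφ : ContDiff ℝ ∞ φ) (v : C2) :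
    pd Set.univ v (lap Set.univ bv φ) = lap Set.univ bv (pd Set.univ v φ) := by
  have hd : ∀ i : Ix, Differentiable ℝ (pd Set.univ (bv i) (pd Set.univ (bv i) φ)) := fun i =>
    (contDiff_pd (contDiff_pd hφ _) _).differentiable (by simp)
  have e : pd Set.univ v (lap Set.univ bv φ) =
      fun z => ∑ i, pd Set.univ v (pd Set.univ (bv i) (pd Set.univ (bv i) φ)) z := by
    funext z
    simp only [pd_eq_fderiv (K := Set.univ) univ_mem v]
    have : DbarNeumann.lap Set.univ bv φ = fun z => ∑ i, pd Set.univ (bv i) (pd Set.univ (bv i) φ) z :=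
      rfl
    rw [this, fderiv_fun_sum fun i _ => (hd i) z]
    simp
  rw [e]
  funext z
  refine Finset.sum_congr rfl fun i _ => ?_
  rw [pd_univ_comm (contDiff_pd hφ _), pd_univ_comm hφ]

theorem lap_eq_laplacian {h : C2 → ℂ} (hh : ContDiffOn ℝ 2 h Omega) {z : C2} (hz : z ∈ Omega) :
    lap Omega bv h z = Laplacian.laplacian h z := by
  have hd : DifferentiableAt ℝ (fderiv ℝ h) z :=
    ((hh.contDiffAt (isOpen_Omega.mem_nhds hz)).fderiv_right (m := 1) (by norm_num)).differentiableAt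
      (by simp)
  rw [InnerProductSpace.laplacian_eq_iteratedFDeriv_orthonormalBasis h
    (EuclideanSpace.basisFun Ix ℝ)]
  refine Finset.sum_congr rfl fun i _ => ?_
  rw [pd_pd_eq_fderiv (by rwa [isOpen_Omega.interior_eq]), iteratedFDeriv_two_apply,
    fderiv_clm_apply hd (differentiableAt_const _)]
  simp [bv]

theorem dbar_eq {k : Fin 2} {h : C2 → ℂ} {z : C2} (hz : z ∈ Omega) : dbar k h z =
    (1 / 2 : ℂ) * (pd Omega (bv (Sum.inl k)) h z + Complex.I * pd Omega (bv (Sum.inr k)) h z) := by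
  rw [pd_eq_fderiv (isOpen_Omega.mem_nhds hz), pd_eq_fderiv (isOpen_Omega.mem_nhds hz)]
  rfl

/-- The derivative of the data, `2 ∂f/∂z̄_k`. -/
noncomputable def dbarData (k : Fin 2) (f : C2 → ℂ) : C2 → ℂ := fun z =>
  pd KO (bv (Sum.inl k)) f z + Complex.I * pd KO (bv (Sum.inr k)) f z

theorem dec_dbarData (k : Fin 2) {f : C2 → ℂ} (hf : ∀ N, Dec N KO f) (N : ℕ) :
    Dec N KO (dbarData k f) :=
  ((hf (N + 1)).pd _).add uniqueDiffOn_closure_Omega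
    (((hf (N + 1)).pd _).const_mul uniqueDiffOn_closure_Omega _)

theorem contDiffOn_dbar {k : Fin 2} {h : C2 → ℂ} (hh : ContDiffOn ℝ 2 h Omega) :
    ContDiffOn ℝ 1 (dbar k h) Omega := by
  have h1 : ∀ v, ContDiffOn ℝ 1 (pd Omega v h) Omega := contDiffOn_pd isOpen_Omega hh (by norm_num)
  exact (contDiffOn_const.mul ((h1 (bv (Sum.inl k))).add
    (contDiffOn_const.mul (h1 (bv (Sum.inr k)))))).congr fun z hz => dbar_eq hz

/-- As `h` is only `C²`, the Laplacian of its derivative is not available. The derivative is moved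
to the test function, where it commutes with the Laplacian; Green's formula brings in the equation,
and the derivative is moved back to `f`. -/
theorem integral_pd_mul_lap {h f φ : C2 → ℂ} (hh : ContDiffOn ℝ 2 h Omega)
    (hf : ContDiffOn ℝ 1 f Omega) (e : ∀ z ∈ Omega, Laplacian.laplacian h z = -2 * f z)
    (hφ : IsTest Omega φ) (v : C2) : ∫ z in Omega, pd Omega v h z * lap Set.univ bv φ z =
      -2 * ∫ z in Omega, pd Omega v f z * φ z := by
  have one : (1 : WithTop ℕ∞) ≤ ∞ := by exact_mod_cast le_top
  have t1 := hφ.lap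
  have t2 := hφ.pd v
  rw [setIntegral_pd_mul isOpen_Omega (hh.of_le (by norm_num)) (t1.smooth.of_le one) t1.compact
    t1.support, pd_lap hφ.smooth, setIntegral_lap isOpen_Omega hh t2,
    setIntegral_pd_mul isOpen_Omega hf (hφ.smooth.of_le one) hφ.compact hφ.support,
    ← integral_neg, mul_neg, ← integral_const_mul, ← integral_neg]
  refine setIntegral_congr_fun isOpen_Omega.measurableSet fun z hz => ?_
  rw [lap_eq_laplacian hh hz, e z hz]
  ring

theorem integral_dbar_mul_lap {h f φ : C2 → ℂ} (hh : ContDiffOn ℝ 2 h Omega)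
    (hf : ContDiffOn ℝ 1 f Omega) (e : ∀ z ∈ Omega, Laplacian.laplacian h z = -2 * f z)
    (hφ : IsTest Omega φ) (k : Fin 2) : ∫ z in Omega, dbar k h z * lap Set.univ bv φ z =
      -∫ z in Omega, dbarData k f z * φ z := by
  have i1 : ∀ v, IntegrableOn (fun z => pd Omega v h z * lap Set.univ bv φ z) Omega := fun v =>
    setIntegral_mul_integrableOn isOpen_Omega
      (contDiffOn_pd isOpen_Omega hh (m := 1) (by norm_num) v).continuousOn hφ.lap
  have i2 : ∀ v, IntegrableOn (fun z => pd Omega v f z * φ z) Omega := fun v =>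
    setIntegral_mul_integrableOn isOpen_Omega
      (contDiffOn_pd isOpen_Omega hf (m := 0) (by norm_num) v).continuousOn hφ
  have e1 : ∫ z in Omega, dbar k h z * lap Set.univ bv φ z = ∫ z in Omega,
      ((1 / 2 : ℂ) * (pd Omega (bv (Sum.inl k)) h z * lap Set.univ bv φ z) +
        (Complex.I / 2) * (pd Omega (bv (Sum.inr k)) h z * lap Set.univ bv φ z)) :=
    setIntegral_congr_fun isOpen_Omega.measurableSet fun z hz => by
      rw [dbar_eq hz]
      ring
  have e2 : ∫ z in Omega, dbarData k f z * φ z = ∫ z in Omega,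
      (pd Omega (bv (Sum.inl k)) f z * φ z + Complex.I * (pd Omega (bv (Sum.inr k)) f z * φ z)) :=
    setIntegral_congr_fun isOpen_Omega.measurableSet fun z hz => by
      have hz' : KO ∈ 𝓝 z := mem_of_superset (isOpen_Omega.mem_nhds hz) Omega_subset
      simp only [dbarData, pd_eq_fderiv hz', pd_eq_fderiv (isOpen_Omega.mem_nhds hz)]
      ring
  rw [e1, e2, integral_add ((i1 _).const_mul _) ((i1 _).const_mul _), integral_const_mul,
    integral_const_mul, integral_add (i2 _) ((i2 _).const_mul _), integral_const_mul,
    integral_pd_mul_lap hh hf e hφ, integral_pd_mul_lap hh hf e hφ]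
  ring

theorem FaceNull.congr {j : Fin 2} {h h' : C2 → ℂ} (hh : FaceNull j h) (e : Set.EqOn h' h Omega) :
    FaceNull j h' := fun α D hα => (hh α D hα).congr fun s =>
  setIntegral_congr_fun isOpen_Omega.measurableSet fun z hz => by
    rw [e hz]

/-- Where `‖w‖ > κ` one has `‖w‖ ≤ κ^(1-p) ‖w‖^p`, as `p ≥ 1`, and the right-hand side is
integrable; elsewhere `κ` itself is a bound. -/
theorem smallPlusInt_of_memLp {w : C2 → ℂ} {p : ENNReal} (h1 : 2 < p) (h2 : p < ⊤)
    (hw : MemLp w p (volume.restrict Omega)) : SmallPlusInt (Omega.indicator w) := by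
  have hp0 : p ≠ 0 := (lt_trans (by simp) h1).ne'
  have hp1 : 1 ≤ p.toReal := by
    have := (ENNReal.toReal_lt_toReal (by simp) h2.ne).2 h1
    simp at this
    linarith
  have hi : IntegrableOn (fun z => ‖w z‖ ^ p.toReal) Omega := hw.integrable_norm_rpow hp0 h2.ne
  intro κ hκ
  refine ⟨fun z => κ ^ (1 - p.toReal) * Omega.indicator (fun z => ‖w z‖ ^ p.toReal) z,
    (hi.integrable_indicator isOpen_Omega.measurableSet).const_mul _, fun z => ?_⟩
  by_cases hz : z ∈ Omega
  · simp only [Set.indicator_of_mem hz]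
    rcases le_total ‖w z‖ κ with hle | hle
    · have : 0 ≤ κ ^ (1 - p.toReal) * ‖w z‖ ^ p.toReal := by positivity
      linarith
    · have hw0 : 0 < ‖w z‖ := hκ.trans_le hle
      have e : ‖w z‖ = ‖w z‖ ^ (1 - p.toReal) * ‖w z‖ ^ p.toReal := by
        rw [← Real.rpow_add hw0]; simp
      have h3 : ‖w z‖ ^ (1 - p.toReal) ≤ κ ^ (1 - p.toReal) :=
        Real.rpow_le_rpow_of_nonpos hκ hle (by linarith)
      have h4 : ‖w z‖ ^ (1 - p.toReal) * ‖w z‖ ^ p.toReal ≤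
          κ ^ (1 - p.toReal) * ‖w z‖ ^ p.toReal := by gcongr
      linarith
  · simp [Set.indicator_of_notMem hz, hκ.le]

end WeakEquation

/-! ### Partial Fourier transform and slices -/

section PartialFourier

theorem integrable_exp_mul {g : R2 → ℂ} (hg : Integrable g) (ξ : R2) :
    Integrable fun x : R2 => Complex.exp (-Complex.I * ((inner ℝ x ξ : ℝ) : ℂ)) * g x := by
  refine hg.norm.mono' ((Continuous.aestronglyMeasurable (by fun_prop)).mul hg.1)
    (Eventually.of_forall fun x => ?_)
  rw [norm_mul, Complex.norm_exp]
  simp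

/-- The transform without `2π` in the exponent is the standard one composed with the dilation `ξ ↦ ξ
/ (2π)`, and both preserve Schwartz functions. -/
theorem exists_schwartz_fourier (c : 𝓢(R2, ℂ)) : ∃ C : 𝓢(R2, ℂ), ∀ ξ,
    ∫ x : R2, Complex.exp (-Complex.I * ((inner ℝ x ξ : ℝ) : ℂ)) * c x = C ξ := by
  have h0 : (2 * Real.pi)⁻¹ ≠ 0 := inv_ne_zero (by positivity)
  refine ⟨SchwartzMap.compCLMOfContinuousLinearEquiv ℂ
    (ContinuousLinearEquiv.smulLeft (Units.mk0 _ h0)) (FourierTransform.fourier c), fun ξ => ?_⟩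
  rw [SchwartzMap.compCLMOfContinuousLinearEquiv_apply, Function.comp_apply, SchwartzMap.fourier_coe,
    Real.fourier_eq']
  refine integral_congr_ae (Eventually.of_forall fun x => ?_)
  simp only [smul_eq_mul]
  congr 2
  rw [show (ContinuousLinearEquiv.smulLeft (Units.mk0 _ h0)) ξ = (2 * Real.pi)⁻¹ • ξ from rfl,
    inner_smul_right]
  push_cast
  have : (Real.pi : ℂ) ≠ 0 := by exact_mod_cast Real.pi_ne_zero
  field_simp

theorem pt_inl (x y : R2) (j : Fin 2) : pt x y (Sum.inl j) = x j := rfl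

theorem pt_inr (x y : R2) (j : Fin 2) : pt x y (Sum.inr j) = y j := rfl

theorem xc_pt (x y : R2) : xc (pt x y) = x := rfl

theorem IsSP.integrable {n : ℕ} {F : C2 → ℂ} (hF : IsSP n F) (y : R2) :
    Integrable fun x : R2 => F (pt x y) := by
  obtain ⟨c, hc⟩ := hF
  simp only [hc, xc_pt, pt_inr, schwartzPoly]
  exact integrable_finsetSum _ fun d _ => integrable_finsetSum _ fun ab _ =>
    ((c ab.1 ab.2).integrable.mul_const _).mul_const _

theorem IsSP.partialFT {n : ℕ} {F : C2 → ℂ} (hF : IsSP n F) : ∃ C : ℕ → ℕ → 𝓢(R2, ℂ), ∀ ξ y : R2,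
    partialFT F ξ y = schwartzPoly n C ξ (y 0) (y 1) := by
  obtain ⟨c, hc⟩ := hF
  choose C hC using fun a b => exists_schwartz_fourier (c a b)
  refine ⟨C, fun ξ y => ?_⟩
  have hi : ∀ a b, Integrable fun x : R2 =>
      Complex.exp (-Complex.I * ((inner ℝ x ξ : ℝ) : ℂ)) * (c a b x * (y 0 : ℂ) ^ a * (y 1 : ℂ) ^ b) :=
    fun a b => integrable_exp_mul (((c a b).integrable.mul_const _).mul_const _) ξ
  simp only [DbarNeumann.partialFT, hc, xc_pt, pt_inr, schwartzPoly, Finset.mul_sum]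
  rw [integral_finsetSum _ fun d _ => integrable_finsetSum _ fun ab _ => hi _ _]
  refine Finset.sum_congr rfl fun d _ => ?_
  rw [integral_finsetSum _ fun ab _ => hi _ _]
  refine Finset.sum_congr rfl fun ab _ => ?_
  rw [← hC, mul_assoc, ← integral_mul_const]
  refine integral_congr_ae (Eventually.of_forall fun x => ?_)
  simp only []
  ring

theorem continuous_pt_left (y : R2) : Continuous fun x : R2 => pt x y := by
  refine (PiLp.continuous_toLp 2 _).comp (continuous_pi fun i => ?_)
  rcases i with j | j
  · exact (EuclideanSpace.proj (𝕜 := ℝ) j).continuous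
  · exact continuous_const

theorem wt_pt_le (x y : R2) : wt (pt x y) ≤ m1 (x 0) * m1 (x 1) := by
  unfold wt prodFn
  rw [Fintype.prod_sum_type]
  simp only [Fin.prod_univ_two, pt_inl, pt_inr]
  have := m1_pos (x 0)
  have := m1_pos (x 1)
  exact mul_le_of_le_one_right (by positivity)
    (mul_le_one₀ (m1_le_one _) (m1_pos _).le (m1_le_one _))

theorem Dec0.integrable_slice {h : C2 → ℂ} (hh : Dec0 KO h) {y : R2} (hy : ∀ j, 0 ≤ y j) :
    Integrable fun x : R2 => h (pt x y) := by
  have hm : ∀ x, pt x y ∈ KO := fun x => by rw [KO, closure_Omega]; exact hy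
  obtain ⟨M, hM0, hM⟩ := hh.le_wt_on
  refine (integrable_m1_R2.const_mul M).mono' (hh.1.comp_continuous (continuous_pt_left y)
    hm).aestronglyMeasurable (Eventually.of_forall fun x => ?_)
  exact (hM _ (hm x)).trans (mul_le_mul_of_nonneg_left (wt_pt_le x y) hM0)

/-- Both signs are `1` where `y₁, y₂ > 0`, so the odd extension is invisible in the range of the
final formula. -/
theorem oddExt_pt {h : C2 → ℂ} (x : R2) {y : R2} (hy : ∀ j, 0 < y j) :
    oddExt h (pt x y) = h (pt x y) := by
  have e : pt (WithLp.toLp 2 fun j => pt x y (Sum.inl j))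
      (WithLp.toLp 2 fun j => |pt x y (Sum.inr j)|) = pt x y := by
    ext i
    rcases i with j | j
    · rfl
    · exact abs_of_pos (hy j)
  rw [oddExt, e, pt_inr, pt_inr, Real.sign_of_pos (hy 0), Real.sign_of_pos (hy 1)]
  simp

theorem arg_eq_arctan {s t : ℝ} (ht : 0 < t) : Complex.arg ⟨t, s⟩ = Real.arctan (s / t) := by
  have h := abs_lt.1 (Complex.abs_arg_lt_pi_div_two_iff.2 (Or.inl ht) : |Complex.arg ⟨t, s⟩| < _)
  have h2 := Complex.tan_arg ⟨t, s⟩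
  simp only [] at h2
  rw [← h2, Real.arctan_tan h.1 h.2]

end PartialFourier

/-! ### Splitting `∂u₁/∂z̄₂` into corrector and potential -/

section Representation

theorem contDiff_altPot {n : ℕ} {R : C2 → ℂ} (hR : Dec n Set.univ R) : ContDiff ℝ n (altPot R) :=
  ContDiff.sum fun p _ => contDiff_const.mul ((contDiff_heatPot hR).comp (contDiff_refl p))

/-- Decomposition of `∂u₁/∂z̄₂` into a corrector and a potential. -/
theorem dbar_eq_corrector_add_altPot {f u : Fin 2 → C2 → ℂ} (hf : ∀ j, IsSchwartzOn KO (f j))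
    (hu : IsSolution f u) {v S : C2 → ℂ} {n : ℕ} (hv : Dec 1 KO v) (hv2 : ContDiffOn ℝ 2 v Omega)
    (hv0 : ∀ j, ∀ z ∈ face j, v z = 0) (hS : Dec n KO S) (hSf : Flat KO (face 0 ∪ face 1) (n + 1) S)
    (e : Set.EqOn (lap Omega bv v) (fun z => S z - dbarData 1 (f 0) z) Omega) {a : C2}
    (ha : a ∈ Omega) : dbar 1 (u 0) a = v a + altPot (KO.indicator S) a := by
  have hu2 := hu.contDiffOn 0
  have hf1 : ContDiffOn ℝ 1 (f 0) Omega := ((hf 0).1.mono Omega_subset).of_le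
    (by exact_mod_cast le_top)
  set w := dbar 1 (u 0) with hw
  have hw1 : ContDiffOn ℝ 1 w Omega := contDiffOn_dbar hu2
  obtain ⟨p, hp1, hp2, -, hwp⟩ := hu.memLp 0 1 (by simp)
  set H : C2 → ℂ := fun z => Omega.indicator w z + Omega.indicator (fun z => -v z) z with hH
  have hHe : Set.EqOn H (fun z => w z - v z) Omega := fun z hz => by
    simp only [hH, Set.indicator_of_mem hz]
    ring
  have hS0 : ∀ z ∉ Omega, KO.indicator S z = 0 := fun z hz => by
    by_cases hzK : z ∈ KO
    · rw [Set.indicator_of_mem hzK]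
      refine hSf.1 z (frontier_KO ?_)
      rw [isClosed_closure.frontier_eq, interior_closure_Omega]
      exact ⟨hzK, hz⟩
    · exact Set.indicator_of_notMem hzK _
  have hvs : SmallPlusInt (Omega.indicator fun z => -v z) := by
    obtain ⟨M, hM0, hM⟩ := hv.dec0.le_wt_on
    refine smallPlusInt_of_le_wt (M := M) fun z => ?_
    by_cases hz : z ∈ Omega
    · rw [Set.indicator_of_mem hz, norm_neg]
      exact hM z (Omega_subset hz)
    · rw [Set.indicator_of_notMem hz, norm_zero]
      exact mul_nonneg hM0 (wt_pos z).le
  -- On `y₁ = 0` this is the Dirichlet condition for `u₁`, because `∂/∂z̄₂` is tangential there; on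
  -- `y₂ = 0` it is the second boundary condition itself.
  have hface : ∀ j, FaceNull j w := by
    intro j
    rcases (by fin_cases j <;> simp : j = 0 ∨ j = 1) with rfl | rfl
    · obtain ⟨q, hq1, hq2, hq⟩ := hu.boundary_dirichlet 0
      exact faceNull_dbar (by simp) (hu2.of_le (by norm_num))
        (tendsto_strip hu2.continuousOn hq1 (hq2.trans (by simp)) hq)
    · obtain ⟨q, hq1, hq2, hq⟩ := hu.boundary_dbar 0 1 (by simp)
      exact faceNull_of_strip (tendsto_strip hw1.continuousOn hq1 hq2 hq)
  have key := representation (H := H) (R := KO.indicator S) (a := a)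
    ((hw1.continuousOn.sub hv2.continuousOn).congr hHe)
    (fun z hz => by simp [hH, Set.indicator_of_notMem hz])
    ((smallPlusInt_of_memLp hp1 hp2 hwp).add hvs)
    (Dec.indicator isClosed_closure frontier_KO hS hSf).dec0 hS0 (fun φ hφ => ?_) (fun j => ?_) ha
  · rw [hHe ha] at key
    rw [← key]
    ring
  · have c1 := setIntegral_mul_integrableOn isOpen_Omega hw1.continuousOn hφ.lap
    have c2 := setIntegral_mul_integrableOn isOpen_Omega hv2.continuousOn hφ.lap
    have hR : ContinuousOn (dbarData 1 (f 0)) Omega :=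
      (dec_dbarData 1 (fun N => (hf 0).dec uniqueDiffOn_closure_Omega) 0).dec0.1.mono Omega_subset
    have c3 := setIntegral_mul_integrableOn isOpen_Omega hR hφ
    have c4 := setIntegral_mul_integrableOn isOpen_Omega (hS.dec0.1.mono Omega_subset) hφ
    have e1 : ∫ z in Omega, H z * lap Set.univ bv φ z =
        ∫ z in Omega, (w z * lap Set.univ bv φ z - v z * lap Set.univ bv φ z) :=
      setIntegral_congr_fun isOpen_Omega.measurableSet fun z hz => by
        rw [hHe hz]
        ring
    have e2 : ∫ z in Omega, lap Omega bv v z * φ z =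
        ∫ z in Omega, (S z * φ z - dbarData 1 (f 0) z * φ z) :=
      setIntegral_congr_fun isOpen_Omega.measurableSet fun z hz => by
        rw [e hz]
        ring
    have e3 : ∫ z in Omega, KO.indicator S z * φ z = ∫ z in Omega, S z * φ z :=
      setIntegral_congr_fun isOpen_Omega.measurableSet fun z hz => by
        rw [Set.indicator_of_mem (Omega_subset hz)]
    rw [e1, integral_sub c1 c2, integral_dbar_mul_lap hu2 hf1 (hu.laplacian_eq 0) hφ,
      setIntegral_lap isOpen_Omega hv2 hφ, e2, integral_sub c4 c3, e3]
    ring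
  · obtain ⟨C, hC⟩ := exists_bound_of_face hv (hv0 j)
    exact ((hface j).sub (faceNull_of_bound hC) hw1.continuousOn hv2.continuousOn).congr hHe

end Representation

end DbarNeumann

/-! ### The asymptotic expansion of the Fourier transform -/

theorem mainTheorem10 (f u : Fin 2 → DbarNeumann.C2 → ℂ)
    (hf : ∀ j, DbarNeumann.IsSchwartzOn (closure DbarNeumann.Omega) (f j))
    (hu : DbarNeumann.IsSolution f u) (n : ℕ) :
    ∃ (A B C : ℕ → ℕ → 𝓢(DbarNeumann.R2, ℂ)) (d : DbarNeumann.C2 → ℂ),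
      ContDiffOn ℝ n d (closure DbarNeumann.Omega) ∧
      (∀ y₁ y₂ : ℝ, 0 < y₁ → 0 < y₂ →
        Integrable (fun x : DbarNeumann.R2 => d (DbarNeumann.pt x !₂[y₁, y₂]))) ∧
      ∃ ε : ℝ, 0 < ε ∧ ∀ y₁ y₂ : ℝ, 0 < y₁ → y₁ < ε → 0 < y₂ → y₂ < ε →
        Integrable (fun x : DbarNeumann.R2 =>
          DbarNeumann.oddExt (DbarNeumann.dbar 1 (u 0)) (DbarNeumann.pt x !₂[y₁, y₂])) ∧
        ∀ ξ : DbarNeumann.R2,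
          DbarNeumann.partialFT (DbarNeumann.oddExt (DbarNeumann.dbar 1 (u 0))) ξ !₂[y₁, y₂] =
            DbarNeumann.schwartzPoly n A ξ y₁ y₂ * (Real.log (y₁ ^ 2 + y₂ ^ 2) : ℂ) +
            DbarNeumann.schwartzPoly n B ξ y₁ y₂ +
            DbarNeumann.schwartzPoly n C ξ y₁ y₂ * (Real.arctan (y₁ / y₂) : ℂ) +
            DbarNeumann.partialFT d ξ !₂[y₁, y₂] := by
  have hK := DbarNeumann.uniqueDiffOn_closure_Omega
  obtain ⟨v, S, hv, hv2, hv0, hS, hSf, e, r, hr, α, β, γ, hα, hβ, hγ, ev⟩ :=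
    DbarNeumann.exists_corrector (R := DbarNeumann.dbarData 1 (f 0))
      (DbarNeumann.dec_dbarData 1 fun N => (hf 0).dec hK) n
  set P := DbarNeumann.altPot (DbarNeumann.KO.indicator S)
  have hSd : DbarNeumann.Dec n Set.univ (DbarNeumann.KO.indicator S) :=
    DbarNeumann.Dec.indicator isClosed_closure DbarNeumann.frontier_KO hS hSf
  obtain ⟨A, hA⟩ := hα.partialFT
  obtain ⟨B, hB⟩ := hβ.partialFT
  obtain ⟨C, hC⟩ := hγ.partialFT
  have hd : ∀ y : DbarNeumann.R2, (∀ j, 0 ≤ y j) →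
      Integrable fun x : DbarNeumann.R2 => r (DbarNeumann.pt x y) + P (DbarNeumann.pt x y) :=
    fun y hy => (hr.dec0.integrable_slice hy).add (DbarNeumann.integrable_altPot_slice hSd.dec0 y)
  -- The regular part consists of the remainder of the corrector and the potential of the flat
  -- residual.
  refine ⟨A, B, C, fun z => r z + P z,
    hr.contDiffOn.add (DbarNeumann.contDiff_altPot hSd).contDiffOn, fun y₁ y₂ h₁ h₂ => ?_,
    -- With `y₁, y₂ < 1 / 2` one has `y₁² + y₂² ≤ 1`, where the radial cutoff equals one.
    1 / 2, by norm_num, fun y₁ y₂ h₁ h₁' h₂ h₂' => ?_⟩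
  · refine hd _ fun j => ?_
    fin_cases j
    exacts [h₁.le, h₂.le]
  · set y : DbarNeumann.R2 := !₂[y₁, y₂]
    have hy : ∀ j, 0 < y j := fun j => by
      fin_cases j
      exacts [h₁, h₂]
    set l : ℂ := (Real.log (y₁ ^ 2 + y₂ ^ 2) : ℂ)
    set t : ℂ := (Real.arctan (y₁ / y₂) : ℂ)
    have hw : ∀ x, DbarNeumann.oddExt (DbarNeumann.dbar 1 (u 0)) (DbarNeumann.pt x y) =
        α (DbarNeumann.pt x y) * l + β (DbarNeumann.pt x y) + γ (DbarNeumann.pt x y) * t +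
          (r (DbarNeumann.pt x y) + P (DbarNeumann.pt x y)) := fun x => by
      have hz : DbarNeumann.zc (DbarNeumann.pt x y) = ⟨y₂, y₁⟩ := rfl
      have hn : Complex.normSq ⟨y₂, y₁⟩ = y₁ ^ 2 + y₂ ^ 2 := by
        rw [Complex.normSq_mk]; ring
      have hcut : DbarNeumann.cutC ⟨y₂, y₁⟩ = 1 := DbarNeumann.cutC_eq_one (by rw [hn]; nlinarith)
      rw [DbarNeumann.oddExt_pt x hy, DbarNeumann.dbar_eq_corrector_add_altPot hf hu hv hv2 hv0 hS hSf
        e (show DbarNeumann.pt x y ∈ DbarNeumann.Omega from hy), ev, hz, hcut, hn,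
        DbarNeumann.arg_eq_arctan h₂]
      ring
    have iα := hα.integrable y
    have iβ := hβ.integrable y
    have iγ := hγ.integrable y
    have ir := hd y fun j => (hy j).le
    refine ⟨?_, fun ξ => ?_⟩
    · simp only [hw]
      exact (((iα.mul_const l).add iβ).add (iγ.mul_const t)).add ir
    · rw [← show y 0 = y₁ from rfl, ← show y 1 = y₂ from rfl, ← hA, ← hB, ← hC]
      have jα := DbarNeumann.integrable_exp_mul iα ξ
      have jβ := DbarNeumann.integrable_exp_mul iβ ξ
      have jγ := DbarNeumann.integrable_exp_mul iγ ξ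
      have jr := DbarNeumann.integrable_exp_mul ir ξ
      simp only [DbarNeumann.partialFT, ← integral_mul_const]
      have j₁ := (jα.mul_const l).fun_add jβ
      have j₂ := j₁.fun_add (jγ.mul_const t)
      rw [← integral_add (jα.mul_const l) jβ, ← integral_add j₁ (jγ.mul_const t),
        ← integral_add j₂ jr]
      refine integral_congr_ae (Filter.Eventually.of_forall fun x => ?_)
      simp only [hw]
      ring
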